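/- For positive integers $q,n$ let $r_q\colon S_n\to\mathbb{N}_0$, $r_q(\pi)=\#\{\sigma\in S_n:\sigma^q=\pi\}$, be the $q$-th root number function. For a partition $\lambda=(\lambda_1\ge\dots\ge\lambda_l)\vdash n$ let $\chi_\lambda$ be the irreducible complex character of $S_n$ corresponding to $\lambda$, let $m^{(q)}_{\chi_\lambda}=\langle r_q,\chi_\lambda\rangle=\frac1{n!}\sum_{\pi\in S_n}r_q(\pi)\overline{\chi_\lambda(\pi)}$ be its multiplicity in $r_q$, and write $\lambda\backslash\lambda_1=(\lambda_2,\dots,\lambda_l)$. Let $\sigma_k(q)=\sum_{d\mid q}d^k$. Theorem. Let $q\in\mathbb{N}$ be sufficiently large, let $\Delta$ be a positive integer with $\Delta\le\frac{\log q}{\log 2}$, and let $n\ge\Delta q$ be an integer. Then, for all partitions $\lambda\vdash n$ and $\mu\vdash\Delta$ with $\lambda\backslash\lambda_1=\mu$, \[ m^{(q)}_{\chi_\lambda}=\begin{cases} \sigma_0(q)+O(1)&\text{if }\Delta=1,\\ \frac12\sigma_1(q)+O\left(\sigma_0(q)^2\right)&\text{if }\Delta=2,\\ \frac{\chi_\mu(1)}{6}\sigma_2(q)+O\left(\sigma_0(q)\sigma_1(q)\right)&\text{if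 }\Delta=3,\\ \frac{\chi_\mu(1)}{\Delta!}\sigma_{\Delta-1}(q)+O\left(\frac{\chi_\mu(1)}{\Delta!}\,q^{\Delta-2}\left(\Delta\,\sigma_0(q)+2^{\Delta}\right)\right)&\text{if }\Delta\ge4. \end{cases} \] The constants implied by $O$, and the threshold beyond which $q$ is sufficiently large, are absolute: they depend on none of $q,\Delta,n,\lambda,\mu$. -/

import Mathlib

noncomputable section

namespace RootNumber

/-- The parts of a partition `lam` of `n` as a weakly decreasing sequence
`(lam_1, lam_2, ..., lam_l)`. -/
def rows {n : ℕ} (lam : n.Partition) : List ℕ :=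
  lam.parts.sort (· ≥ ·)

/-- The cell (row index, column index), both counted from `0`, that contains the entry `k` when the
rows of lengths `l = [l_1, l_2, ...]` are filled one after the other, each from left to right, with
`0, 1, 2, ...`. (Entries `k ≥ l.sum` never occur below.) -/
def cell : List ℕ → ℕ → ℕ × ℕ
  | [], k => (0, k)
  | a :: l, k => if k < a then (0, k) else ((cell l (k - a)).1 + 1, (cell l (k - a)).2)

/-- The row stabilizer of the row-by-row tableau of shape `lam`. -/
def rowGroup {n : ℕ} (lam : n.Partition) : Set (Equiv.Perm (Fin n)) :=
  {s | ∀ k : Fin n, (cell (rows lam) (s k)).1 = (cell (rows lam) k).1}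

/-- The column stabilizer of the row-by-row tableau of shape `lam`. -/
def colGroup {n : ℕ} (lam : n.Partition) : Set (Equiv.Perm (Fin n)) :=
  {s | ∀ k : Fin n, (cell (rows lam) (s k)).2 = (cell (rows lam) k).2}

open scoped Classical in
/-- The row symmetrizer `∑_{s ∈ R} s` in the group algebra `ℂ[S_n]`. -/
def rowSymmetrizer {n : ℕ} (lam : n.Partition) : MonoidAlgebra ℂ (Equiv.Perm (Fin n)) :=
  ∑ s : Equiv.Perm (Fin n) with s ∈ rowGroup lam, MonoidAlgebra.single s 1

open scoped Classical in
/-- The column antisymmetrizer `∑_{s ∈ C} sgn(s) s` in the group algebra `ℂ[S_n]`. -/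
def colAntisymmetrizer {n : ℕ} (lam : n.Partition) : MonoidAlgebra ℂ (Equiv.Perm (Fin n)) :=
  ∑ s : Equiv.Perm (Fin n) with s ∈ colGroup lam,
    MonoidAlgebra.single s ((Equiv.Perm.sign s : ℤ) : ℂ)

/-- The Young symmetrizer of `lam`. -/
def youngSymmetrizer {n : ℕ} (lam : n.Partition) : MonoidAlgebra ℂ (Equiv.Perm (Fin n)) :=
  rowSymmetrizer lam * colAntisymmetrizer lam

/-- The Specht module of `lam`: the left ideal of `ℂ[S_n]` generated by the Young symmetrizer. -/
abbrev Specht {n : ℕ} (lam : n.Partition) :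
    Submodule (MonoidAlgebra ℂ (Equiv.Perm (Fin n))) (MonoidAlgebra ℂ (Equiv.Perm (Fin n))) :=
  Submodule.span (MonoidAlgebra ℂ (Equiv.Perm (Fin n))) {youngSymmetrizer lam}

/-- The representation of `S_n` on the Specht module of `lam`, by left multiplication. -/
def spechtRep {n : ℕ} (lam : n.Partition) :
    Representation ℂ (Equiv.Perm (Fin n)) (Specht lam) :=
  ((Algebra.lsmul ℂ ℂ (Specht lam) :
      MonoidAlgebra ℂ (Equiv.Perm (Fin n)) →ₐ[ℂ] Module.End ℂ (Specht lam)) :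
    MonoidAlgebra ℂ (Equiv.Perm (Fin n)) →* Module.End ℂ (Specht lam)).comp
    (MonoidAlgebra.of ℂ (Equiv.Perm (Fin n)))

/-- `χ_lam`, the irreducible character of `S_n` that corresponds to the partition `lam`. -/
def chi {n : ℕ} (lam : n.Partition) (g : Equiv.Perm (Fin n)) : ℂ :=
  (spechtRep lam).character g

/-- The scalar product `⟨f, g⟩ = |G|⁻¹ ∑_x f(x) conj (g(x))` of complex functions on a finite
group. -/
def innerProd {G : Type*} [Fintype G] (f g : G → ℂ) : ℂ :=
  (Fintype.card G : ℂ)⁻¹ * ∑ x : G, f x * (starRingEnd ℂ) (g x)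

/-- The `q`-th root number function of `S_n`. -/
def rootNumber (n q : ℕ) (p : Equiv.Perm (Fin n)) : ℕ :=
  Nat.card {s : Equiv.Perm (Fin n) // s ^ q = p}

/-- The multiplicity of `χ_lam` in the `q`-th root number function of `S_n`. -/
def multiplicity (q : ℕ) {n : ℕ} (lam : n.Partition) : ℂ :=
  innerProd (fun p => (rootNumber n q p : ℂ)) (chi lam)

end RootNumber

end

/-!
The multiplicity of `χ_λ` in the root number function is the mean value of `χ_λ (σ ^ q)` over
`σ ∈ S_n` (`multiplicity_eq`). For a partition `λ = (m, μ)` with `m ≥ Δ = |μ|`, the character is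
`χ_λ(π) = (1 / Δ!) ∑_t χ_μ(t) ∑_V (-1)^|V| N(t, V, π)` (`chi_eq_charPoly`), where `t` runs over `S_Δ`,
`V` over the sets of cycles of `t`, and `N(t, V, π)` is the number of embeddings of the points
outside `V` that intertwine `t` and `π`. The term `t = 1`, `V = ∅` gives `χ_μ(1)` times the number
`Q(π)` of `Δ`-element sets of fixed points of `π`. As `|χ_μ| ≤ χ_μ(1)`, and the images of the
embeddings are invariant under `π`, all other terms together are at most `χ_μ(1) (U(π) - Q(π))`,
where `U(π)` is the number of `π`-invariant sets of at most `Δ` elements (`norm_charPoly_sub_le`).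
So it suffices to bound the mean of `Q(σ ^ q)` from below and that of `U(σ ^ q)` from above, both
by `σ_{Δ-1}(q) / Δ!` up to the error term (`norm_multiplicity_sub_le`).

The formula for the character comes from Young symmetrizers. If `a` and `b` are the row symmetrizer
and the column antisymmetrizer, then `a z b` is a multiple of `a b` for every `z`
(`exists_rowSymmetrizer_mul_single_mul`). This determines traces on the Specht module, and shows
that characters have norm one (`sum_chi_mul_chi`) and are real (`conj_chi`). Both sides of the
formula are then real functions of norm one (`sum_charPoly_mul_self`), and their scalar product is
one as well, so that they coincide. For the scalar product, the terms with `V ≠ ∅` vanish because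
more than `m` points cannot lie in different columns (`sum_ite_intertwines_chi`), and those with
`V = ∅` are evaluated by the Young symmetrizers of `λ` and `μ` (`sum_chi_mul_sum_chi_glue`).

For the lower bound, take only the sets of fixed points of `σ ^ q` inside one cycle of `σ`, of a
length `d` that divides `q` (`le_sum_embCount_one`). For the upper bound, mark a point of an
invariant set of size `k` and remove the cycle of `σ` through it. The set meets the cycle in a union
of cosets of a subgroup of `ZMod d` (`cycCount_le`), and the rest is an invariant set for a random
permutation of fewer points. So the mean numbers are bounded by the solution `invBound q k` of
`k p_k = ∑_j c_j p_{k-j}` with `c_j = ∑_{i ∣ j} σ_{i-1}(q) / (i-1)!` (`sum_invCount_le`).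

After normalization, this becomes `π_k = β_k + (1/q) ∑_j (k-1 choose j-1) β_j π_{k-j}`
(`normalized_invBound_succ`), where `β_j` is essentially `∑_{d ∣ q} d^{1-j}`: at most `σ_0(q)` for
`j = 1`, at most `O(σ_0(q)^{1/2})` for `j = 2`, and bounded for `j ≥ 3`. As `2^Δ ≤ q` and `σ_0(q)`
is smaller than any power of `q` (`exists_sigma_zero_pow_le`), an induction yields a crude estimate
(`recursion_le`), and substituting it once yields `π_k = β_k + O((k σ_0(q) + 2^k) / q)`
(`recursion_le_refined`), which is the error term of the theorem for `Δ ≥ 4`. For `Δ ≤ 3` the bounds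
are computed directly.
-/

/-! ### Traces on left ideals of a group algebra -/

namespace RootNumber
open MonoidAlgebra LinearMap

section GroupAlgebra
variable {G : Type*} [Group G] [Fintype G]

theorem trace_mulLeft_single_comp_mulRight (g : G) (e : MonoidAlgebra ℂ G) :
    trace ℂ _ (mulLeft ℂ (single g (1 : ℂ)) ∘ₗ mulRight ℂ e) =
      ∑ h : G, e.coeff (h⁻¹ * g⁻¹ * h) := by
  classical
  rw [trace_eq_matrix_trace ℂ (MonoidAlgebra.basis G ℂ), Matrix.trace]
  refine Finset.sum_congr rfl fun h _ => ?_
  rw [Matrix.diag_apply, LinearMap.toMatrix_apply]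
  have : (MonoidAlgebra.basis G ℂ) h = single h 1 := by
    simp [MonoidAlgebra.basis]
  rw [this]
  change (((single g (1:ℂ)) * ((single h 1) * e)).coeff) h = _
  rw [← mul_assoc, single_mul_single, one_mul]
  have := MonoidAlgebra.coeff_single_mul_eq_mul_coeff (x := e) (m := g * h) (m₁ := h) (r := (1 : ℂ))
    (h⁻¹ * g⁻¹ * h) (fun m' _ => by
      constructor
      · intro H
        have : m' = (g * h)⁻¹ * h := eq_inv_mul_of_mul_eq H
        rw [this, mul_inv_rev]
      · rintro rfl; group)
  rw [this, one_mul]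

/-- If `e * e = κ e`, then right multiplication by `e` maps the group algebra onto the left ideal
of `e` and is multiplication by `κ` there. So traces on the ideal are traces on the group
algebra. -/
theorem trace_lsmul_span {e : MonoidAlgebra ℂ G} {κ : ℂ} (he : e * e = κ • e) (hκ : κ ≠ 0)
    (x : MonoidAlgebra ℂ G) :
    trace ℂ (Submodule.span (MonoidAlgebra ℂ G) {e})
        (Algebra.lsmul ℂ ℂ (Submodule.span (MonoidAlgebra ℂ G) {e}) x) =
      κ⁻¹ * trace ℂ _ (mulLeft ℂ x ∘ₗ mulRight ℂ e) := by
  set S := Submodule.span (MonoidAlgebra ℂ G) {e}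
  let p : MonoidAlgebra ℂ G →ₗ[ℂ] S :=
    (mulRight ℂ e).codRestrict (S.restrictScalars ℂ) (fun z => by
      exact Submodule.smul_mem S z (Submodule.mem_span_singleton_self e))
  let i : S →ₗ[ℂ] MonoidAlgebra ℂ G := (S.restrictScalars ℂ).subtype
  have hfix : ∀ s : S, (s : MonoidAlgebra ℂ G) * e = κ • (s : MonoidAlgebra ℂ G) := by
    rintro ⟨s, hs⟩
    obtain ⟨z, rfl⟩ := Submodule.mem_span_singleton.1 hs
    simp only [smul_eq_mul]
    rw [mul_assoc, he, mul_smul_comm]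
  have h1 : (p ∘ₗ (mulLeft ℂ x ∘ₗ i)) = κ • Algebra.lsmul ℂ ℂ S x := by
    ext s
    change ((x * (s : MonoidAlgebra ℂ G)) * e).coeff _ = (κ • (x * (s : MonoidAlgebra ℂ G))).coeff _
    rw [mul_assoc, hfix, mul_smul_comm]
  have h2 := trace_comp_comm' (mulLeft ℂ x ∘ₗ i) p
  rw [h1, map_smul, smul_eq_mul] at h2
  rw [eq_inv_mul_iff_mul_eq₀ hκ, h2]
  rfl

/-- `trace (z ↦ a x z a b)`, computed by the cyclicity of the trace: the rank one map
`z ↦ a z b` is moved to the right. -/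
theorem trace_mulLeft_comp_mulRight_mul {a b : MonoidAlgebra ℂ G}
    (c : MonoidAlgebra ℂ G →ₗ[ℂ] ℂ) (hc : ∀ z, a * z * b = c z • (a * b))
    (x : MonoidAlgebra ℂ G) :
    trace ℂ _ (mulLeft ℂ (a * x) ∘ₗ mulRight ℂ (a * b)) = c (x * a * b * a) := by
  have h1 : mulLeft ℂ (a * x) ∘ₗ mulRight ℂ (a * b) =
      (mulLeft ℂ a ∘ₗ mulRight ℂ b) * (mulLeft ℂ x ∘ₗ mulRight ℂ a) := by
    ext; simp [mul_assoc]
  have h2 : (mulLeft ℂ x ∘ₗ mulRight ℂ a) * (mulLeft ℂ a ∘ₗ mulRight ℂ b) =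
      c.smulRight (x * a * b * a) := by
    refine LinearMap.ext fun z => ?_
    change x * (a * (z * b) * a) = c z • (x * a * b * a)
    rw [← mul_assoc a z b, hc]
    simp [mul_assoc]
  rw [h1, trace_mul_comm, h2, trace_smulRight]

/-- If `z ↦ a z b` maps the basis to multiples of `a b`, it is a rank one map. -/
theorem exists_functional_of_forall_single {a b : MonoidAlgebra ℂ G}
    (h : ∀ g : G, ∃ t : ℂ, a * single g 1 * b = t • (a * b)) :
    ∃ c : MonoidAlgebra ℂ G →ₗ[ℂ] ℂ, ∀ z, a * z * b = c z • (a * b) := by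
  choose t ht using h
  refine ⟨(MonoidAlgebra.basis G ℂ).constr ℂ t, fun z => ?_⟩
  have : (mulLeft ℂ a ∘ₗ mulRight ℂ b) =
      ((MonoidAlgebra.basis G ℂ).constr ℂ t).smulRight (a * b) := by
    refine (MonoidAlgebra.basis G ℂ).ext fun g => ?_
    have hg : (MonoidAlgebra.basis G ℂ) g = single g 1 := by simp [MonoidAlgebra.basis]
    rw [smulRight_apply, Module.Basis.constr_basis, hg, ← ht, mul_assoc]
    rfl
  have := congrArg (fun f => f z) this
  simpa [mul_assoc] using this

/-- A quasi-idempotent `e` with `e(1) = 1` has a nonzero scalar: otherwise right multiplication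
by `e` would be nilpotent of trace `|G|`. -/
theorem ne_zero_of_mul_self_eq_smul {e : MonoidAlgebra ℂ G} {κ : ℂ} (he : e * e = κ • e)
    (h1 : e.coeff 1 = 1) : κ ≠ 0 := by
  rintro rfl
  have hn : IsNilpotent (mulRight ℂ e) := by
    refine ⟨2, LinearMap.ext fun z => ?_⟩
    rw [pow_two]
    change z * e * e = 0
    rw [mul_assoc, he, zero_smul, mul_zero]
  have h2 := LinearMap.isNilpotent_trace_of_isNilpotent hn
  have h3 := trace_mulLeft_single_comp_mulRight 1 e
  have h4 : mulLeft ℂ (single (1 : G) (1 : ℂ)) ∘ₗ mulRight ℂ e = mulRight ℂ e := by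
    refine LinearMap.ext fun z => ?_
    change (1 : MonoidAlgebra ℂ G) * _ = _
    rw [one_mul]
  rw [h4] at h3
  rw [h3] at h2
  simp [h1] at h2

/-- The eigenvalues of an endomorphism of finite order are roots of unity. -/
theorem norm_trace_le_of_pow_eq_one {V : Type*} [AddCommGroup V] [Module ℂ V]
    [FiniteDimensional ℂ V] {f : Module.End ℂ V} {N : ℕ} (hN : N ≠ 0) (hf : f ^ N = 1) :
    ‖trace ℂ V f‖ ≤ Module.finrank ℂ V := by
  rw [Module.End.trace_eq_sum_roots_charpoly_of_splits (IsAlgClosed.splits _)]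
  refine (norm_multiset_sum_le _).trans ?_
  have h : ∀ z ∈ f.charpoly.roots, ‖z‖ = 1 := by
    intro z hz
    have hz' : f.HasEigenvalue z := by
      rw [Module.End.hasEigenvalue_iff_isRoot_charpoly]
      exact Polynomial.isRoot_of_mem_roots hz
    obtain ⟨v, hv⟩ := hz'.exists_hasEigenvector
    have := hv.pow_apply N
    rw [hf] at this
    have h1 : z ^ N = 1 := by
      have h2 : (z ^ N - 1) • v = 0 := by
        rw [sub_smul, ← this]; simp
      rcases smul_eq_zero.1 h2 with h | h
      · exact sub_eq_zero.1 h
      · exact absurd h hv.2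
    exact Complex.norm_eq_one_of_pow_eq_one h1 hN
  rw [Multiset.map_congr rfl h, Multiset.map_const', Multiset.sum_replicate, nsmul_eq_mul, mul_one]
  exact_mod_cast (Polynomial.card_roots' _).trans (LinearMap.charpoly_natDegree f).le

end GroupAlgebra
end RootNumber

/-! ### Young symmetrizers and Specht characters -/

namespace RootNumber
open MonoidAlgebra (single single_mul_single coeff_smul_apply smul_single)
open LinearMap

theorem perm_apply_inv {α : Type*} (f : Equiv.Perm α) (x : α) : f (f⁻¹ x) = x :=
  f.apply_symm_apply x

theorem perm_inv_apply {α : Type*} (f : Equiv.Perm α) (x : α) : f⁻¹ (f x) = x :=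
  f.symm_apply_apply x

theorem cell_spec {l : List ℕ} {k : ℕ} (hk : k < l.sum) :
    ∃ h : (cell l k).1 < l.length, (cell l k).2 < l[(cell l k).1] := by
  induction l generalizing k with
  | nil => simp at hk
  | cons a l ih =>
    by_cases h : k < a
    · simp [cell, h]
    · rw [List.sum_cons] at hk
      obtain ⟨h1, h2⟩ := ih (k := k - a) (by omega)
      simp only [cell, h, if_false]
      exact ⟨by simpa using h1, by simpa using h2⟩

theorem cell_injOn {l : List ℕ} {k k' : ℕ} (hk : k < l.sum) (hk' : k' < l.sum)
    (h : cell l k = cell l k') : k = k' := by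
  induction l generalizing k k' with
  | nil => simp at hk
  | cons a l ih =>
    rw [List.sum_cons] at hk hk'
    by_cases h1 : k < a <;> by_cases h2 : k' < a <;> simp [cell, h1, h2] at h
    · exact h
    · have := ih (k := k - a) (k' := k' - a) (by omega) (by omega) (Prod.ext h.1 h.2)
      omega

theorem exists_cell_eq {l : List ℕ} {i j : ℕ} (hi : i < l.length) (hj : j < l[i]) :
    ∃ k < l.sum, cell l k = (i, j) := by
  induction l generalizing i with
  | nil => simp at hi
  | cons a l ih =>
    cases i with
    | zero => exact ⟨j, by simp at hj ⊢; omega, by simp at hj; simp [cell, hj]⟩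
    | succ i =>
      obtain ⟨k, hk, h⟩ := ih (i := i) (by simpa using hi) (by simpa using hj)
      exact ⟨a + k, by simp; omega, by simp [cell, h]⟩

variable {n : ℕ} (lam : n.Partition)

theorem rows_sum : (rows lam).sum = n := by
  rw [rows, ← Multiset.sum_coe, Multiset.sort_eq, lam.parts_sum]

theorem rows_sortedGE : (rows lam).SortedGE :=
  List.sortedGE_iff_pairwise.2 (Multiset.pairwise_sort _ _)

/-- The row of the entry `k` in the row-by-row tableau. -/
def row (k : Fin n) : ℕ := (cell (rows lam) k).1

/-- The column of the entry `k` in the row-by-row tableau. -/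
def col (k : Fin n) : ℕ := (cell (rows lam) k).2

theorem lt_rows_sum (k : Fin n) : (k : ℕ) < (rows lam).sum := by
  rw [rows_sum]; exact k.2

variable {lam} in
theorem eq_of_row_eq_of_col_eq {k k' : Fin n} (h1 : row lam k = row lam k')
    (h2 : col lam k = col lam k') : k = k' :=
  Fin.ext (cell_injOn (lt_rows_sum lam k) (lt_rows_sum lam k') (Prod.ext h1 h2))

/-- A cell lies in the diagram if and only if its hook number
`(lam_i - i) + (lam'_j - j) - 1` is positive. The hook number is a function of the row plus a
function of the column. -/
theorem exists_weight : ∃ u v : ℕ → ℤ, ∀ i j : ℕ,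
    0 < u i + v j ↔ ∃ k : Fin n, row lam k = i ∧ col lam k = j := by
  set D := YoungDiagram.ofRowLens (rows lam) (rows_sortedGE lam)
  refine ⟨fun i => D.rowLen i - i, fun j => D.colLen j - j - 1, fun i j => ?_⟩
  have h1 : (i, j) ∈ D ↔ j < D.rowLen i := YoungDiagram.mem_iff_lt_rowLen
  have h2 : (i, j) ∈ D ↔ i < D.colLen j := YoungDiagram.mem_iff_lt_colLen
  have h3 : (i, j) ∈ D ↔ ∃ k : Fin n, row lam k = i ∧ col lam k = j := by
    rw [YoungDiagram.mem_ofRowLens]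
    constructor
    · rintro ⟨hi, hj⟩
      obtain ⟨k, hk, h⟩ := exists_cell_eq hi hj
      rw [rows_sum] at hk
      exact ⟨⟨k, hk⟩, congrArg Prod.fst h, congrArg Prod.snd h⟩
    · rintro ⟨k, rfl, rfl⟩
      exact cell_spec (lt_rows_sum lam k)
  rw [← h3]
  by_cases h : (i, j) ∈ D
  · have := h1.1 h
    have := h2.1 h
    simp only [h, iff_true]
    omega
  · have := mt h1.2 h
    have := mt h2.2 h
    simp only [h, iff_false]
    omega

/-- If no two entries of one row of the tableau `T` lie in one column of `g T`, then `g` is a row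
permutation times a column permutation. The cells `(row x, col (g⁻¹ x))` are distinct, and the sum
of their hook numbers is the same as for the cells of the diagram, which are those of positive hook
number: so they are the cells of the diagram. -/
theorem exists_mul_of_forall_ne (g : Equiv.Perm (Fin n))
    (h : ∀ i j, i ≠ j → row lam i = row lam j → col lam (g⁻¹ i) ≠ col lam (g⁻¹ j)) :
    ∃ r ∈ rowGroup lam, ∃ c ∈ colGroup lam, g = r * c := by
  classical
  obtain ⟨u, v, huv⟩ := exists_weight lam
  let S : Finset (ℕ × ℕ) := Finset.univ.image fun x => (row lam x, col lam (g⁻¹ x))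
  let D : Finset (ℕ × ℕ) := Finset.univ.image fun x => (row lam x, col lam x)
  have hSinj : Function.Injective fun x => (row lam x, col lam (g⁻¹ x)) := by
    intro x y hxy
    by_contra hne
    exact h x y hne (Prod.ext_iff.1 hxy).1 (Prod.ext_iff.1 hxy).2
  have hDinj : Function.Injective fun x => (row lam x, col lam x) := fun x y hxy =>
    eq_of_row_eq_of_col_eq (Prod.ext_iff.1 hxy).1 (Prod.ext_iff.1 hxy).2
  let w : ℕ × ℕ → ℤ := fun p => u p.1 + v p.2
  have hw : ∀ p, 0 < w p ↔ p ∈ D := by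
    rintro ⟨i, j⟩
    rw [huv]
    simp [D]
  have hsum : ∑ p ∈ S, w p = ∑ p ∈ D, w p := by
    rw [Finset.sum_image hSinj.injOn, Finset.sum_image hDinj.injOn]
    simp only [w, Finset.sum_add_distrib]
    congr 1
    exact Equiv.sum_comp g⁻¹ (fun x => v (col lam x))
  have hDS : D ⊆ S := by
    by_contra hns
    obtain ⟨p, hp⟩ := Finset.sdiff_nonempty.2 hns
    have h1 : ∑ p ∈ S \ D, w p ≤ 0 := Finset.sum_nonpos fun p hp => by
      have := mt (hw p).1 (Finset.mem_sdiff.1 hp).2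
      omega
    have h2 : 0 < ∑ p ∈ D \ S, w p := Finset.sum_pos
      (fun p hp => (hw p).2 (Finset.mem_sdiff.1 hp).1) ⟨p, hp⟩
    have h3 := Finset.sum_sdiff_sub_sum_sdiff (s₁ := S) (s₂ := D) (f := w)
    omega
  have hSD : S ⊆ D := (Finset.eq_of_subset_of_card_le hDS (by
    rw [Finset.card_image_of_injective _ hSinj, Finset.card_image_of_injective _ hDinj])).ge
  have hp : ∀ x, ∃ y, row lam y = row lam x ∧ col lam y = col lam (g⁻¹ x) := by
    intro x
    have : (row lam x, col lam (g⁻¹ x)) ∈ D := hSD (Finset.mem_image_of_mem _ (Finset.mem_univ x))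
    obtain ⟨y, -, hy⟩ := Finset.mem_image.1 this
    exact ⟨y, (Prod.ext_iff.1 hy).1, (Prod.ext_iff.1 hy).2⟩
  choose p hp1 hp2 using hp
  have hpinj : Function.Injective p := fun x y hxy => hSinj
    (Prod.ext ((hp1 x).symm.trans (hxy ▸ hp1 y)) ((hp2 x).symm.trans (hxy ▸ hp2 y)))
  let P : Equiv.Perm (Fin n) := Equiv.ofBijective p (Finite.injective_iff_bijective.1 hpinj)
  refine ⟨P⁻¹, fun k => ?_, P * g, fun k => ?_, by group⟩
  · have := hp1 (P⁻¹ k)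
    change row lam (P (P⁻¹ k)) = _ at this
    rw [perm_apply_inv] at this
    exact this.symm
  · have := hp2 (g k)
    rw [perm_inv_apply] at this
    exact this

theorem mul_mem_rowGroup {s t : Equiv.Perm (Fin n)} (hs : s ∈ rowGroup lam)
    (ht : t ∈ rowGroup lam) : s * t ∈ rowGroup lam := fun k => (hs (t k)).trans (ht k)

theorem mul_mem_colGroup {s t : Equiv.Perm (Fin n)} (hs : s ∈ colGroup lam)
    (ht : t ∈ colGroup lam) : s * t ∈ colGroup lam := fun k => (hs (t k)).trans (ht k)

theorem inv_mem_rowGroup {s : Equiv.Perm (Fin n)} (hs : s ∈ rowGroup lam) :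
    s⁻¹ ∈ rowGroup lam := fun k => by
  have := hs (s⁻¹ k)
  rw [perm_apply_inv] at this
  exact this.symm

theorem inv_mem_colGroup {s : Equiv.Perm (Fin n)} (hs : s ∈ colGroup lam) :
    s⁻¹ ∈ colGroup lam := fun k => by
  have := hs (s⁻¹ k)
  rw [perm_apply_inv] at this
  exact this.symm

theorem one_mem_rowGroup : (1 : Equiv.Perm (Fin n)) ∈ rowGroup lam := fun _ => rfl

theorem one_mem_colGroup : (1 : Equiv.Perm (Fin n)) ∈ colGroup lam := fun _ => rfl

theorem swap_mem_rowGroup {i j : Fin n} (h : row lam i = row lam j) :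
    Equiv.swap i j ∈ rowGroup lam := fun k => by
  change row lam _ = row lam _
  rw [Equiv.swap_apply_def]
  split_ifs with h1 h2
  · rw [h1, h]
  · rw [h2, h]
  · rfl

theorem swap_mem_colGroup {i j : Fin n} (h : col lam i = col lam j) :
    Equiv.swap i j ∈ colGroup lam := fun k => by
  change col lam _ = col lam _
  rw [Equiv.swap_apply_def]
  split_ifs with h1 h2
  · rw [h1, h]
  · rw [h2, h]
  · rfl

theorem rowSymmetrizer_mul_single {s : Equiv.Perm (Fin n)} (hs : s ∈ rowGroup lam) :
    rowSymmetrizer lam * single s 1 = rowSymmetrizer lam := by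
  classical
  rw [rowSymmetrizer, Finset.sum_mul]
  refine Finset.sum_bij (fun t _ => t * s) ?_ ?_ ?_ ?_
  · intro t ht
    simp only [Finset.mem_filter, Finset.mem_univ, true_and] at ht ⊢
    exact mul_mem_rowGroup lam ht hs
  · intro t _ t' _ h
    exact mul_right_cancel h
  · intro t ht
    simp only [Finset.mem_filter, Finset.mem_univ, true_and] at ht
    refine ⟨t * s⁻¹, ?_, by group⟩
    simp only [Finset.mem_filter, Finset.mem_univ, true_and]
    exact mul_mem_rowGroup lam ht (inv_mem_rowGroup lam hs)
  · intro t _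
    rw [single_mul_single, one_mul]

theorem single_mul_colAntisymmetrizer {s : Equiv.Perm (Fin n)} (hs : s ∈ colGroup lam) :
    single s 1 * colAntisymmetrizer lam =
      ((Equiv.Perm.sign s : ℤ) : ℂ) • colAntisymmetrizer lam := by
  classical
  rw [colAntisymmetrizer, Finset.mul_sum, Finset.smul_sum]
  refine Finset.sum_bij (fun t _ => s * t) ?_ ?_ ?_ ?_
  · intro t ht
    simp only [Finset.mem_filter, Finset.mem_univ, true_and] at ht ⊢
    exact mul_mem_colGroup lam hs ht
  · intro t _ t' _ h
    exact mul_left_cancel h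
  · intro t ht
    simp only [Finset.mem_filter, Finset.mem_univ, true_and] at ht
    refine ⟨s⁻¹ * t, ?_, by group⟩
    simp only [Finset.mem_filter, Finset.mem_univ, true_and]
    exact mul_mem_colGroup lam (inv_mem_colGroup lam hs) ht
  · intro t _
    rw [single_mul_single, one_mul, smul_single, smul_eq_mul, Equiv.Perm.sign_mul]
    congr 1
    have : ((Equiv.Perm.sign s : ℤ) : ℂ) * ((Equiv.Perm.sign s : ℤ) : ℂ) = 1 := by
      rw [← Int.cast_mul, ← Units.val_mul, Int.units_mul_self]; simp
    push_cast
    rw [← mul_assoc, this, one_mul]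

/-- If `x` absorbs the transposition `(i j)` on the right, and `i`, `j` lie in one column of the
tableau `g T`, then `x g b = x (i j) g b = - x g b`, where `b` is the column antisymmetrizer. -/
theorem mul_single_mul_colAntisymmetrizer_eq_zero {x : MonoidAlgebra ℂ (Equiv.Perm (Fin n))}
    {i j : Fin n} (hij : i ≠ j) (hx : x * single (Equiv.swap i j) 1 = x)
    (g : Equiv.Perm (Fin n)) (h : col lam (g⁻¹ i) = col lam (g⁻¹ j)) :
    x * single g 1 * colAntisymmetrizer lam = 0 := by
  have h1 : Equiv.swap i j * g = g * Equiv.swap (g⁻¹ i) (g⁻¹ j) := by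
    rw [Equiv.mul_swap_eq_swap_mul]; simp
  have h2 : x * single g 1 * colAntisymmetrizer lam =
      -(x * single g 1 * colAntisymmetrizer lam) := by
    conv_lhs => rw [← hx]
    rw [mul_assoc x, single_mul_single, one_mul, h1, ← one_mul (1 : ℂ), ← single_mul_single,
      ← mul_assoc x, mul_assoc _ (single (Equiv.swap _ _) 1),
      single_mul_colAntisymmetrizer lam (swap_mem_colGroup lam h),
      Equiv.Perm.sign_swap (fun hh => hij (g⁻¹.injective hh))]
    simp
  have h3 : (2 : ℂ) • (x * single g 1 * colAntisymmetrizer lam) = 0 := by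
    rw [two_smul]; nth_rewrite 2 [h2]; exact add_neg_cancel _
  exact (smul_eq_zero.1 h3).resolve_left two_ne_zero

/-- Von Neumann: `a g b` is a multiple of `a b` for all `g`, where `a` is the row symmetrizer and
`b` the column antisymmetrizer. It is `± a b` if `g` is a row permutation times a column
permutation, and otherwise two entries of one row of `T` lie in one column of `g T`, and it
is `0`. -/
theorem exists_rowSymmetrizer_mul_single_mul (g : Equiv.Perm (Fin n)) :
    ∃ t : ℂ, rowSymmetrizer lam * single g 1 * colAntisymmetrizer lam =
      t • (rowSymmetrizer lam * colAntisymmetrizer lam) := by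
  by_cases h : ∀ i j, i ≠ j → row lam i = row lam j → col lam (g⁻¹ i) ≠ col lam (g⁻¹ j)
  · obtain ⟨r, hr, c, hc, rfl⟩ := exists_mul_of_forall_ne lam g h
    refine ⟨((Equiv.Perm.sign c : ℤ) : ℂ), ?_⟩
    rw [← one_mul (1 : ℂ), ← single_mul_single, ← mul_assoc, rowSymmetrizer_mul_single lam hr,
      mul_assoc, single_mul_colAntisymmetrizer lam hc, mul_smul_comm]
  · push Not at h
    obtain ⟨i, j, hij, h1, h2⟩ := h
    refine ⟨0, ?_⟩
    rw [zero_smul]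
    exact mul_single_mul_colAntisymmetrizer_eq_zero lam hij
      (rowSymmetrizer_mul_single lam (swap_mem_rowGroup lam h1)) g h2

theorem youngSymmetrizer_coeff_one : (youngSymmetrizer lam).coeff 1 = 1 := by
  classical
  rw [youngSymmetrizer, rowSymmetrizer, colAntisymmetrizer, Finset.sum_mul_sum]
  simp only [single_mul_single, one_mul, MonoidAlgebra.coeff_sum, Finsupp.coe_finsetSum,
    Finset.sum_apply, MonoidAlgebra.coeff_single, Finsupp.single_apply]
  -- the row group and the column group intersect trivially
  have h0 : ∀ r ∈ rowGroup lam, ∀ c ∈ colGroup lam, r * c = 1 → r = 1 := by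
    intro r hr c hc h
    have hrc : r = c⁻¹ := eq_inv_of_mul_eq_one_left h
    have hr' : r ∈ colGroup lam := by rw [hrc]; exact inv_mem_colGroup lam hc
    ext k
    exact congrArg Fin.val (eq_of_row_eq_of_col_eq (lam := lam) (hr k) (hr' k))
  rw [Finset.sum_eq_single_of_mem 1 (by simp [one_mem_rowGroup])]
  · rw [Finset.sum_eq_single_of_mem 1 (by simp [one_mem_colGroup])]
    · simp
    · intro c _ hc
      simp [hc]
  · intro r hr hr1
    refine Finset.sum_eq_zero fun c hc => ?_
    rw [if_neg]
    intro h
    simp only [Finset.mem_filter, Finset.mem_univ, true_and] at hr hc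
    exact hr1 (h0 r hr c hc h)

theorem exists_youngFunctional : ∃ c : MonoidAlgebra ℂ (Equiv.Perm (Fin n)) →ₗ[ℂ] ℂ,
    ∀ z, rowSymmetrizer lam * z * colAntisymmetrizer lam = c z • youngSymmetrizer lam :=
  exists_functional_of_forall_single (exists_rowSymmetrizer_mul_single_mul lam)

/-- The linear functional `c` with `a z b = c(z) a b` for the row symmetrizer `a` and the column
antisymmetrizer `b`. -/
noncomputable def youngFunctional : MonoidAlgebra ℂ (Equiv.Perm (Fin n)) →ₗ[ℂ] ℂ :=
  (exists_youngFunctional lam).choose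

theorem youngFunctional_spec (z : MonoidAlgebra ℂ (Equiv.Perm (Fin n))) :
    rowSymmetrizer lam * z * colAntisymmetrizer lam =
      youngFunctional lam z • youngSymmetrizer lam :=
  (exists_youngFunctional lam).choose_spec z

/-- The scalar `κ` with `e * e = κ e` for the Young symmetrizer `e`. -/
noncomputable def youngScalar : ℂ :=
  youngFunctional lam (colAntisymmetrizer lam * rowSymmetrizer lam)

theorem youngSymmetrizer_mul_self :
    youngSymmetrizer lam * youngSymmetrizer lam = youngScalar lam • youngSymmetrizer lam := by
  rw [youngScalar, ← youngFunctional_spec, youngSymmetrizer]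
  simp only [mul_assoc]

theorem youngScalar_ne_zero : youngScalar lam ≠ 0 :=
  ne_zero_of_mul_self_eq_smul (youngSymmetrizer_mul_self lam) (youngSymmetrizer_coeff_one lam)

/-- The character of the Specht module, extended linearly to the group algebra. -/
noncomputable def spechtTrace (x : MonoidAlgebra ℂ (Equiv.Perm (Fin n))) : ℂ :=
  trace ℂ (Specht lam) (Algebra.lsmul ℂ ℂ (Specht lam) x)

theorem chi_eq_spechtTrace (g : Equiv.Perm (Fin n)) :
    chi lam g = spechtTrace lam (single g 1) := rfl

theorem spechtTrace_sum {ι : Type*} (s : Finset ι)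
    (f : ι → MonoidAlgebra ℂ (Equiv.Perm (Fin n))) :
    spechtTrace lam (∑ i ∈ s, f i) = ∑ i ∈ s, spechtTrace lam (f i) := by
  simp [spechtTrace, map_sum]

theorem spechtTrace_smul (t : ℂ) (x : MonoidAlgebra ℂ (Equiv.Perm (Fin n))) :
    spechtTrace lam (t • x) = t * spechtTrace lam x := by
  simp [spechtTrace]

theorem spechtTrace_mul_comm (x y : MonoidAlgebra ℂ (Equiv.Perm (Fin n))) :
    spechtTrace lam (x * y) = spechtTrace lam (y * x) := by
  simp only [spechtTrace, map_mul]
  exact trace_mul_comm _ _ _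

theorem spechtTrace_eq (x : MonoidAlgebra ℂ (Equiv.Perm (Fin n))) :
    spechtTrace lam x = (youngScalar lam)⁻¹ *
      trace ℂ _ (mulLeft ℂ x ∘ₗ mulRight ℂ (youngSymmetrizer lam)) :=
  trace_lsmul_span (youngSymmetrizer_mul_self lam) (youngScalar_ne_zero lam) x

theorem spechtTrace_rowSymmetrizer_mul (x : MonoidAlgebra ℂ (Equiv.Perm (Fin n))) :
    spechtTrace lam (rowSymmetrizer lam * x) = (youngScalar lam)⁻¹ *
      youngFunctional lam (x * rowSymmetrizer lam * colAntisymmetrizer lam *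
        rowSymmetrizer lam) := by
  rw [spechtTrace_eq, youngSymmetrizer,
    trace_mulLeft_comp_mulRight_mul (youngFunctional lam) (youngFunctional_spec lam)]

theorem spechtTrace_youngSymmetrizer :
    spechtTrace lam (youngSymmetrizer lam) = youngScalar lam := by
  rw [youngSymmetrizer, spechtTrace_rowSymmetrizer_mul]
  have h : youngFunctional lam (colAntisymmetrizer lam * rowSymmetrizer lam *
      colAntisymmetrizer lam * rowSymmetrizer lam) • youngSymmetrizer lam =
      (youngScalar lam * youngScalar lam) • youngSymmetrizer lam := by
    rw [← youngFunctional_spec, mul_smul, ← youngSymmetrizer_mul_self, ← mul_smul_comm,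
      ← youngSymmetrizer_mul_self, youngSymmetrizer]
    simp only [mul_assoc]
  have h1 := congrArg (fun x => x.coeff 1) h
  simp only [coeff_smul_apply, youngSymmetrizer_coeff_one, smul_eq_mul, mul_one] at h1
  rw [h1, inv_mul_cancel_left₀ (youngScalar_ne_zero lam)]

theorem chi_eq_sum (g : Equiv.Perm (Fin n)) : chi lam g = (youngScalar lam)⁻¹ *
    ∑ h : Equiv.Perm (Fin n), (youngSymmetrizer lam).coeff (h⁻¹ * g⁻¹ * h) := by
  rw [chi_eq_spechtTrace, spechtTrace_eq, trace_mulLeft_single_comp_mulRight]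

theorem chi_conj (g h : Equiv.Perm (Fin n)) : chi lam (h * g * h⁻¹) = chi lam g :=
  (spechtRep lam).char_conj g h

/-- Every permutation is conjugate to its inverse. -/
theorem eq_inv_of_conj_invariant {R : Type*} {F : Equiv.Perm (Fin n) → R}
    (hF : ∀ g h, F (h * g * h⁻¹) = F g) (g : Equiv.Perm (Fin n)) : F g⁻¹ = F g := by
  obtain ⟨c, hc⟩ := isConj_iff.1 (Equiv.Perm.isConj_iff_cycleType_eq.2
    (Equiv.Perm.cycleType_inv g).symm)
  rw [← hc, hF]

/-- Pairing with `χ` amounts to evaluating a class function at the Young symmetrizer. -/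
theorem sum_chi_mul {F : Equiv.Perm (Fin n) → ℂ} (hF : ∀ g h, F (h * g * h⁻¹) = F g) :
    ∑ g, chi lam g * F g =
      (youngScalar lam)⁻¹ * (n.factorial * ∑ g, (youngSymmetrizer lam).coeff g * F g) := by
  simp_rw [chi_eq_sum, mul_assoc, ← Finset.mul_sum]
  congr 1
  simp_rw [Finset.sum_mul]
  rw [Finset.sum_comm]
  have : ∀ h : Equiv.Perm (Fin n),
      ∑ g, (youngSymmetrizer lam).coeff (h⁻¹ * (g⁻¹ * h)) * F g =
        ∑ g, (youngSymmetrizer lam).coeff g * F g := by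
    intro h
    rw [← Equiv.sum_comp (MulAut.conj h).toEquiv, ← Equiv.sum_comp (Equiv.inv _)]
    refine Finset.sum_congr rfl fun g _ => ?_
    simp only [Equiv.inv_apply, MulEquiv.toEquiv_eq_coe, EquivLike.coe_coe, MulAut.conj_apply]
    rw [hF, eq_inv_of_conj_invariant hF]
    congr 2
    group
  rw [Finset.sum_congr rfl fun h _ => this h, Finset.sum_const, Finset.card_univ, Fintype.card_perm,
    Fintype.card_fin, nsmul_eq_mul]

theorem sum_coeff_mul_chi (x : MonoidAlgebra ℂ (Equiv.Perm (Fin n))) :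
    ∑ g, x.coeff g * chi lam g = spechtTrace lam x := by
  have : x = ∑ g, x.coeff g • single g (1 : ℂ) := by
    ext g
    classical
    simp [MonoidAlgebra.coeff_sum]
  conv_rhs => rw [this]
  rw [spechtTrace_sum]
  exact Finset.sum_congr rfl fun g _ => by rw [spechtTrace_smul, chi_eq_spechtTrace]

/-- The norm of an irreducible character is one; as the characters are real, no conjugate is
needed. -/
theorem sum_chi_mul_chi : ∑ g, chi lam g * chi lam g = n.factorial := by
  rw [sum_chi_mul lam (chi_conj lam), sum_coeff_mul_chi, spechtTrace_youngSymmetrizer]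
  field_simp [youngScalar_ne_zero lam]

theorem chi_one : chi lam 1 = Module.finrank ℂ (Specht lam) :=
  (spechtRep lam).char_one

theorem norm_chi_le (g : Equiv.Perm (Fin n)) : ‖chi lam g‖ ≤ ‖chi lam 1‖ := by
  rw [chi_one]
  have h : (spechtRep lam g) ^ (orderOf g) = 1 := by
    rw [← map_pow, pow_orderOf_eq_one, map_one]
  rw [Complex.norm_natCast]
  exact norm_trace_le_of_pow_eq_one (orderOf_pos g).ne' h

theorem conj_coeff_mul {G : Type*} [Group G] {x y : MonoidAlgebra ℂ G}
    (hx : ∀ g, starRingEnd ℂ (x.coeff g) = x.coeff g)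
    (hy : ∀ g, starRingEnd ℂ (y.coeff g) = y.coeff g) (g : G) :
    starRingEnd ℂ ((x * y).coeff g) = (x * y).coeff g := by
  classical
  rw [MonoidAlgebra.coeff_mul, Finsupp.sum, map_sum]
  refine Finset.sum_congr rfl fun a _ => ?_
  rw [Finsupp.sum, map_sum]
  refine Finset.sum_congr rfl fun b _ => ?_
  split_ifs
  · rw [map_mul, hx, hy]
  · rw [map_zero]

theorem conj_youngSymmetrizer_coeff (g : Equiv.Perm (Fin n)) :
    starRingEnd ℂ ((youngSymmetrizer lam).coeff g) = (youngSymmetrizer lam).coeff g := by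
  classical
  refine conj_coeff_mul (fun g => ?_) (fun g => ?_) g
  · simp only [rowSymmetrizer, MonoidAlgebra.coeff_sum, Finsupp.coe_finsetSum, Finset.sum_apply,
      MonoidAlgebra.coeff_single, Finsupp.single_apply, map_sum]
    exact Finset.sum_congr rfl fun a _ => by split_ifs <;> simp
  · simp only [colAntisymmetrizer, MonoidAlgebra.coeff_sum, Finsupp.coe_finsetSum,
      Finset.sum_apply, MonoidAlgebra.coeff_single, Finsupp.single_apply, map_sum]
    exact Finset.sum_congr rfl fun a _ => by split_ifs <;> simp

theorem conj_youngScalar : starRingEnd ℂ (youngScalar lam) = youngScalar lam := by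
  have h := congrArg (fun x => x.coeff 1) (youngSymmetrizer_mul_self lam)
  simp only [coeff_smul_apply, youngSymmetrizer_coeff_one, smul_eq_mul, mul_one] at h
  rw [← h]
  exact conj_coeff_mul (conj_youngSymmetrizer_coeff lam) (conj_youngSymmetrizer_coeff lam) 1

theorem conj_chi (g : Equiv.Perm (Fin n)) : starRingEnd ℂ (chi lam g) = chi lam g := by
  rw [chi_eq_sum, map_mul, map_inv₀, conj_youngScalar, map_sum]
  simp only [conj_youngSymmetrizer_coeff]

end RootNumber

/-! ### Embeddings that commute with permutations -/

namespace RootNumber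
open Equiv Equiv.Perm

section EquivariantEmbeddings
variable {γ γ' α α' δ β : Type*}

/-- `f` intertwines the permutations `t` and `s`. -/
def Intertwines (t : Perm γ) (s : Perm α) (f : γ → α) : Prop := ∀ x, f (t x) = s (f x)

/-- The number of embeddings of `γ` into `α` that intertwine the permutations `t` and `s`. -/
noncomputable def embCount (t : Perm γ) (s : Perm α) : ℕ :=
  Nat.card {f : γ ↪ α // Intertwines t s f}

theorem embCount_congr {t : Perm γ} {t' : Perm γ'} {s : Perm α} {s' : Perm α'}
    (e : γ ≃ γ') (e' : α ≃ α') (he : Intertwines t t' e) (he' : Intertwines s s' e') :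
    embCount t s = embCount t' s' := by
  refine Nat.card_congr ((Equiv.embeddingCongr e e').subtypeEquiv fun f => ?_)
  constructor
  · intro h x
    obtain ⟨y, rfl⟩ := e.surjective x
    change e' (f (e.symm (t' (e y)))) = s' (e' (f (e.symm (e y))))
    rw [← he y, Equiv.symm_apply_apply, Equiv.symm_apply_apply, h y, he']
  · intro h x
    have := h (e x)
    change e' (f (e.symm (t' (e x)))) = s' (e' (f (e.symm (e x)))) at this
    rw [← he x, Equiv.symm_apply_apply, Equiv.symm_apply_apply, ← he'] at this
    exact e'.injective this

theorem embCount_permCongr (t : Perm γ) (s : Perm α) (e : α ≃ α') :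
    embCount t (e.permCongr s) = embCount t s :=
  (embCount_congr (t := t) (t' := t) (s := s) (s' := e.permCongr s) (Equiv.refl γ) e
    (fun _ => rfl) (fun x => by simp)).symm

theorem embCount_eq_zero [Finite γ] [Finite α] (h : Nat.card α < Nat.card γ) (t : Perm γ)
    (s : Perm α) : embCount t s = 0 := by
  have : IsEmpty {f : γ ↪ α // Intertwines t s f} :=
    ⟨fun f => absurd (Finite.card_le_of_embedding f.1) (not_le.2 h)⟩
  exact Nat.card_of_isEmpty

open scoped Classical in
theorem embCount_eq_sum [Fintype γ] [Fintype α] (t : Perm γ) (s : Perm α) :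
    embCount t s = ∑ f : γ ↪ α, if Intertwines t s f then 1 else 0 := by
  rw [embCount, Nat.card_eq_fintype_card, Fintype.card_subtype, Finset.card_filter]

/-- The standard embedding of `δ` into `δ ⊕ β` intertwines `t` and `s` exactly if `s` is `t` on
`δ` and some permutation on `β`. -/
theorem intertwines_inl_iff [Finite δ] [Finite β] (t : Perm δ) (s : Perm (δ ⊕ β)) :
    Intertwines t s Sum.inl ↔ ∃ r : Perm β, Equiv.Perm.sumCongr t r = s := by
  constructor
  · intro h
    have h1 : Set.MapsTo s (Set.range Sum.inl) (Set.range Sum.inl) := by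
      rintro _ ⟨x, rfl⟩
      exact ⟨t x, h x⟩
    obtain ⟨⟨t', r⟩, rfl⟩ := mem_sumCongrHom_range_of_perm_mapsTo_inl h1
    refine ⟨r, ?_⟩
    have : t = t' := Equiv.ext fun x => Sum.inl_injective (h x)
    rw [this]
    rfl
  · rintro ⟨r, rfl⟩ x
    rfl

variable [Fintype δ] [Fintype β] [DecidableEq δ] [DecidableEq β]

omit [Fintype δ] [Fintype β] [DecidableEq δ] [DecidableEq β] in
theorem sumCongr_right_injective (t : Perm δ) :
    Function.Injective fun r : Perm β => Equiv.Perm.sumCongr t r := fun r r' h => by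
  ext x
  have := congrArg (fun s : Perm (δ ⊕ β) => s (Sum.inr x)) h
  exact Sum.inr_injective this

open scoped Classical in
theorem sum_ite_intertwines_inl {R : Type*} [AddCommMonoid R] (t : Perm δ)
    (F : Perm (δ ⊕ β) → R) :
    ∑ s, (if Intertwines t s Sum.inl then F s else 0) =
      ∑ r : Perm β, F (Equiv.Perm.sumCongr t r) := by
  rw [← Finset.sum_filter]
  symm
  refine Finset.sum_bij (fun r _ => Equiv.Perm.sumCongr t r) ?_ ?_ ?_ ?_
  · intro r _
    simpa using (intertwines_inl_iff t _).2 ⟨r, rfl⟩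
  · intro r _ r' _ h
    exact sumCongr_right_injective t h
  · intro s hs
    obtain ⟨r, hr⟩ := (intertwines_inl_iff t s).1 (by simpa using hs)
    exact ⟨r, Finset.mem_univ _, hr⟩
  · intro r _
    rfl

theorem sum_perm_comp_inl {R : Type*} [AddCommMonoid R] (Φ : (δ ↪ δ ⊕ β) → R) :
    ∑ g : Perm (δ ⊕ β), Φ (Function.Embedding.inl.trans g.toEmbedding) =
      (Fintype.card β).factorial • ∑ c, Φ c := by
  classical
  rw [← Finset.sum_fiberwise Finset.univ
    (fun g : Perm (δ ⊕ β) => Function.Embedding.inl.trans g.toEmbedding), Finset.smul_sum]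
  refine Finset.sum_congr rfl fun c _ => ?_
  rw [Finset.sum_congr rfl fun g hg => by rw [(Finset.mem_filter.1 hg).2], Finset.sum_const]
  congr 1
  obtain ⟨g₀, hg₀⟩ := Equiv.Perm.exists_extending_pair (Sum.inl : δ → δ ⊕ β) c Sum.inl_injective
    c.injective
  rw [← Fintype.card_perm, ← Finset.card_univ]
  symm
  refine Finset.card_bij (fun r _ => g₀ * Equiv.Perm.sumCongr 1 r) ?_ ?_ ?_
  · intro r _
    simp only [Finset.mem_filter, Finset.mem_univ, true_and]
    ext x
    exact hg₀ x
  · intro r _ r' _ h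
    exact sumCongr_right_injective 1 (mul_left_cancel h)
  · intro g hg
    simp only [Finset.mem_filter, Finset.mem_univ, true_and] at hg
    obtain ⟨r, hr⟩ := (intertwines_inl_iff (1 : Perm δ) (g₀⁻¹ * g)).1 (fun x => by
      have : g (Sum.inl x) = c x := DFunLike.congr_fun hg x
      rw [Perm.mul_apply, this, ← hg₀, perm_inv_apply]
      rfl)
    exact ⟨r, Finset.mem_univ _, by rw [hr]; group⟩

open scoped Classical in
/-- All embeddings `c : δ ↪ δ ⊕ β` are conjugate to the standard one. So a sum of a conjugation
invariant function over pairs of an embedding and a permutation that extends `t` along it reduces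
to a sum over the permutations of `β`. -/
theorem sum_embedding_sum_perm {R : Type*} [AddCommMonoid R]
    (F : Perm (δ ⊕ β) → (δ ↪ δ ⊕ β) → R)
    (hF : ∀ g s c, F (g * s * g⁻¹) (c.trans g.toEmbedding) = F s c) (t : Perm δ) :
    (Fintype.card β).factorial • ∑ c : δ ↪ δ ⊕ β, ∑ s, (if Intertwines t s c then F s c else 0) =
      (Fintype.card (δ ⊕ β)).factorial •
        ∑ r : Perm β, F (Equiv.Perm.sumCongr t r) Function.Embedding.inl := by
  rw [← sum_perm_comp_inl]
  have : ∀ g : Perm (δ ⊕ β), ∑ s, (if Intertwines t s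
      (Function.Embedding.inl.trans g.toEmbedding : δ ↪ δ ⊕ β) then
        F s (Function.Embedding.inl.trans g.toEmbedding) else 0) =
      ∑ r : Perm β, F (Equiv.Perm.sumCongr t r) Function.Embedding.inl := by
    intro g
    rw [← sum_ite_intertwines_inl t (fun s => F s Function.Embedding.inl),
      ← Equiv.sum_comp (MulAut.conj g).toEquiv]
    refine Finset.sum_congr rfl fun s _ => ?_
    simp only [MulEquiv.toEquiv_eq_coe, EquivLike.coe_coe, MulAut.conj_apply]
    rw [hF]
    refine if_congr ?_ rfl rfl
    refine forall_congr' fun x => ?_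
    change g (Sum.inl (t x)) = g (s (g⁻¹ (g (Sum.inl x)))) ↔ _
    rw [perm_inv_apply]
    exact g.injective.eq_iff
  rw [Finset.sum_congr rfl fun g _ => this g, Finset.sum_const, Finset.card_univ, Fintype.card_perm]

variable [Fintype α] [DecidableEq α]

/-- The scalar product of `embCount t` and a class function: the mean value of the class function
over the permutations that extend `t`. -/
theorem sum_embCount_mul (e : δ ⊕ β ≃ α) (F : Perm α → ℂ)
    (hF : ∀ s g, F (g * s * g⁻¹) = F s) (t : Perm δ) :
    ((Fintype.card β).factorial : ℂ) * ∑ s, (embCount t s : ℂ) * F s =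
      (Fintype.card α).factorial *
        ∑ r : Perm β, F (e.permCongr (Equiv.Perm.sumCongr t r)) := by
  classical
  have h := sum_embedding_sum_perm (fun s _ => F (e.permCongr s)) (fun g s c => by
    have : e.permCongr (g * s * g⁻¹) =
        e.permCongr g * e.permCongr s * (e.permCongr g)⁻¹ := by
      simp only [← Equiv.permCongrHom_coe, map_mul, map_inv]
    rw [this, hF]) t
  rw [nsmul_eq_mul, nsmul_eq_mul, Fintype.card_congr e] at h
  rw [← h]
  congr 1
  rw [Finset.sum_comm, ← Equiv.sum_comp e.permCongr]
  refine Finset.sum_congr rfl fun s _ => ?_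
  rw [embCount_permCongr, embCount_eq_sum]
  push_cast
  rw [Finset.sum_mul]
  exact Finset.sum_congr rfl fun c _ => by rw [ite_mul, one_mul, zero_mul]

omit [Fintype β] [DecidableEq β] in
/-- The mean value of `embCount t` over a symmetric group is one. -/
theorem sum_embCount (h : Fintype.card δ ≤ Fintype.card α) (t : Perm δ) :
    ∑ s : Perm α, embCount t s = (Fintype.card α).factorial := by
  have e : δ ⊕ Fin (Fintype.card α - Fintype.card δ) ≃ α :=
    Fintype.equivOfCardEq (by simp; omega)
  have h1 := sum_embCount_mul e (fun _ => 1) (fun _ _ => rfl) t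
  simp only [mul_one, Finset.sum_const, Finset.card_univ, Fintype.card_perm, nsmul_eq_mul] at h1
  rw [mul_comm] at h1
  have h2 := mul_right_cancel₀ (Nat.cast_ne_zero.2 (Nat.factorial_ne_zero _)) h1
  exact_mod_cast h2

end EquivariantEmbeddings

/-! ### Unions of cycles -/

section CyclePolynomial
variable {γ α δ β : Type*}

/-- The cycles of `t`, fixed points included. -/
abbrev Orbits (t : Perm γ) : Type _ := Quotient (SameCycle.setoid t)

theorem mk_apply_eq (t : Perm γ) (x : γ) : (⟦t x⟧ : Orbits t) = ⟦x⟧ :=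
  Quotient.sound (show SameCycle t (t x) x from sameCycle_apply_left.2 (SameCycle.refl t x))

/-- The restriction of `t` to a union of cycles. -/
def restrict (t : Perm γ) (W : Finset (Orbits t)) : Perm {x : γ // (⟦x⟧ : Orbits t) ∈ W} :=
  t.subtypePerm fun x => by rw [mk_apply_eq]

theorem embCount_restrict_univ (t : Perm γ) [Fintype (Orbits t)] (s : Perm α) :
    embCount (restrict t Finset.univ) s = embCount t s :=
  embCount_congr (Equiv.subtypeUnivEquiv fun _ => Finset.mem_univ _) (Equiv.refl α)
    (fun _ => rfl) (fun _ => rfl)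

variable [Fintype γ]

open scoped Classical in
/-- An embedding into a disjoint union of two sets with permutations splits the cycles of its
domain into those that go to the left and those that go to the right. -/
theorem embCount_restrict_sumCongr [Finite δ] [Finite β] (t : Perm γ) (W : Finset (Orbits t))
    (s : Perm δ) (r : Perm β) :
    embCount (restrict t W) (Equiv.Perm.sumCongr s r) =
      ∑ W₁ ∈ W.powerset, embCount (restrict t W₁) s * embCount (restrict t (W \ W₁)) r := by
  -- `L f` is the set of the cycles that `f` maps to the left
  let T := {f : {x : γ // (⟦x⟧ : Orbits t) ∈ W} ↪ δ ⊕ β //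
    Intertwines (restrict t W) (Equiv.Perm.sumCongr s r) f}
  have : Fintype T := Fintype.ofFinite T
  let L : T → Finset (Orbits t) := fun f =>
    {o ∈ W | ∃ x : {x : γ // (⟦x⟧ : Orbits t) ∈ W}, ⟦x.1⟧ = o ∧ (f.1 x).isLeft}
  have hleft : ∀ (f : T) (x y : {x : γ // (⟦x⟧ : Orbits t) ∈ W}),
      (⟦x.1⟧ : Orbits t) = ⟦y.1⟧ → ((f.1 x).isLeft ↔ (f.1 y).isLeft) := by
    rintro f ⟨x, hx⟩ ⟨y, hy⟩ hxy
    obtain ⟨i, hi⟩ := (Quotient.exact hxy : SameCycle t x y).exists_nat_pow_eq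
    simp only at hi
    clear hxy
    induction i generalizing y with
    | zero => simp only [pow_zero, Perm.one_apply] at hi; subst hi; rfl
    | succ i ih =>
      have hz : (⟦(t ^ i) x⟧ : Orbits t) ∈ W := by
        rw [← hi, pow_succ', Perm.mul_apply, mk_apply_eq] at hy; exact hy
      rw [ih _ hz rfl]
      have h1 := f.2 ⟨(t ^ i) x, hz⟩
      have h2 : restrict t W ⟨(t ^ i) x, hz⟩ = ⟨y, hy⟩ := Subtype.ext (by
        change t ((t ^ i) x) = y
        rw [← hi, pow_succ']; rfl)
      rw [h2] at h1
      rw [h1]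
      cases f.1 ⟨(t ^ i) x, hz⟩ <;> simp
  have hL : ∀ (f : T) (x : {x : γ // (⟦x⟧ : Orbits t) ∈ W}),
      (f.1 x).isLeft ↔ (⟦x.1⟧ : Orbits t) ∈ L f := by
    intro f x
    simp only [L, Finset.mem_filter]
    exact ⟨fun h => ⟨x.2, x, rfl, h⟩, fun ⟨_, y, hy, h⟩ => (hleft f y x hy).1 h⟩
  have hcard : embCount (restrict t W) (Equiv.Perm.sumCongr s r) =
      ∑ W₁ ∈ W.powerset, (Finset.univ.filter fun f : T => L f = W₁).card := by
    rw [embCount, Nat.card_eq_fintype_card, ← Finset.card_univ]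
    exact Finset.card_eq_sum_card_fiberwise fun f _ => by
      exact Finset.mem_coe.2 (Finset.mem_powerset.2 (Finset.filter_subset _ _))
  rw [hcard]
  refine Finset.sum_congr rfl fun W₁ hW₁ => ?_
  rw [Finset.mem_powerset] at hW₁
  rw [embCount, embCount, ← Nat.card_prod, ← Fintype.card_subtype, ← Nat.card_eq_fintype_card]
  symm
  let Φ : {f : {x : γ // (⟦x⟧ : Orbits t) ∈ W₁} ↪ δ // Intertwines (restrict t W₁) s f} ×
      {f : {x : γ // (⟦x⟧ : Orbits t) ∈ W \ W₁} ↪ β // Intertwines (restrict t (W \ W₁)) r f} →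
      {x : γ // (⟦x⟧ : Orbits t) ∈ W} → δ ⊕ β := fun p x =>
    if h : (⟦x.1⟧ : Orbits t) ∈ W₁ then Sum.inl (p.1.1 ⟨x.1, h⟩)
    else Sum.inr (p.2.1 ⟨x.1, Finset.mem_sdiff.2 ⟨x.2, h⟩⟩)
  have hΦinj : ∀ p, Function.Injective (Φ p) := by
    intro p x y h
    simp only [Φ] at h
    split_ifs at h with h1 h2 h2
    · have := p.1.1.injective (Sum.inl_injective h)
      exact Subtype.ext (congrArg (fun z => z.1) this)
    · have := p.2.1.injective (Sum.inr_injective h)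
      exact Subtype.ext (congrArg (fun z => z.1) this)
  have hΦint : ∀ p, Intertwines (restrict t W) (Equiv.Perm.sumCongr s r) (Φ p) := by
    intro p x
    have hx : (⟦(restrict t W x).1⟧ : Orbits t) = ⟦x.1⟧ := mk_apply_eq t x.1
    by_cases h : (⟦x.1⟧ : Orbits t) ∈ W₁
    · have h' : (⟦(restrict t W x).1⟧ : Orbits t) ∈ W₁ := by rw [hx]; exact h
      simp only [Φ, h, h', dif_pos]
      exact congrArg Sum.inl (p.1.2 ⟨x.1, h⟩)
    · have h' : (⟦(restrict t W x).1⟧ : Orbits t) ∉ W₁ := by rw [hx]; exact h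
      simp only [Φ, h, h', dif_neg, not_false_eq_true]
      exact congrArg Sum.inr (p.2.2 ⟨x.1, Finset.mem_sdiff.2 ⟨x.2, h⟩⟩)
  refine Nat.card_eq_of_bijective (fun p => ⟨⟨⟨Φ p, hΦinj p⟩, hΦint p⟩, ?_⟩) ⟨?_, ?_⟩
  · ext o
    constructor
    · intro ho
      obtain ⟨h1, x, rfl, h2⟩ := Finset.mem_filter.1 ho
      by_contra h
      change (Φ p x).isLeft = true at h2
      simp [Φ, h] at h2
    · intro ho
      induction o using Quotient.inductionOn with
      | h x =>
        refine Finset.mem_filter.2 ⟨hW₁ ho, ⟨x, hW₁ ho⟩, rfl, ?_⟩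
        change (Φ p _).isLeft = true
        simp [Φ, ho]
  · intro p p' h
    have h' : Φ p = Φ p' := by
      have := congrArg (fun z => (z.1.1 : _ → δ ⊕ β)) h
      exact this
    refine Prod.ext (Subtype.ext (DFunLike.ext _ _ fun x => ?_))
      (Subtype.ext (DFunLike.ext _ _ fun x => ?_))
    · have := congrFun h' ⟨x.1, hW₁ x.2⟩
      simp only [Φ, x.2, dif_pos] at this
      exact Sum.inl_injective this
    · have hx := Finset.mem_sdiff.1 x.2
      have := congrFun h' ⟨x.1, hx.1⟩
      simp only [Φ, hx.2, dif_neg, not_false_eq_true] at this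
      exact Sum.inr_injective this
  · rintro ⟨f, hf⟩
    have hl : ∀ x : {x : γ // (⟦x⟧ : Orbits t) ∈ W₁}, ∃ y, f.1 ⟨x.1, hW₁ x.2⟩ = Sum.inl y := by
      intro x
      have := (hL f ⟨x.1, hW₁ x.2⟩).2 (by rw [hf]; exact x.2)
      exact Sum.isLeft_iff.1 this
    have hr : ∀ x : {x : γ // (⟦x⟧ : Orbits t) ∈ W \ W₁},
        ∃ y, f.1 ⟨x.1, (Finset.mem_sdiff.1 x.2).1⟩ = Sum.inr y := by
      intro x
      have hx := Finset.mem_sdiff.1 x.2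
      have := mt (hL f ⟨x.1, hx.1⟩).1 (by rw [hf]; exact hx.2)
      exact Sum.isRight_iff.1 (by simpa using this)
    choose f₁ hf₁ using hl
    choose f₂ hf₂ using hr
    refine ⟨⟨⟨⟨f₁, fun x y h => ?_⟩, fun x => ?_⟩, ⟨⟨f₂, fun x y h => ?_⟩, fun x => ?_⟩⟩, ?_⟩
    · have := (hf₁ x).trans ((congrArg Sum.inl h).trans (hf₁ y).symm)
      exact Subtype.ext (congrArg (fun z => z.1) (f.1.injective this))
    · refine Sum.inl_injective (β := β) ?_
      change Sum.inl (f₁ (restrict t W₁ x)) = Sum.inl (s (f₁ x))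
      rw [← hf₁]
      have := f.2 ⟨x.1, hW₁ x.2⟩
      rw [hf₁] at this
      exact this
    · have := (hf₂ x).trans ((congrArg Sum.inr h).trans (hf₂ y).symm)
      exact Subtype.ext (congrArg (fun z => z.1) (f.1.injective this))
    · refine Sum.inr_injective (α := δ) ?_
      change Sum.inr (f₂ (restrict t (W \ W₁) x)) = Sum.inr (r (f₂ x))
      rw [← hf₂]
      have := f.2 ⟨x.1, (Finset.mem_sdiff.1 x.2).1⟩
      rw [hf₂] at this
      exact this
    · refine Subtype.ext (Subtype.ext (DFunLike.ext _ _ fun x => ?_))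
      change Φ _ x = f.1 x
      by_cases h : (⟦x.1⟧ : Orbits t) ∈ W₁
      · simp only [Φ, h, dif_pos]
        exact (hf₁ ⟨x.1, h⟩).symm
      · simp only [Φ, h, dif_neg, not_false_eq_true]
        exact (hf₂ ⟨x.1, Finset.mem_sdiff.2 ⟨x.2, h⟩⟩).symm

end CyclePolynomial
end RootNumber

/-! ### The alternating sum over unions of cycles -/

namespace RootNumber
open Equiv Equiv.Perm

section CyclePolynomial
variable {γ α α' δ β : Type*} [Fintype γ]

noncomputable instance (t : Perm γ) : Fintype (Orbits t) := Fintype.ofFinite _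

open scoped Classical in
/-- The alternating sum, over the unions of cycles of `t`, of the numbers of embeddings of the
complement of the union that intertwine `t` and `s`. -/
noncomputable def cyclePoly (t : Perm γ) (s : Perm α) : ℂ :=
  ∑ V : Finset (Orbits t), (-1) ^ V.card * (embCount (restrict t Vᶜ) s : ℂ)

/-- The class function `(1 / |γ|!) ∑_t φ(t) K(t, s)` with `K = cyclePoly`. For the character `φ` of
the Specht module of `μ` it is the character of the Specht module of `(n - |μ|, μ)`. -/
noncomputable def charPoly (φ : Perm γ → ℂ) (s : Perm α) : ℂ :=
  ((Fintype.card γ).factorial : ℂ)⁻¹ *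
    (haveI := Classical.decEq γ; ∑ t : Perm γ, φ t * cyclePoly t s)

theorem charPoly_eq [DecidableEq γ] (φ : Perm γ → ℂ) (s : Perm α) :
    charPoly φ s = ((Fintype.card γ).factorial : ℂ)⁻¹ * ∑ t : Perm γ, φ t * cyclePoly t s := by
  rw [charPoly]
  congr!

theorem cyclePoly_permCongr (t : Perm γ) (s : Perm α) (e : α ≃ α') :
    cyclePoly t (e.permCongr s) = cyclePoly t s := by
  simp only [cyclePoly, embCount_permCongr]

theorem charPoly_permCongr (φ : Perm γ → ℂ) (s : Perm α) (e : α ≃ α') :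
    charPoly φ (e.permCongr s) = charPoly φ s := by
  simp only [charPoly, cyclePoly_permCongr]

theorem charPoly_conj (φ : Perm γ → ℂ) (s g : Perm α) :
    charPoly φ (g * s * g⁻¹) = charPoly φ s :=
  charPoly_permCongr φ s g

theorem conj_cyclePoly (t : Perm γ) (s : Perm α) :
    starRingEnd ℂ (cyclePoly t s) = cyclePoly t s := by
  simp [cyclePoly]

theorem conj_charPoly {φ : Perm γ → ℂ} (hφ : ∀ t, starRingEnd ℂ (φ t) = φ t) (s : Perm α) :
    starRingEnd ℂ (charPoly φ s) = charPoly φ s := by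
  simp [charPoly, conj_cyclePoly, hφ]

theorem card_subtype_mem_lt (t : Perm γ) {V : Finset (Orbits t)} (hV : V ≠ Finset.univ) :
    Nat.card {x : γ // (⟦x⟧ : Orbits t) ∈ V} < Nat.card γ := by
  obtain ⟨o, ho⟩ : ∃ o, o ∉ V := by
    by_contra h
    push Not at h
    exact hV (Finset.eq_univ_iff_forall.2 h)
  induction o using Quotient.inductionOn with
  | h x => exact Finite.card_subtype_lt ho

variable [Fintype δ] [Fintype β] [DecidableEq δ] [DecidableEq β]

omit [DecidableEq δ] in
/-- Averaged over the permutations of a large set, the terms of `cyclePoly` cancel, except for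
those embeddings that avoid the set. -/
theorem sum_cyclePoly_sumCongr (h : Fintype.card γ ≤ Fintype.card β) (t : Perm γ) (s : Perm δ) :
    ∑ r : Perm β, cyclePoly t (Equiv.Perm.sumCongr s r) =
      (Fintype.card β).factorial * (embCount t s : ℂ) := by
  classical
  simp only [cyclePoly]
  rw [Finset.sum_comm]
  have h1 : ∀ V : Finset (Orbits t), ∑ r : Perm β,
      (-1 : ℂ) ^ V.card * (embCount (restrict t Vᶜ) (Equiv.Perm.sumCongr s r) : ℂ) =
      ∑ W ∈ (Vᶜ).powerset,
        (-1 : ℂ) ^ V.card * ((Fintype.card β).factorial * (embCount (restrict t W) s : ℂ)) := by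
    intro V
    simp_rw [embCount_restrict_sumCongr]
    push_cast
    rw [← Finset.mul_sum, ← Finset.mul_sum, Finset.sum_comm]
    congr 1
    refine Finset.sum_congr rfl fun W _ => ?_
    rw [← Finset.mul_sum, mul_comm]
    congr 1
    have h2 := sum_embCount (α := β) (δ := {x : γ // (⟦x⟧ : Orbits t) ∈ Vᶜ \ W})
      ((Fintype.card_subtype_le _).trans h) (restrict t (Vᶜ \ W))
    exact_mod_cast h2
  rw [Finset.sum_congr rfl fun V _ => h1 V]
  rw [Finset.sum_comm' (t' := Finset.univ) (s' := fun W => (Wᶜ).powerset) (by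
    intro V W
    simp only [Finset.mem_univ, Finset.mem_powerset, true_and, and_true]
    constructor
    · exact fun h => Finset.subset_compl_comm.1 h
    · exact fun h => Finset.subset_compl_comm.1 h)]
  have h3 : ∀ W : Finset (Orbits t), ∑ V ∈ (Wᶜ).powerset, (-1 : ℂ) ^ V.card *
      ((Fintype.card β).factorial * (embCount (restrict t W) s : ℂ)) =
      if W = Finset.univ then ((Fintype.card β).factorial * (embCount (restrict t W) s : ℂ))
      else 0 := by
    intro W
    rw [← Finset.sum_mul]
    have h4 := Finset.sum_powerset_neg_one_pow_card (x := Wᶜ)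
    have h5 : ∑ V ∈ (Wᶜ).powerset, (-1 : ℂ) ^ V.card = if Wᶜ = ∅ then 1 else 0 := by
      exact_mod_cast congrArg (Int.cast : ℤ → ℂ) h4
    rw [h5]
    simp only [Finset.compl_eq_empty_iff]
    split_ifs <;> simp
  rw [Finset.sum_congr rfl fun W _ => h3 W, Finset.sum_ite_eq' Finset.univ Finset.univ,
    if_pos (Finset.mem_univ _), embCount_restrict_univ]

variable [Fintype α] [DecidableEq α]

/-- If `F` is orthogonal to the counts for the smaller unions of cycles, only the full union
contributes to the scalar product with `cyclePoly t`. -/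
theorem sum_cyclePoly_mul (F : Perm α → ℂ) (t : Perm γ)
    (hF : ∀ W : Finset (Orbits t), W ≠ Finset.univ →
      ∑ s, (embCount (restrict t W) s : ℂ) * F s = 0) :
    ∑ s, cyclePoly t s * F s = ∑ s, (embCount t s : ℂ) * F s := by
  classical
  simp_rw [cyclePoly, Finset.sum_mul]
  rw [Finset.sum_comm, Finset.sum_eq_single ∅]
  · refine Finset.sum_congr rfl fun s _ => ?_
    rw [Finset.compl_empty, embCount_restrict_univ, Finset.card_empty, pow_zero, one_mul]
  · intro V _ hV
    simp_rw [mul_assoc]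
    rw [← Finset.mul_sum, hF Vᶜ (by simpa [Finset.compl_eq_univ_iff] using hV), mul_zero]
  · simp

variable [DecidableEq γ]

theorem sum_charPoly_mul (e : γ ⊕ β ≃ α) (φ : Perm γ → ℂ) (F : Perm α → ℂ)
    (hconj : ∀ s g, F (g * s * g⁻¹) = F s)
    (hF : ∀ (t : Perm γ) (W : Finset (Orbits t)), W ≠ Finset.univ →
      ∑ s, (embCount (restrict t W) s : ℂ) * F s = 0) :
    ((Fintype.card β).factorial : ℂ) * ∑ s, charPoly φ s * F s =
      (Fintype.card α).factorial * (((Fintype.card γ).factorial : ℂ)⁻¹ *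
        ∑ t, φ t * ∑ r : Perm β, F (e.permCongr (Equiv.Perm.sumCongr t r))) := by
  have h1 : ∑ s, charPoly φ s * F s = ((Fintype.card γ).factorial : ℂ)⁻¹ *
      ∑ t, φ t * ∑ s, (embCount t s : ℂ) * F s := by
    simp_rw [charPoly_eq, mul_assoc]
    rw [← Finset.mul_sum]
    congr 1
    simp_rw [Finset.sum_mul]
    rw [Finset.sum_comm]
    refine Finset.sum_congr rfl fun t _ => ?_
    rw [← sum_cyclePoly_mul F t (hF t), Finset.mul_sum]
    exact Finset.sum_congr rfl fun s _ => mul_assoc _ _ _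
  have h2 : ∀ t : Perm γ, ((Fintype.card β).factorial : ℂ) *
      (φ t * ∑ s, (embCount t s : ℂ) * F s) = (Fintype.card α).factorial *
        (φ t * ∑ r : Perm β, F (e.permCongr (Equiv.Perm.sumCongr t r))) := by
    intro t
    rw [mul_left_comm, sum_embCount_mul e F hconj t, mul_left_comm]
  rw [h1, mul_left_comm, Finset.mul_sum, Finset.sum_congr rfl fun t _ => h2 t, ← Finset.mul_sum,
    mul_left_comm]

omit [DecidableEq δ] in
theorem sum_charPoly_sumCongr (φ : Perm γ → ℂ) (h : Fintype.card γ ≤ Fintype.card β)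
    (s : Perm δ) :
    ∑ r : Perm β, charPoly φ (Equiv.Perm.sumCongr s r) = (Fintype.card β).factorial *
      (((Fintype.card γ).factorial : ℂ)⁻¹ * ∑ t, φ t * (embCount t s : ℂ)) := by
  simp_rw [charPoly_eq]
  rw [← Finset.mul_sum, Finset.sum_comm, mul_left_comm]
  congr 1
  rw [Finset.mul_sum]
  refine Finset.sum_congr rfl fun t _ => ?_
  rw [← Finset.mul_sum, sum_cyclePoly_sumCongr h, mul_left_comm]

/-- An embedding of `γ` into itself is a permutation `g`, and it intertwines exactly
`g⁻¹ s g` and `s`. -/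
theorem sum_mul_embCount {φ : Perm γ → ℂ} (hφ : ∀ s g, φ (g * s * g⁻¹) = φ s) (s : Perm γ) :
    ∑ t, φ t * (embCount t s : ℂ) = (Fintype.card γ).factorial * φ s := by
  classical
  simp_rw [embCount_eq_sum]
  push_cast
  simp_rw [Finset.mul_sum]
  rw [Finset.sum_comm]
  have h : ∀ f : γ ↪ γ, ∑ t, φ t * (if Intertwines t s f then (1 : ℂ) else 0) = φ s := by
    intro f
    let g : Perm γ := Equiv.ofBijective f (Finite.injective_iff_bijective.1 f.injective)
    rw [Finset.sum_eq_single (g⁻¹ * s * g)]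
    · rw [if_pos, mul_one]
      · have := hφ s g⁻¹
        rwa [inv_inv] at this
      · intro x
        change g (g⁻¹ (s (g x))) = s (g x)
        rw [perm_apply_inv]
    · intro t _ ht
      rw [if_neg, mul_zero]
      intro h
      apply ht
      ext x
      apply g.injective
      rw [Perm.mul_apply, Perm.mul_apply, perm_apply_inv]
      exact h x
    · simp
  rw [Finset.sum_congr rfl fun f _ => h f, Finset.sum_const, Finset.card_univ,
    Fintype.card_embedding_eq, Nat.descFactorial_self, nsmul_eq_mul]

/-- `charPoly φ` has the same norm as `φ`. -/
theorem sum_charPoly_mul_self (e : γ ⊕ β ≃ α) {φ : Perm γ → ℂ}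
    (hφ : ∀ s g, φ (g * s * g⁻¹) = φ s) (h : Fintype.card γ ≤ Fintype.card β) :
    ∑ s : Perm α, charPoly φ s * charPoly φ s = (Fintype.card α).factorial *
      (((Fintype.card γ).factorial : ℂ)⁻¹ * ∑ t, φ t * φ t) := by
  have hβ : ((Fintype.card β).factorial : ℂ) ≠ 0 := Nat.cast_ne_zero.2 (Nat.factorial_ne_zero _)
  have hγ : ((Fintype.card γ).factorial : ℂ) ≠ 0 := Nat.cast_ne_zero.2 (Nat.factorial_ne_zero _)
  have hα : Fintype.card α = Fintype.card γ + Fintype.card β := by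
    rw [← Fintype.card_congr e, Fintype.card_sum]
  apply mul_left_cancel₀ hβ
  rw [sum_charPoly_mul e φ _ (charPoly_conj φ)]
  · simp_rw [charPoly_permCongr, sum_charPoly_sumCongr φ h, sum_mul_embCount hφ]
    simp_rw [inv_mul_cancel_left₀ hγ]
    have h1 : ∑ t, φ t * (((Fintype.card β).factorial : ℂ) * φ t) =
        (Fintype.card β).factorial * ∑ t, φ t * φ t := by
      rw [Finset.mul_sum]
      exact Finset.sum_congr rfl fun t _ => mul_left_comm _ _ _
    rw [h1]
    ring
  · -- there are no embeddings of `γ` into a smaller set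
    intro t W hW
    classical
    have hlt := card_subtype_mem_lt t hW
    rw [Nat.card_eq_fintype_card, Nat.card_eq_fintype_card] at hlt
    obtain ⟨e'⟩ : Nonempty ({x : γ // (⟦x⟧ : Orbits t) ∈ W} ⊕
        Fin (Fintype.card α - Fintype.card {x : γ // (⟦x⟧ : Orbits t) ∈ W}) ≃ α) :=
      ⟨Fintype.equivOfCardEq (by rw [Fintype.card_sum, Fintype.card_fin]; omega)⟩
    have h1 := sum_embCount_mul e' (charPoly φ) (charPoly_conj φ) (restrict t W)
    simp_rw [charPoly_permCongr] at h1
    rw [sum_charPoly_sumCongr φ (by rw [Fintype.card_fin]; omega)] at h1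
    have h2 : ∀ t' : Perm γ, φ t' * (embCount t' (restrict t W) : ℂ) = 0 := by
      intro t'
      rw [embCount_eq_zero (by simpa [Nat.card_eq_fintype_card] using hlt), Nat.cast_zero, mul_zero]
    rw [Finset.sum_congr rfl fun t' _ => h2 t', Finset.sum_const_zero, mul_zero, mul_zero,
      mul_zero] at h1
    exact (mul_eq_zero.1 h1).resolve_left (Nat.cast_ne_zero.2 (Nat.factorial_ne_zero _))

end CyclePolynomial
end RootNumber

/-! ### The character of a partition with a long first row -/

namespace RootNumber
open MonoidAlgebra (single single_mul_single coeff_smul_apply smul_single)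
open LinearMap

section LongFirstRow
variable {m Δ : ℕ}

/-- The entries of the row-by-row tableau with a first row of length `m`: `Sum.inr` gives those of
the first row, `Sum.inl` those below it. -/
def splitRows (m Δ : ℕ) : Fin Δ ⊕ Fin m ≃ Fin (m + Δ) :=
  (Equiv.sumComm _ _).trans finSumFinEquiv

/-- The permutation of all entries that is `t` below the first row and `r` on the first row. -/
def glue (t : Equiv.Perm (Fin Δ)) (r : Equiv.Perm (Fin m)) : Equiv.Perm (Fin (m + Δ)) :=
  (splitRows m Δ).permCongr (Equiv.Perm.sumCongr t r)

theorem glue_mul (t t' : Equiv.Perm (Fin Δ)) (r r' : Equiv.Perm (Fin m)) :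
    glue (t * t') (r * r') = glue t r * glue t' r' := by
  simp only [glue, ← Equiv.permCongrHom_coe, ← Equiv.Perm.sumCongr_mul, map_mul]

theorem glue_injective {t t' : Equiv.Perm (Fin Δ)} {r r' : Equiv.Perm (Fin m)}
    (h : glue t r = glue t' r') : t = t' ∧ r = r' := by
  have h1 := (splitRows m Δ).permCongr.injective h
  have h2 := Equiv.Perm.sumCongrHom_injective (a₁ := (t, r)) (a₂ := (t', r')) h1
  exact Prod.ext_iff.1 h2

theorem sign_glue_one (t : Equiv.Perm (Fin Δ)) :
    Equiv.Perm.sign (glue t (1 : Equiv.Perm (Fin m))) = Equiv.Perm.sign t := by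
  rw [glue, Equiv.Perm.sign_permCongr, Equiv.Perm.sign_sumCongr, Equiv.Perm.sign_one, mul_one]

/-- The embedding of `S_Δ` into `S_{m + Δ}` as the permutations of the entries below the
first row. -/
def glueHom (m Δ : ℕ) : Equiv.Perm (Fin Δ) →* Equiv.Perm (Fin (m + Δ)) where
  toFun t := glue t 1
  map_one' := by
    ext x
    simp [glue]
  map_mul' t t' := by rw [← glue_mul, one_mul]

/-- The algebra homomorphism `ℂ[S_Δ] → ℂ[S_{m + Δ}]` that extends `glueHom`. -/
noncomputable def glueAlg (m Δ : ℕ) : MonoidAlgebra ℂ (Equiv.Perm (Fin Δ)) →ₐ[ℂ]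
    MonoidAlgebra ℂ (Equiv.Perm (Fin (m + Δ))) :=
  MonoidAlgebra.mapDomainAlgHom ℂ ℂ (glueHom m Δ)

theorem glueAlg_single (t : Equiv.Perm (Fin Δ)) (z : ℂ) :
    glueAlg m Δ (single t z) = single (glue t 1) z := by
  simp [glueAlg, glueHom]

/-- The sum of all permutations of the first row. -/
noncomputable def firstRowSum (m Δ : ℕ) : MonoidAlgebra ℂ (Equiv.Perm (Fin (m + Δ))) :=
  ∑ r : Equiv.Perm (Fin m), single (glue 1 r) 1

theorem glueAlg_single_mul_firstRowSum (t : Equiv.Perm (Fin Δ)) (z : ℂ) :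
    glueAlg m Δ (single t z) * firstRowSum m Δ =
      ∑ r : Equiv.Perm (Fin m), single (glue t r) z := by
  rw [glueAlg_single, firstRowSum, Finset.mul_sum]
  refine Finset.sum_congr rfl fun r _ => ?_
  rw [single_mul_single, ← glue_mul, mul_one, one_mul, mul_one]

theorem firstRowSum_mul_glueAlg_single (t : Equiv.Perm (Fin Δ)) (z : ℂ) :
    firstRowSum m Δ * glueAlg m Δ (single t z) =
      ∑ r : Equiv.Perm (Fin m), single (glue t r) z := by
  rw [glueAlg_single, firstRowSum, Finset.sum_mul]
  refine Finset.sum_congr rfl fun r _ => ?_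
  rw [single_mul_single, ← glue_mul, mul_one, one_mul, one_mul]

theorem glueAlg_mul_firstRowSum (x : MonoidAlgebra ℂ (Equiv.Perm (Fin Δ))) :
    glueAlg m Δ x * firstRowSum m Δ = firstRowSum m Δ * glueAlg m Δ x := by
  induction x using MonoidAlgebra.induction_linear with
  | zero => simp
  | add x y hx hy => rw [map_add, add_mul, mul_add, hx, hy]
  | single t z => rw [glueAlg_single_mul_firstRowSum, firstRowSum_mul_glueAlg_single]

theorem firstRowSum_mul_self :
    firstRowSum m Δ * firstRowSum m Δ = (m.factorial : ℂ) • firstRowSum m Δ := by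
  have h : ∀ r : Equiv.Perm (Fin m), single (glue (1 : Equiv.Perm (Fin Δ)) r) 1 *
      firstRowSum m Δ = firstRowSum m Δ := by
    intro r
    rw [firstRowSum, Finset.mul_sum, ← Equiv.sum_comp (Equiv.mulLeft r)
      (fun r => single (glue (1 : Equiv.Perm (Fin Δ)) r) (1 : ℂ))]
    refine Finset.sum_congr rfl fun r' _ => ?_
    rw [single_mul_single, ← glue_mul, one_mul, one_mul]
    rfl
  nth_rewrite 1 [firstRowSum]
  rw [Finset.sum_mul]
  rw [Finset.sum_congr rfl fun r _ => h r, Finset.sum_const, Finset.card_univ, Fintype.card_perm,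
    Fintype.card_fin, Nat.cast_smul_eq_nsmul]

variable {lam : (m + Δ).Partition} {mu : Δ.Partition}

theorem cell_inl (h : rows lam = m :: rows mu) (x : Fin Δ) :
    cell (rows lam) (splitRows m Δ (Sum.inl x)) =
      ((cell (rows mu) x).1 + 1, (cell (rows mu) x).2) := by
  rw [h]
  simp [splitRows, cell]

theorem cell_inr (h : rows lam = m :: rows mu) (x : Fin m) :
    cell (rows lam) (splitRows m Δ (Sum.inr x)) = (0, (x : ℕ)) := by
  rw [h]
  simp [splitRows, cell]

theorem glue_apply_splitRows (t : Equiv.Perm (Fin Δ)) (r : Equiv.Perm (Fin m))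
    (x : Fin Δ ⊕ Fin m) :
    glue t r (splitRows m Δ x) = splitRows m Δ (Equiv.Perm.sumCongr t r x) := by
  simp [glue]

theorem mem_rowGroup_iff (h : rows lam = m :: rows mu) (s : Equiv.Perm (Fin (m + Δ))) :
    s ∈ rowGroup lam ↔ ∃ t ∈ rowGroup mu, ∃ r, glue t r = s := by
  constructor
  · intro hs
    have h1 : Set.MapsTo ((splitRows m Δ).symm.permCongr s) (Set.range Sum.inl)
        (Set.range Sum.inl) := by
      rintro _ ⟨x, rfl⟩
      have h2 := hs (splitRows m Δ (Sum.inl x))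
      rw [cell_inl h] at h2
      obtain ⟨y, hy⟩ := (splitRows m Δ).surjective (s (splitRows m Δ (Sum.inl x)))
      rw [← hy] at h2
      cases y with
      | inl y => exact ⟨y, by simp [← hy]⟩
      | inr y => rw [cell_inr h] at h2; simp at h2
    obtain ⟨⟨t, r⟩, htr⟩ := Equiv.Perm.mem_sumCongrHom_range_of_perm_mapsTo_inl h1
    have hs' : glue t r = s := by
      ext x
      have := Equiv.congr_fun htr ((splitRows m Δ).symm x)
      simp only [Equiv.Perm.sumCongrHom_apply] at this
      simp [glue, this]
    refine ⟨t, fun x => ?_, r, hs'⟩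
    have h2 := hs (splitRows m Δ (Sum.inl x))
    rw [← hs', glue_apply_splitRows, cell_inl h, Equiv.Perm.sumCongr_apply, Sum.map_inl,
      cell_inl h] at h2
    simpa using h2
  · rintro ⟨t, ht, r, rfl⟩ x
    obtain ⟨x, rfl⟩ := (splitRows m Δ).surjective x
    rw [glue_apply_splitRows]
    cases x with
    | inl x =>
      rw [Equiv.Perm.sumCongr_apply, Sum.map_inl, cell_inl h, cell_inl h]
      simpa using ht x
    | inr x =>
      rw [Equiv.Perm.sumCongr_apply, Sum.map_inr, cell_inr h, cell_inr h]

theorem glue_one_mem_colGroup (h : rows lam = m :: rows mu) {t : Equiv.Perm (Fin Δ)}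
    (ht : t ∈ colGroup mu) : glue t (1 : Equiv.Perm (Fin m)) ∈ colGroup lam := by
  intro x
  obtain ⟨x, rfl⟩ := (splitRows m Δ).surjective x
  rw [glue_apply_splitRows]
  cases x with
  | inl x =>
    rw [Equiv.Perm.sumCongr_apply, Sum.map_inl, cell_inl h, cell_inl h]
    exact ht x
  | inr x =>
    rw [Equiv.Perm.sumCongr_apply, Sum.map_inr, cell_inr h, cell_inr h]
    rfl

theorem rowSymmetrizer_eq (h : rows lam = m :: rows mu) :
    rowSymmetrizer lam = firstRowSum m Δ * glueAlg m Δ (rowSymmetrizer mu) := by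
  classical
  rw [rowSymmetrizer, rowSymmetrizer, map_sum, Finset.mul_sum]
  simp_rw [firstRowSum_mul_glueAlg_single]
  rw [← Finset.sum_product']
  symm
  refine Finset.sum_bij (fun p _ => glue p.1 p.2) ?_ ?_ ?_ ?_
  · rintro ⟨t, r⟩ hp
    simp only [Finset.mem_product, Finset.mem_filter, Finset.mem_univ, true_and, and_true] at hp ⊢
    exact (mem_rowGroup_iff h _).2 ⟨t, hp, r, rfl⟩
  · rintro ⟨t, r⟩ _ ⟨t', r'⟩ _ hp
    exact Prod.ext_iff.2 (glue_injective hp)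
  · intro s hs
    simp only [Finset.mem_filter, Finset.mem_univ, true_and] at hs
    obtain ⟨t, ht, r, hr⟩ := (mem_rowGroup_iff h s).1 hs
    exact ⟨(t, r), by simpa using ht, hr⟩
  · intro p _
    rfl

open scoped Classical in
theorem glueAlg_colAntisymmetrizer_mul (h : rows lam = m :: rows mu) :
    glueAlg m Δ (colAntisymmetrizer mu) * colAntisymmetrizer lam =
      (((Finset.univ.filter (· ∈ colGroup mu)).card : ℕ) : ℂ) • colAntisymmetrizer lam := by
  rw [colAntisymmetrizer, map_sum, Finset.sum_mul]
  have h1 : ∀ t ∈ Finset.univ.filter (· ∈ colGroup mu),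
      glueAlg m Δ (single t ((Equiv.Perm.sign t : ℤ) : ℂ)) * colAntisymmetrizer lam =
        colAntisymmetrizer lam := by
    intro t ht
    simp only [Finset.mem_filter, Finset.mem_univ, true_and] at ht
    have h2 : single (glue t (1 : Equiv.Perm (Fin m))) ((Equiv.Perm.sign t : ℤ) : ℂ) =
        ((Equiv.Perm.sign t : ℤ) : ℂ) • single (glue t (1 : Equiv.Perm (Fin m))) (1 : ℂ) := by
      rw [smul_single, smul_eq_mul, mul_one]
    rw [glueAlg_single, h2, smul_mul_assoc,
      single_mul_colAntisymmetrizer lam (glue_one_mem_colGroup h ht), sign_glue_one, smul_smul,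
      ← Int.cast_mul, ← Units.val_mul, Int.units_mul_self]
    simp
  rw [Finset.sum_congr rfl h1, Finset.sum_const, Nat.cast_smul_eq_nsmul]

/-- `a_λ b_μ` is a quasi-idempotent with scalar `m! κ_μ`, and `b_λ` is a left multiple of `b_μ`
up to a nonzero scalar. So the factor `b_μ a_λ` in front of `b_λ` may be dropped. -/
theorem rowSymmetrizer_mul_glueAlg_mul (h : rows lam = m :: rows mu) :
    rowSymmetrizer lam * glueAlg m Δ (colAntisymmetrizer mu) * rowSymmetrizer lam *
      colAntisymmetrizer lam =
        ((m.factorial : ℂ) * youngScalar mu) • youngSymmetrizer lam := by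
  classical
  have hc : (((Finset.univ.filter (· ∈ colGroup mu)).card : ℕ) : ℂ) ≠ 0 :=
    Nat.cast_ne_zero.2 (Finset.card_ne_zero.2 ⟨1, by simp [one_mem_colGroup]⟩)
  set N := (((Finset.univ.filter (· ∈ colGroup mu)).card : ℕ) : ℂ)
  set B := glueAlg m Δ (colAntisymmetrizer mu) with hB
  set A := glueAlg m Δ (rowSymmetrizer mu) with hA
  set E := firstRowSum m Δ
  have hNb : B * colAntisymmetrizer lam = N • colAntisymmetrizer lam :=
    glueAlg_colAntisymmetrizer_mul h
  have hAB : A * B * (A * B) = youngScalar mu • (A * B) := by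
    rw [hA, hB, ← map_mul, ← map_mul, ← map_smul, ← youngSymmetrizer,
      youngSymmetrizer_mul_self]
  have hcomm : A * B * E = E * (A * B) := by
    rw [hA, hB, ← map_mul, glueAlg_mul_firstRowSum]
  have hEAB : E * A * B * (E * A * B) = ((m.factorial : ℂ) * youngScalar mu) • (E * A * B) := by
    calc E * A * B * (E * A * B) = E * (A * B * E) * (A * B) := by simp only [mul_assoc]
      _ = E * E * (A * B * (A * B)) := by rw [hcomm]; simp only [mul_assoc]
      _ = _ := by
        rw [hAB, firstRowSum_mul_self, smul_mul_assoc, mul_smul_comm, smul_smul, mul_assoc E A B]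
  have hsmul : N • (E * A * B * (E * A) * colAntisymmetrizer lam) =
      N • (((m.factorial : ℂ) * youngScalar mu) • (E * A * colAntisymmetrizer lam)) := by
    calc N • (E * A * B * (E * A) * colAntisymmetrizer lam)
        = E * A * B * (E * A) * (B * colAntisymmetrizer lam) := by rw [hNb, mul_smul_comm]
      _ = E * A * B * (E * A * B) * colAntisymmetrizer lam := by simp only [mul_assoc]
      _ = ((m.factorial : ℂ) * youngScalar mu) • (E * A * (B * colAntisymmetrizer lam)) := by
        rw [hEAB, smul_mul_assoc, mul_assoc (E * A)]
      _ = _ := by rw [hNb, mul_smul_comm, smul_comm]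
  have := smul_right_injective _ hc hsmul
  rw [youngSymmetrizer, rowSymmetrizer_eq h]
  exact this

theorem spechtTrace_rowSymmetrizer_mul_glueAlg (h : rows lam = m :: rows mu) :
    spechtTrace lam (rowSymmetrizer lam * glueAlg m Δ (colAntisymmetrizer mu)) =
      m.factorial * youngScalar mu := by
  rw [spechtTrace_rowSymmetrizer_mul]
  set B := glueAlg m Δ (colAntisymmetrizer mu)
  have h1 : youngFunctional lam (B * rowSymmetrizer lam * colAntisymmetrizer lam *
      rowSymmetrizer lam) • youngSymmetrizer lam =
      (((m.factorial : ℂ) * youngScalar mu) * youngScalar lam) • youngSymmetrizer lam := by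
    rw [← youngFunctional_spec]
    calc rowSymmetrizer lam * (B * rowSymmetrizer lam * colAntisymmetrizer lam *
          rowSymmetrizer lam) * colAntisymmetrizer lam
        = rowSymmetrizer lam * B * rowSymmetrizer lam * colAntisymmetrizer lam *
          youngSymmetrizer lam := by rw [youngSymmetrizer]; simp only [mul_assoc]
      _ = _ := by
        rw [rowSymmetrizer_mul_glueAlg_mul h, smul_mul_assoc, youngSymmetrizer_mul_self, smul_smul]
  have h2 := congrArg (fun x => x.coeff 1) h1
  simp only [coeff_smul_apply, youngSymmetrizer_coeff_one, smul_eq_mul, mul_one] at h2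
  rw [h2]
  field_simp [youngScalar_ne_zero lam]

theorem sum_chi_glue (t : Equiv.Perm (Fin Δ)) :
    ∑ r : Equiv.Perm (Fin m), chi lam (glue t r) =
      spechtTrace lam (glueAlg m Δ (single t 1) * firstRowSum m Δ) := by
  rw [glueAlg_single_mul_firstRowSum, spechtTrace_sum]
  rfl

/-- The multiplicity of `χ_μ ⊗ 1` in the restriction of `χ_λ` to `S_Δ × S_m` is one. -/
theorem sum_chi_mul_sum_chi_glue (h : rows lam = m :: rows mu) :
    ∑ t, chi mu t * ∑ r : Equiv.Perm (Fin m), chi lam (glue t r) =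
      Δ.factorial * m.factorial := by
  rw [sum_chi_mul mu]
  · have h1 : ∑ g, (youngSymmetrizer mu).coeff g *
        ∑ r : Equiv.Perm (Fin m), chi lam (glue g r) =
        spechtTrace lam (glueAlg m Δ (youngSymmetrizer mu) * firstRowSum m Δ) := by
      have h2 : youngSymmetrizer mu =
          ∑ g, (youngSymmetrizer mu).coeff g • single g (1 : ℂ) := by
        ext g
        classical
        simp [MonoidAlgebra.coeff_sum]
      conv_rhs => rw [h2]
      rw [map_sum, Finset.sum_mul, spechtTrace_sum]
      refine Finset.sum_congr rfl fun g _ => ?_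
      rw [map_smul, smul_mul_assoc, spechtTrace_smul, sum_chi_glue]
    rw [h1, glueAlg_mul_firstRowSum, youngSymmetrizer, map_mul,
      ← mul_assoc (firstRowSum m Δ), ← rowSymmetrizer_eq h,
      spechtTrace_rowSymmetrizer_mul_glueAlg h]
    have := youngScalar_ne_zero mu
    field_simp
  · intro t g
    rw [sum_chi_glue, sum_chi_glue, ← mul_one (1 : ℂ), ← mul_one (1 : ℂ), ← single_mul_single,
      ← single_mul_single, mul_one, map_mul, map_mul, mul_assoc, glueAlg_mul_firstRowSum,
      ← mul_assoc, spechtTrace_mul_comm, ← mul_assoc, ← mul_assoc, ← map_mul, ← map_mul,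
      single_mul_single, single_mul_single]
    simp

theorem col_lt (h : rows lam = m :: rows mu) (k : Fin (m + Δ)) : col lam k < m := by
  obtain ⟨h1, h2⟩ := cell_spec (lt_rows_sum lam k)
  refine lt_of_lt_of_le h2 ?_
  have h3 := List.sortedGE_iff_pairwise.1 (rows_sortedGE lam)
  have h4 : (rows lam)[(cell (rows lam) k).1] ∈ rows lam := List.getElem_mem _
  generalize (rows lam)[(cell (rows lam) k).1] = x at h4
  rw [h] at h3 h4
  rcases List.mem_cons.1 h4 with h5 | h5
  · exact h5.le
  · exact (List.pairwise_cons.1 h3).1 _ h5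

/-- A sum of permutations that absorbs the transpositions of more than `m` points, where `m` is
the number of columns, kills the Specht module: two of the points lie in one column. The sum over
the permutations that extend `t` along `f` absorbs the transpositions outside the image of `f`. -/
theorem sum_ite_intertwines_chi (h : rows lam = m :: rows mu) {δ : Type*} [Fintype δ]
    (hδ : Fintype.card δ < Δ) (t : Equiv.Perm δ) (f : δ ↪ Fin (m + Δ)) [DecidablePred
      fun s : Equiv.Perm (Fin (m + Δ)) => Intertwines t s f] :
    ∑ s : Equiv.Perm (Fin (m + Δ)), (if Intertwines t s f then chi lam s else 0) = 0 := by
  classical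
  set Z : MonoidAlgebra ℂ (Equiv.Perm (Fin (m + Δ))) :=
    ∑ s : Equiv.Perm (Fin (m + Δ)) with Intertwines t s f, single s 1 with hZ
  have h1 : ∑ s : Equiv.Perm (Fin (m + Δ)), (if Intertwines t s f then chi lam s else 0) =
      spechtTrace lam Z := by
    rw [hZ, spechtTrace_sum, Finset.sum_filter]
    rfl
  let B : Finset (Fin (m + Δ)) := (Finset.univ.map f)ᶜ
  have hZswap : ∀ i ∈ B, ∀ j ∈ B, Z * single (Equiv.swap i j) 1 = Z := by
    intro i hi j hj
    have hfix : ∀ x, Equiv.swap i j (f x) = f x := by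
      intro x
      refine Equiv.swap_apply_of_ne_of_ne ?_ ?_
      · rintro rfl; simp [B] at hi
      · rintro rfl; simp [B] at hj
    rw [hZ, Finset.sum_mul]
    refine Finset.sum_bij (fun s _ => s * Equiv.swap i j) ?_ ?_ ?_ ?_
    · intro s hs
      simp only [Finset.mem_filter, Finset.mem_univ, true_and] at hs ⊢
      intro x
      rw [Equiv.Perm.mul_apply, hfix]
      exact hs x
    · intro s _ s' _ hss
      exact mul_right_cancel hss
    · intro s hs
      simp only [Finset.mem_filter, Finset.mem_univ, true_and] at hs
      refine ⟨s * Equiv.swap i j, ?_, by rw [mul_assoc, Equiv.swap_mul_self, mul_one]⟩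
      simp only [Finset.mem_filter, Finset.mem_univ, true_and]
      intro x
      rw [Equiv.Perm.mul_apply, hfix]
      exact hs x
    · intro s _
      rw [single_mul_single, one_mul]
  have hBcard : m < B.card := by
    rw [Finset.card_compl, Finset.card_map, Finset.card_univ, Fintype.card_fin]
    omega
  have hkill : ∀ g : Equiv.Perm (Fin (m + Δ)),
      Z * single g 1 * colAntisymmetrizer lam = 0 := by
    intro g
    obtain ⟨i, hi, j, hj, hij, hcol⟩ := Finset.exists_ne_map_eq_of_card_lt_of_maps_to
      (s := B) (t := Finset.range m) (f := fun x => col lam (g⁻¹ x))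
      (by rwa [Finset.card_range]) (fun x _ => by
        simpa using col_lt h (g⁻¹ x))
    exact mul_single_mul_colAntisymmetrizer_eq_zero lam hij (hZswap i hi j hj) g hcol
  have hzero : mulLeft ℂ Z ∘ₗ mulRight ℂ (colAntisymmetrizer lam) = 0 := by
    refine (MonoidAlgebra.basis (Equiv.Perm (Fin (m + Δ))) ℂ).ext fun g => ?_
    have hg : (MonoidAlgebra.basis (Equiv.Perm (Fin (m + Δ))) ℂ) g = single g 1 := by
      simp [MonoidAlgebra.basis]
    rw [hg]
    change Z * (single g 1 * colAntisymmetrizer lam) = 0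
    rw [← mul_assoc, hkill]
  have hzero' : mulLeft ℂ Z ∘ₗ mulRight ℂ (youngSymmetrizer lam) = 0 := by
    refine LinearMap.ext fun z => ?_
    have := LinearMap.congr_fun hzero (z * rowSymmetrizer lam)
    simpa [youngSymmetrizer, mul_assoc] using this
  rw [h1, spechtTrace_eq, hzero', map_zero, mul_zero]

/-- The character of the Specht module of `(m, μ)` in terms of that of `μ`. Both sides are real
functions of norm one, and their scalar product is one. -/
theorem chi_eq_charPoly (h : rows lam = m :: rows mu) (hm : Δ ≤ m)
    (s : Equiv.Perm (Fin (m + Δ))) : chi lam s = charPoly (chi mu) s := by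
  classical
  have hΔ : (Δ.factorial : ℂ) ≠ 0 := Nat.cast_ne_zero.2 (Nat.factorial_ne_zero _)
  have hm' : (m.factorial : ℂ) ≠ 0 := Nat.cast_ne_zero.2 (Nat.factorial_ne_zero _)
  have h1 : ∑ s : Equiv.Perm (Fin (m + Δ)), charPoly (chi mu) s * charPoly (chi mu) s =
      ((m + Δ).factorial : ℂ) := by
    rw [sum_charPoly_mul_self (splitRows m Δ) (fun s g => chi_conj mu s g) (by simpa using hm),
      sum_chi_mul_chi, Fintype.card_fin, Fintype.card_fin, inv_mul_cancel₀ hΔ, mul_one]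
  have h2 : ∑ s, charPoly (chi mu) s * chi lam s = ((m + Δ).factorial : ℂ) := by
    have h3 := sum_charPoly_mul (splitRows m Δ) (chi mu) (chi lam) (chi_conj lam) (by
      intro t W hW
      have hlt := card_subtype_mem_lt t hW
      rw [Nat.card_eq_fintype_card, Nat.card_eq_fintype_card, Fintype.card_fin] at hlt
      simp_rw [embCount_eq_sum]
      push_cast
      simp_rw [Finset.sum_mul]
      rw [Finset.sum_comm]
      refine Finset.sum_eq_zero fun f _ => ?_
      simp_rw [ite_mul, one_mul, zero_mul]
      exact sum_ite_intertwines_chi h hlt _ f)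
    have h4 := sum_chi_mul_sum_chi_glue h
    simp only [glue] at h4
    rw [h4, Fintype.card_fin, Fintype.card_fin, Fintype.card_fin, inv_mul_cancel_left₀ hΔ,
      mul_comm] at h3
    exact mul_right_cancel₀ hm' h3
  have h3 : ∑ s, (charPoly (chi mu) s - chi lam s) * (charPoly (chi mu) s - chi lam s) = 0 := by
    have : ∀ s, (charPoly (chi mu) s - chi lam s) * (charPoly (chi mu) s - chi lam s) =
        charPoly (chi mu) s * charPoly (chi mu) s - 2 * (charPoly (chi mu) s * chi lam s) +
          chi lam s * chi lam s := fun s => by ring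
    rw [Finset.sum_congr rfl fun s _ => this s, Finset.sum_add_distrib, Finset.sum_sub_distrib,
      ← Finset.mul_sum, h1, h2, sum_chi_mul_chi]
    ring
  have hreal : ∀ s, ∃ x : ℝ, charPoly (chi mu) s - chi lam s = x := fun s => by
    have : starRingEnd ℂ (charPoly (chi mu) s - chi lam s) = charPoly (chi mu) s - chi lam s := by
      rw [map_sub, conj_charPoly (conj_chi mu), conj_chi]
    obtain ⟨x, hx⟩ := Complex.conj_eq_iff_real.1 this
    exact ⟨x, hx⟩
  choose x hx using hreal
  simp_rw [hx] at h3
  have h4 : ∑ s, x s * x s = 0 := by exact_mod_cast h3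
  have h5 := (Finset.sum_eq_zero_iff_of_nonneg fun s _ => mul_self_nonneg (x s)).1 h4 s
    (Finset.mem_univ s)
  have h6 := hx s
  rw [mul_self_eq_zero.1 h5, Complex.ofReal_zero] at h6
  exact (sub_eq_zero.1 h6).symm

end LongFirstRow
end RootNumber

/-! ### Invariant sets -/

namespace RootNumber
open Equiv Equiv.Perm

section InvariantSets
variable {γ α α' δ β : Type*}

/-- The number of `k`-element sets that the permutation `s` maps to themselves. -/
noncomputable def invCount (s : Perm α) (k : ℕ) : ℕ :=
  Nat.card {A : Finset α // A.card = k ∧ ∀ x ∈ A, s x ∈ A}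

variable [Fintype α] [DecidableEq α]

/-- An embedding with an invariant image is given by the image and one of `|D|!` numberings. -/
theorem card_embedding_range_invariant_le (s : Perm α) (D : Finset γ)
    [Fintype {f : {x : γ // x ∈ D} ↪ α // ∀ x ∈ Finset.univ.map f, s x ∈ Finset.univ.map f}] :
    Fintype.card {f : {x : γ // x ∈ D} ↪ α //
      ∀ x ∈ Finset.univ.map f, s x ∈ Finset.univ.map f} ≤
      D.card.factorial * invCount s D.card := by
  classical
  rw [Fintype.card_subtype]
  have hmaps : ∀ f ∈ (Finset.univ.filter fun f : {x : γ // x ∈ D} ↪ α =>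
      ∀ x ∈ Finset.univ.map f, s x ∈ Finset.univ.map f), Finset.univ.map f ∈
      (Finset.univ.filter fun A : Finset α => A.card = D.card ∧ ∀ x ∈ A, s x ∈ A) := by
    intro f hf
    simp only [Finset.mem_filter, Finset.mem_univ, true_and] at hf ⊢
    exact ⟨by rw [Finset.card_map, Finset.card_univ, Fintype.card_coe], hf⟩
  have h := Finset.card_le_mul_card_image_of_maps_to hmaps D.card.factorial (fun A hA => by
    simp only [Finset.mem_filter, Finset.mem_univ, true_and] at hA
    have : Fintype.card ({x : γ // x ∈ D} ↪ {x : α // x ∈ A}) = D.card.factorial := by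
      rw [Fintype.card_embedding_eq, Fintype.card_coe, Fintype.card_coe, hA.1,
        Nat.descFactorial_self]
    rw [← this, ← Finset.card_univ]
    refine Finset.card_le_card_of_surjOn
      (fun f => f.trans (Function.Embedding.subtype _)) ?_
    intro f hf
    simp only [Finset.coe_filter, Finset.mem_filter, Finset.mem_univ, true_and,
      Set.mem_ofPred_eq] at hf
    have hfA : ∀ x, f x ∈ A := fun x => by
      rw [← hf.2]; exact Finset.mem_map_of_mem _ (Finset.mem_univ x)
    exact ⟨⟨fun x => ⟨f x, hfA x⟩, fun x y hxy => f.injective (congrArg Subtype.val hxy)⟩,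
      Finset.mem_coe.2 (Finset.mem_univ _), by ext x; rfl⟩)
  rwa [invCount, Nat.card_eq_fintype_card, Fintype.card_subtype]

variable [Fintype γ] [DecidableEq γ]

open scoped Classical in
/-- Pairs of a permutation `t` of `γ` that preserves `D` and an embedding of `D` that intertwines
`t` and `s`: the image of the embedding is invariant under `s`, the embedding determines `t` on `D`,
and `t` is arbitrary on the complement. -/
theorem sum_card_extensions_le (s : Perm α) (D : Finset γ) :
    ∑ t : Perm γ, (if ∀ x ∈ D, t x ∈ D then
      Fintype.card {f : {x : γ // x ∈ D} ↪ α //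
        ∀ x y : {x : γ // x ∈ D}, t x = y → f y = s (f x)} else 0) ≤
      D.card.factorial * (Fintype.card γ - D.card).factorial * invCount s D.card := by
  have h1 : ∀ f : {x : γ // x ∈ D} ↪ α,
      (Finset.univ.filter fun t : Perm γ => (∀ x ∈ D, t x ∈ D) ∧
        ∀ x y : {x : γ // x ∈ D}, t x = y → f y = s (f x)).card ≤
      if ∀ x ∈ Finset.univ.map f, s x ∈ Finset.univ.map f then
        (Fintype.card γ - D.card).factorial else 0 := by
    intro f
    split_ifs with hf
    · have hc : Fintype.card (Perm {x : γ // x ∉ D}) = (Fintype.card γ - D.card).factorial := by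
        rw [Fintype.card_perm, Fintype.card_subtype_compl, Fintype.card_coe]
      rw [← hc, ← Finset.card_univ]
      have hinv : ∀ t : Perm γ, (∀ x ∈ D, t x ∈ D) → ∀ x, t x ∉ D ↔ x ∉ D := by
        intro t ht x
        refine not_congr ⟨fun h => ?_, ht x⟩
        have := perm_symm_on_of_perm_on_finset (s := D) (f := t) (fun x => ht x) h
        rwa [Equiv.symm_apply_apply] at this
      refine Finset.card_le_card_of_injOn
        (fun t => if h : ∀ x ∈ D, t x ∈ D then t.subtypePerm (hinv t h) else 1)
        (fun t _ => Finset.mem_coe.2 (Finset.mem_univ _)) ?_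
      intro t ht t' ht' htt
      simp only [Finset.coe_filter, Finset.mem_univ, true_and, Set.mem_ofPred_eq] at ht ht'
      dsimp only at htt
      rw [dif_pos ht.1, dif_pos ht'.1] at htt
      ext x
      by_cases hx : x ∈ D
      · have e1 := ht.2 ⟨x, hx⟩ ⟨t x, ht.1 x hx⟩ rfl
        have e2 := ht'.2 ⟨x, hx⟩ ⟨t' x, ht'.1 x hx⟩ rfl
        exact congrArg Subtype.val (f.injective (e1.trans e2.symm))
      · have := Equiv.congr_fun htt ⟨x, hx⟩
        exact congrArg Subtype.val this
    · rw [Nat.le_zero, Finset.card_eq_zero, Finset.filter_eq_empty_iff]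
      rintro t - ⟨ht1, ht2⟩
      apply hf
      intro x hx
      obtain ⟨y, -, rfl⟩ := Finset.mem_map.1 hx
      rw [← ht2 y ⟨t y, ht1 y y.2⟩ rfl]
      exact Finset.mem_map_of_mem _ (Finset.mem_univ _)
  have h2 : ∀ t : Perm γ, (if ∀ x ∈ D, t x ∈ D then
      Fintype.card {f : {x : γ // x ∈ D} ↪ α //
        ∀ x y : {x : γ // x ∈ D}, t x = y → f y = s (f x)} else 0) =
      ∑ f : {x : γ // x ∈ D} ↪ α, if (∀ x ∈ D, t x ∈ D) ∧
        ∀ x y : {x : γ // x ∈ D}, t x = y → f y = s (f x) then 1 else 0 := by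
    intro t
    rw [← Finset.card_filter]
    split_ifs with h
    · rw [Fintype.card_subtype]
      congr 1
      ext f
      simp only [Finset.mem_filter, Finset.mem_univ, true_and]
      exact ⟨fun hf => ⟨h, hf⟩, fun hf => hf.2⟩
    · symm
      rw [Finset.card_eq_zero, Finset.filter_eq_empty_iff]
      exact fun f _ hf => h hf.1
  rw [Finset.sum_congr rfl fun t _ => h2 t, Finset.sum_comm]
  simp_rw [← Finset.card_filter]
  refine (Finset.sum_le_sum fun f _ => h1 f).trans ?_
  rw [← Finset.sum_filter, Finset.sum_const, smul_eq_mul, ← Fintype.card_subtype]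
  have := card_embedding_range_invariant_le s D
  calc _ ≤ D.card.factorial * invCount s D.card * (Fintype.card γ - D.card).factorial :=
        Nat.mul_le_mul_right _ this
    _ = _ := by ring

theorem sum_embCount_restrict_le (s : Perm α) :
    ∑ t : Perm γ, ∑ W : Finset (Orbits t), embCount (restrict t W) s ≤
      (Fintype.card γ).factorial *
        ∑ k ∈ Finset.range (Fintype.card γ + 1), invCount s k := by
  classical
  have h1 : ∀ t : Perm γ, ∑ W : Finset (Orbits t), embCount (restrict t W) s ≤
      ∑ D : Finset γ, if ∀ x ∈ D, t x ∈ D then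
        Fintype.card {f : {x : γ // x ∈ D} ↪ α //
          ∀ x y : {x : γ // x ∈ D}, t x = y → f y = s (f x)} else 0 := by
    intro t
    let U : Finset (Orbits t) → Finset γ := fun W => Finset.univ.filter fun x => ⟦x⟧ ∈ W
    have hU : Function.Injective U := by
      intro W W' h
      ext o
      induction o using Quotient.inductionOn with
      | h x => simpa [U] using congrArg (x ∈ ·) h
    have h2 : ∀ W, embCount (restrict t W) s = if ∀ x ∈ U W, t x ∈ U W then
        Fintype.card {f : {x : γ // x ∈ U W} ↪ α //
          ∀ x y : {x : γ // x ∈ U W}, t x = y → f y = s (f x)} else 0 := by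
      intro W
      have hmem : ∀ x, x ∈ U W ↔ (⟦x⟧ : Orbits t) ∈ W := fun x => by simp [U]
      rw [if_pos (fun x hx => by
        rw [hmem] at hx ⊢; rw [mk_apply_eq]; exact hx), ← Nat.card_eq_fintype_card]
      let e : {x : γ // (⟦x⟧ : Orbits t) ∈ W} ≃ {x : γ // x ∈ U W} :=
        Equiv.subtypeEquivRight fun x => (hmem x).symm
      refine Nat.card_congr ((Equiv.embeddingCongr e (Equiv.refl α)).subtypeEquiv fun f => ?_)
      constructor
      · intro hf x y hxy
        have := hf (e.symm x)
        have h3 : restrict t W (e.symm x) = e.symm y := Subtype.ext hxy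
        rw [h3] at this
        exact this
      · intro hf x
        exact hf (e x) (e (restrict t W x)) rfl
    rw [Finset.sum_congr rfl fun W _ => h2 W, ← Finset.sum_image (f := fun D => if
      ∀ x ∈ D, t x ∈ D then Fintype.card {f : {x : γ // x ∈ D} ↪ α //
          ∀ x y : {x : γ // x ∈ D}, t x = y → f y = s (f x)} else 0) hU.injOn]
    exact Finset.sum_le_sum_of_subset (Finset.subset_univ _)
  refine (Finset.sum_le_sum fun t _ => h1 t).trans ?_
  rw [Finset.sum_comm]
  refine (Finset.sum_le_sum fun D _ => sum_card_extensions_le s D).trans ?_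
  rw [← Finset.powerset_univ, Finset.sum_powerset_apply_card
    (fun k => k.factorial * (Fintype.card γ - k).factorial * invCount s k), Finset.mul_sum,
    Finset.card_univ]
  refine (Finset.sum_congr rfl fun k hk => ?_).le
  rw [smul_eq_mul, ← Nat.choose_mul_factorial_mul_factorial
    (Nat.lt_succ_iff.1 (Finset.mem_range.1 hk))]
  ring

/-- The identity permutation gives the main term of `charPoly`; everything else is bounded by
counts of invariant sets. -/
theorem norm_charPoly_sub_le {φ : Perm γ → ℂ} (hφ : ∀ t, ‖φ t‖ ≤ ‖φ 1‖) (s : Perm α) :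
    ‖charPoly φ s - φ 1 * (((Fintype.card γ).factorial : ℂ)⁻¹ * embCount (1 : Perm γ) s)‖ ≤
      ‖φ 1‖ * ((∑ k ∈ Finset.range (Fintype.card γ + 1), (invCount s k : ℝ)) -
        ((Fintype.card γ).factorial : ℝ)⁻¹ * embCount (1 : Perm γ) s) := by
  classical
  have hγ : (0 : ℝ) < ((Fintype.card γ).factorial : ℝ) := Nat.cast_pos.2 (Nat.factorial_pos _)
  let T := Σ t : Perm γ, Finset (Orbits t)
  let g : T → ℂ := fun p => φ p.1 * ((-1) ^ p.2.card * (embCount (restrict p.1 p.2ᶜ) s : ℂ))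
  let N : T → ℝ := fun p => embCount (restrict p.1 p.2ᶜ) s
  let o : T := ⟨1, ∅⟩
  have hN0 : N o = embCount (1 : Perm γ) s := by
    change ((embCount (restrict (1 : Perm γ) (∅ : Finset (Orbits (1 : Perm γ)))ᶜ) s : ℕ) : ℝ) = _
    rw [Finset.compl_empty, embCount_restrict_univ]
  have hsum : ∑ p, N p ≤ (Fintype.card γ).factorial *
      ∑ k ∈ Finset.range (Fintype.card γ + 1), (invCount s k : ℝ) := by
    have h1 := sum_embCount_restrict_le (γ := γ) s
    have h2 : ∑ p, N p = ((∑ t : Perm γ, ∑ W : Finset (Orbits t),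
        embCount (restrict t W) s : ℕ) : ℝ) := by
      rw [Fintype.sum_sigma]
      push_cast
      refine Finset.sum_congr rfl fun t _ => ?_
      exact Fintype.sum_bijective compl compl_bijective _ _ fun _ => rfl
    rw [h2]
    exact_mod_cast h1
  have hchar : charPoly φ s = ((Fintype.card γ).factorial : ℂ)⁻¹ * ∑ p, g p := by
    rw [charPoly_eq, Fintype.sum_sigma]
    congr 1
    refine Finset.sum_congr rfl fun t _ => ?_
    rw [cyclePoly, Finset.mul_sum]
  have hg0 : g o = φ 1 * embCount (1 : Perm γ) s := by
    change φ 1 * ((-1) ^ (∅ : Finset (Orbits (1 : Perm γ))).card *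
      (embCount (restrict (1 : Perm γ) (∅ : Finset (Orbits (1 : Perm γ)))ᶜ) s : ℂ)) = _
    rw [Finset.compl_empty, embCount_restrict_univ, Finset.card_empty, pow_zero, one_mul]
  have hg : ∀ p, ‖g p‖ ≤ ‖φ 1‖ * N p := by
    intro p
    simp only [g, N, norm_mul, norm_pow, norm_neg, norm_one, one_pow, one_mul,
      Complex.norm_natCast]
    exact mul_le_mul_of_nonneg_right (hφ _) (Nat.cast_nonneg _)
  have hsplit : charPoly φ s - φ 1 * (((Fintype.card γ).factorial : ℂ)⁻¹ *
      embCount (1 : Perm γ) s) =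
      ((Fintype.card γ).factorial : ℂ)⁻¹ * ∑ p ∈ Finset.univ.erase o, g p := by
    rw [hchar, ← Finset.add_sum_erase _ _ (Finset.mem_univ o), hg0]
    ring
  rw [hsplit, norm_mul, norm_inv, Complex.norm_natCast]
  have h3 : ‖∑ p ∈ Finset.univ.erase o, g p‖ ≤ ‖φ 1‖ * ((Fintype.card γ).factorial *
      ∑ k ∈ Finset.range (Fintype.card γ + 1), (invCount s k : ℝ) -
        embCount (1 : Perm γ) s) := by
    refine (norm_sum_le _ _).trans ((Finset.sum_le_sum fun p _ => hg p).trans ?_)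
    rw [← Finset.mul_sum]
    refine mul_le_mul_of_nonneg_left ?_ (norm_nonneg _)
    have := Finset.add_sum_erase _ N (Finset.mem_univ o)
    linarith
  calc _ ≤ ((Fintype.card γ).factorial : ℝ)⁻¹ * (‖φ 1‖ * ((Fintype.card γ).factorial *
      ∑ k ∈ Finset.range (Fintype.card γ + 1), (invCount s k : ℝ) -
        embCount (1 : Perm γ) s)) := mul_le_mul_of_nonneg_left h3 (by positivity)
    _ = _ := by field_simp

theorem embCount_one (s : Perm α) (γ : Type*) [Fintype γ] :
    embCount (1 : Perm γ) s =
      (Fintype.card {x // s x = x}).descFactorial (Fintype.card γ) := by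
  classical
  rw [← Fintype.card_embedding_eq, embCount, ← Nat.card_eq_fintype_card]
  refine Nat.card_congr ⟨fun f => ⟨fun x => ⟨f.1 x, (f.2 x).symm⟩, fun x y h =>
    f.1.injective (congrArg Subtype.val h)⟩, fun f => ⟨f.trans (Function.Embedding.subtype _),
      fun x => (f x).2.symm⟩, fun f => rfl, fun f => rfl⟩

end InvariantSets
end RootNumber

/-! ### Invariant sets of a random power -/

namespace RootNumber
open Equiv Equiv.Perm

section CycleRemoval
variable {α δ β : Type*}

section Conjugation
variable [Fintype δ] [Fintype β] [DecidableEq δ] [DecidableEq β] [Fintype α] [DecidableEq α]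

open scoped Classical in
/-- The version of `sum_embedding_sum_perm` for a set of the same size as `δ ⊕ β`. -/
theorem sum_embedding_sum_perm_of_equiv {R : Type*} [AddCommMonoid R] (e : δ ⊕ β ≃ α)
    (F : Perm α → (δ ↪ α) → R)
    (hF : ∀ g s c, F (g * s * g⁻¹) (c.trans g.toEmbedding) = F s c) (t : Perm δ) :
    (Fintype.card β).factorial •
        ∑ c : δ ↪ α, ∑ s, (if Intertwines t s c then F s c else 0) =
      (Fintype.card α).factorial •
        ∑ r : Perm β, F (e.permCongr (Equiv.Perm.sumCongr t r))
          (Function.Embedding.inl.trans e.toEmbedding) := by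
  have h := sum_embedding_sum_perm
    (fun s c => F (e.permCongr s) (c.trans e.toEmbedding)) (fun g s c => by
      have h1 : e.permCongr (g * s * g⁻¹) =
          e.permCongr g * e.permCongr s * (e.permCongr g)⁻¹ := by
        simp only [← Equiv.permCongrHom_coe, map_mul, map_inv]
      have h2 : (c.trans g.toEmbedding).trans e.toEmbedding =
          (c.trans e.toEmbedding).trans (e.permCongr g).toEmbedding := by
        ext x; simp
      rw [h1, h2, hF]) t
  rw [Fintype.card_congr e] at h
  rw [← h]
  congr 1
  rw [← Equiv.sum_comp (Equiv.embeddingCongr (Equiv.refl δ) e)]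
  refine Finset.sum_congr rfl fun c _ => ?_
  rw [← Equiv.sum_comp e.permCongr]
  refine Finset.sum_congr rfl fun s _ => ?_
  have h3 : Equiv.embeddingCongr (Equiv.refl δ) e c = c.trans e.toEmbedding := by
    ext x; rfl
  rw [h3]
  refine if_congr (forall_congr' fun x => ?_) rfl rfl
  simp

end Conjugation

/-- The cyclic permutation `x ↦ x + 1` of `ZMod d`. -/
def rot (d : ℕ) : Perm (ZMod d) := Equiv.addRight 1

theorem rot_pow_apply (d q : ℕ) (x : ZMod d) : (rot d ^ q) x = x + q := by
  induction q generalizing x with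
  | zero => simp
  | succ q ih =>
    rw [pow_succ', Perm.mul_apply, ih]
    simp [rot, add_assoc]

theorem intertwines_rot_natCast {d : ℕ} {s : Perm α} {c : ZMod d → α}
    (h : Intertwines (rot d) s c) (i : ℕ) : c (i : ZMod d) = (s^[i]) (c 0) := by
  induction i with
  | zero => simp
  | succ i ih =>
    rw [Function.iterate_succ_apply', ← ih, ← h]
    simp [rot]

theorem intertwines_rot_minimalPeriod {d : ℕ} {s : Perm α} {c : ZMod d ↪ α}
    (h : Intertwines (rot d) s c) : Function.minimalPeriod s (c 0) = d := by
  have h1 : ∀ i, Function.IsPeriodicPt s i (c 0) ↔ d ∣ i := by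
    intro i
    rw [Function.IsPeriodicPt, Function.IsFixedPt, ← intertwines_rot_natCast h,
      c.injective.eq_iff, ZMod.natCast_eq_zero_iff]
  refine Nat.dvd_antisymm ?_ ?_
  · rw [← Function.isPeriodicPt_iff_minimalPeriod_dvd, h1]
  · rw [← h1]
    exact Function.isPeriodicPt_minimalPeriod _ _

variable [Fintype α] [DecidableEq α]

omit [DecidableEq α] in
open scoped Classical in
/-- A point of a cycle of length `d` is the same as an embedding of `ZMod d` that intertwines
`x ↦ x + 1` and the permutation. -/
theorem sum_intertwines_rot {R : Type*} [AddCommMonoid R] (d : ℕ) [NeZero d] (s : Perm α)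
    (F : α → R) :
    ∑ c : ZMod d ↪ α, (if Intertwines (rot d) s c then F (c 0) else 0) =
      ∑ a, if Function.minimalPeriod s a = d then F a else 0 := by
  rw [← Finset.sum_filter, ← Finset.sum_filter]
  refine Finset.sum_bij (fun c _ => c 0) ?_ ?_ ?_ ?_
  · intro c hc
    simp only [Finset.mem_filter, Finset.mem_univ, true_and] at hc ⊢
    exact intertwines_rot_minimalPeriod hc
  · intro c hc c' hc' h
    simp only [Finset.mem_filter, Finset.mem_univ, true_and] at hc hc'
    ext x
    rw [← ZMod.natCast_zmod_val x, intertwines_rot_natCast hc, intertwines_rot_natCast hc', h]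
  · intro a ha
    simp only [Finset.mem_filter, Finset.mem_univ, true_and] at ha
    refine ⟨⟨fun x => (s^[x.val]) a, fun x y hxy => ?_⟩, ?_, ?_⟩
    · refine ZMod.val_injective d ?_
      exact (Function.iterate_eq_iterate_iff_of_lt_minimalPeriod (by rw [ha]; exact x.val_lt)
        (by rw [ha]; exact y.val_lt)).1 hxy
    · simp only [Finset.mem_filter, Finset.mem_univ, true_and]
      intro x
      change (s^[(x + 1).val]) a = s ((s^[x.val]) a)
      rw [← Function.iterate_succ_apply' s,
        ← Function.iterate_mod_minimalPeriod_eq (n := x.val.succ), ha]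
      congr 2
      rw [← ZMod.val_natCast]
      simp
    · change (s^[(0 : ZMod d).val]) a = a
      rw [ZMod.val_zero]
      rfl
  · intro c _
    rfl

open scoped Classical in
/-- The mean number of points on cycles of length `d ≤ |α|` is one. -/
theorem sum_card_minimalPeriod {d : ℕ} (hd : d ≠ 0) (hdn : d ≤ Fintype.card α) :
    ∑ s : Perm α, ∑ a, (if Function.minimalPeriod s a = d then 1 else 0) =
      (Fintype.card α).factorial := by
  have : NeZero d := ⟨hd⟩
  rw [← sum_embCount (α := α) (by rwa [ZMod.card]) (rot d)]
  refine Finset.sum_congr rfl fun s _ => ?_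
  rw [embCount_eq_sum, sum_intertwines_rot d s (fun _ => 1)]

/-- The number of `k`-element sets that contain `a` and that `s` maps to themselves. -/
noncomputable def rootedCount {α : Type*} (s : Perm α) (k : ℕ) (a : α) : ℕ :=
  Nat.card {A : Finset α // a ∈ A ∧ A.card = k ∧ ∀ x ∈ A, s x ∈ A}

omit [Fintype α] [DecidableEq α] in
theorem rootedCount_permCongr {α' : Type*} (e : α ≃ α') (s : Perm α) (k : ℕ) (a : α) :
    rootedCount (e.permCongr s) k (e a) = rootedCount s k a := by
  symm
  refine Nat.card_congr (e.finsetCongr.subtypeEquiv fun A => ?_)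
  simp only [Equiv.finsetCongr_apply, Finset.mem_map_equiv, Equiv.symm_apply_apply,
    Finset.card_map, Equiv.permCongr_apply]
  refine and_congr_right fun _ => and_congr_right fun _ => ⟨fun h x hx => h _ hx, fun h x hx => ?_⟩
  simpa using h (e x) (by simpa using hx)

omit [DecidableEq α] in
theorem sum_rootedCount (s : Perm α) (k : ℕ) :
    ∑ a, rootedCount s k a = k * invCount s k := by
  classical
  simp only [rootedCount, invCount, Nat.card_eq_fintype_card, Fintype.card_subtype,
    Finset.card_filter]
  rw [Finset.sum_comm, Finset.mul_sum]
  refine Finset.sum_congr rfl fun A _ => ?_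
  split_ifs with h
  · have h' : ∀ a, (a ∈ A ∧ A.card = k ∧ ∀ x ∈ A, s x ∈ A) ↔ a ∈ A :=
      fun a => ⟨And.left, fun ha => ⟨ha, h⟩⟩
    simp only [h']
    rw [← h.1]
    simp
  · rw [mul_zero]
    exact Finset.sum_eq_zero fun a _ => if_neg fun h' => h h'.2

/-- The number of `j`-element subsets of `ZMod d` that contain `0` and that are mapped to
themselves by the translation by `q`. -/
noncomputable def cycCount (d q j : ℕ) : ℕ :=
  Nat.card {S : Finset (ZMod d) // 0 ∈ S ∧ S.card = j ∧ ∀ x ∈ S, x + q ∈ S}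

theorem rootedCount_sumCongr_le [Finite β] {d : ℕ} [NeZero d] (q k : ℕ) (r : Perm β) :
    rootedCount (Equiv.Perm.sumCongr (rot d) r ^ q) k (Sum.inl 0) ≤
      ∑ j ∈ Finset.Icc 1 k, cycCount d q j * invCount (r ^ q) (k - j) := by
  classical
  have := Fintype.ofFinite β
  have hpow : Equiv.Perm.sumCongr (rot d) r ^ q = Equiv.Perm.sumCongr (rot d ^ q) (r ^ q) :=
    (map_pow (Equiv.Perm.sumCongrHom (ZMod d) β) (rot d, r) q).symm
  rw [hpow]
  simp only [rootedCount, invCount, cycCount, Nat.card_eq_fintype_card, Fintype.card_subtype]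
  have hmaps : ∀ A ∈ Finset.univ.filter (fun A : Finset (ZMod d ⊕ β) => Sum.inl 0 ∈ A ∧
      A.card = k ∧ ∀ x ∈ A, Equiv.Perm.sumCongr (rot d ^ q) (r ^ q) x ∈ A),
      A.toLeft.card ∈ Finset.Icc 1 k := by
    intro A hA
    simp only [Finset.mem_filter, Finset.mem_univ, true_and] at hA
    rw [Finset.mem_Icc, ← hA.2.1]
    exact ⟨Finset.card_pos.2 ⟨0, Finset.mem_toLeft.2 hA.1⟩, Finset.card_toLeft_le⟩
  rw [Finset.card_eq_sum_card_fiberwise hmaps]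
  refine Finset.sum_le_sum fun j _ => ?_
  rw [← Finset.card_product]
  refine Finset.card_le_card_of_injOn (fun A => (A.toLeft, A.toRight)) ?_ ?_
  · intro A hA
    simp only [Finset.coe_filter, Finset.mem_filter, Finset.mem_univ, true_and,
      Set.mem_ofPred_eq] at hA
    obtain ⟨⟨h0, hk, hinv⟩, hj⟩ := hA
    simp only [Finset.coe_product, Finset.coe_filter, Finset.mem_univ, true_and, Set.mem_prod,
      Set.mem_ofPred_eq, Finset.mem_toLeft, Finset.mem_toRight]
    refine ⟨⟨h0, hj, fun x hx => ?_⟩, ?_, fun x hx => ?_⟩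
    · have := hinv _ hx
      rwa [Equiv.Perm.sumCongr_apply, Sum.map_inl, rot_pow_apply] at this
    · have := Finset.card_toLeft_add_card_toRight (u := A)
      omega
    · have := hinv _ hx
      rwa [Equiv.Perm.sumCongr_apply, Sum.map_inr] at this
  · intro A _ A' _ h
    rw [← Finset.toLeft_disjSum_toRight (u := A), ← Finset.toLeft_disjSum_toRight (u := A')]
    exact congrArg₂ _ (Prod.ext_iff.1 h).1 (Prod.ext_iff.1 h).2

open scoped Classical in
/-- Removal of the cycle of length `d` through a marked point: it meets the invariant set in a
subset of `ZMod d` invariant under the translation by `q`, and the remaining set is invariant under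
the `q`-th power of a uniform permutation of the remaining points. -/
theorem sum_rootedCount_minimalPeriod_le {p : ℕ → ℝ} {q k : ℕ} {d : ℕ} (hd : d ≠ 0)
    (hdn : d ≤ Fintype.card α)
    (hp : ∀ k' < k, ∑ r : Perm (Fin (Fintype.card α - d)), (invCount (r ^ q) k' : ℝ) ≤
      (Fintype.card α - d).factorial * p k') :
    ∑ s : Perm α, ∑ a, (if Function.minimalPeriod s a = d then
        (rootedCount (s ^ q) k a : ℝ) else 0) ≤
      (Fintype.card α).factorial * ∑ j ∈ Finset.Icc 1 k, cycCount d q j * p (k - j) := by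
  have : NeZero d := ⟨hd⟩
  set β := Fin (Fintype.card α - d)
  have e : ZMod d ⊕ β ≃ α := Fintype.equivOfCardEq (by
    rw [Fintype.card_sum, ZMod.card, Fintype.card_fin]; omega)
  have h1 := sum_embedding_sum_perm_of_equiv e
    (fun s c => (rootedCount (s ^ q) k (c 0) : ℝ)) (fun g s c => by
      have h2 : (g * s * g⁻¹) ^ q = Equiv.permCongr g (s ^ q) := by
        rw [conj_pow]; rfl
      rw [h2]
      exact congrArg _ (rootedCount_permCongr g (s ^ q) k (c 0))) (rot d)
  rw [Finset.sum_comm] at h1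
  have h3 : ∀ s : Perm α, ∑ c : ZMod d ↪ α, (if Intertwines (rot d) s c then
      (rootedCount (s ^ q) k (c 0) : ℝ) else 0) =
      ∑ a, (if Function.minimalPeriod s a = d then (rootedCount (s ^ q) k a : ℝ) else 0) :=
    fun s => sum_intertwines_rot d s fun a => (rootedCount (s ^ q) k a : ℝ)
  rw [Finset.sum_congr rfl fun s _ => h3 s, nsmul_eq_mul, nsmul_eq_mul] at h1
  have hβ : (0 : ℝ) < (Fintype.card β).factorial := Nat.cast_pos.2 (Nat.factorial_pos _)
  refine le_of_mul_le_mul_left ?_ hβ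
  rw [h1, mul_left_comm]
  refine mul_le_mul_of_nonneg_left ?_ (Nat.cast_nonneg _)
  have h4 : ∀ r : Perm β, (rootedCount ((e.permCongr (Equiv.Perm.sumCongr (rot d) r)) ^ q) k
      ((Function.Embedding.inl.trans e.toEmbedding : ZMod d ↪ α) 0) : ℝ) ≤
      ∑ j ∈ Finset.Icc 1 k, (cycCount d q j : ℝ) * invCount (r ^ q) (k - j) := by
    intro r
    have h5 : (e.permCongr (Equiv.Perm.sumCongr (rot d) r)) ^ q =
        e.permCongr (Equiv.Perm.sumCongr (rot d) r ^ q) := by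
      simp only [← Equiv.permCongrHom_coe, map_pow]
    rw [h5]
    have h6 := rootedCount_permCongr e (Equiv.Perm.sumCongr (rot d) r ^ q) k (Sum.inl 0)
    have h7 := rootedCount_sumCongr_le (d := d) q k r
    rw [← h6] at h7
    exact_mod_cast h7
  refine (Finset.sum_le_sum fun r _ => h4 r).trans ?_
  rw [Finset.sum_comm, Finset.mul_sum]
  refine Finset.sum_le_sum fun j hj => ?_
  rw [← Finset.mul_sum, mul_left_comm]
  refine mul_le_mul_of_nonneg_left ?_ (Nat.cast_nonneg _)
  have hj' := Finset.mem_Icc.1 hj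
  have := hp (k - j) (by omega)
  rwa [Fintype.card_fin]

omit [DecidableEq α] in
theorem minimalPeriod_mem_Icc (s : Perm α) (a : α) :
    Function.minimalPeriod s a ∈ Finset.Icc 1 (Fintype.card α) := by
  rw [Finset.mem_Icc]
  exact ⟨Function.minimalPeriod_pos_of_mem_periodicPts (s.injective.mem_periodicPts a),
    Function.minimalPeriod_le_card⟩

/-- Marking a point of the invariant set and removing the cycle through it turns bounds for the
smaller sets into a bound for the sets of size `k`. -/
theorem mul_sum_invCount_le {p : ℕ → ℝ} {q k : ℕ}
    (hp : ∀ m, ∀ k' < k, ∑ r : Perm (Fin m), (invCount (r ^ q) k' : ℝ) ≤ m.factorial * p k') :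
    k * ∑ s : Perm α, (invCount (s ^ q) k : ℝ) ≤ (Fintype.card α).factorial *
      ∑ j ∈ Finset.Icc 1 k, (∑ d ∈ Finset.Icc 1 (Fintype.card α), (cycCount d q j : ℝ)) *
        p (k - j) := by
  classical
  have h1 : ∀ s : Perm α, (k : ℝ) * (invCount (s ^ q) k : ℝ) =
      ∑ d ∈ Finset.Icc 1 (Fintype.card α), ∑ a, (if Function.minimalPeriod s a = d then
        (rootedCount (s ^ q) k a : ℝ) else 0) := by
    intro s
    rw [Finset.sum_comm]
    have h2 := sum_rootedCount (s ^ q) k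
    rw [← Nat.cast_mul, ← h2]
    push_cast
    refine Finset.sum_congr rfl fun a _ => ?_
    rw [Finset.sum_ite_eq, if_pos (minimalPeriod_mem_Icc s a)]
  rw [Finset.mul_sum, Finset.sum_congr rfl fun s _ => h1 s, Finset.sum_comm]
  have h3 : ∀ d ∈ Finset.Icc 1 (Fintype.card α), ∑ s : Perm α, ∑ a,
      (if Function.minimalPeriod s a = d then (rootedCount (s ^ q) k a : ℝ) else 0) ≤
      (Fintype.card α).factorial * ∑ j ∈ Finset.Icc 1 k, cycCount d q j * p (k - j) := by
    intro d hd
    rw [Finset.mem_Icc] at hd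
    exact sum_rootedCount_minimalPeriod_le (by omega) hd.2 fun k' hk' => hp _ k' hk'
  refine (Finset.sum_le_sum h3).trans ?_
  rw [← Finset.mul_sum, Finset.sum_comm]
  simp_rw [Finset.sum_mul]
  exact le_rfl

/-- A subset of `ZMod d` that is invariant under the translation by `q` is the preimage of a
subset of the quotient by the subgroup generated by `q`, which has `gcd(d, q)` elements. -/
theorem cycCount_le {d q j : ℕ} (hd : d ≠ 0) :
    (cycCount d q j : ℝ) ≤ if d / d.gcd q ∣ j then
      (d.gcd q : ℝ) ^ (j / (d / d.gcd q) - 1) / (j / (d / d.gcd q) - 1).factorial else 0 := by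
  classical
  have : NeZero d := ⟨hd⟩
  set H := AddSubgroup.zmultiples (q : ZMod d)
  set e := d / d.gcd q with he
  have hHcard : Nat.card H = e := by
    rw [Nat.card_zmultiples, ZMod.addOrderOf_coe q hd]
  have hepos : 0 < e := by rw [← hHcard]; exact Nat.card_pos
  have hgcd : d.gcd q * e = d := Nat.mul_div_cancel' (Nat.gcd_dvd_left d q)
  have hQcard : Nat.card (ZMod d ⧸ H) = d.gcd q := by
    have h1 := AddSubgroup.card_eq_card_quotient_mul_card_addSubgroup H
    rw [hHcard, Nat.card_zmod] at h1
    exact Nat.eq_of_mul_eq_mul_right hepos (h1.symm.trans hgcd.symm)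
  have hpre : ∀ S : Finset (ZMod d), (∀ x ∈ S, x + q ∈ S) → ∀ x y : ZMod d,
      (x : ZMod d ⧸ H) = y → x ∈ S → y ∈ S := by
    intro S hS x y hxy hx
    rw [QuotientAddGroup.eq] at hxy
    have h2 : -x + y ∈ AddSubmonoid.multiples (q : ZMod d) :=
      (isOfFinAddOrder_of_finite _).mem_multiples_iff_mem_zmultiples.2 hxy
    obtain ⟨i, hi⟩ := h2
    have h3 : ∀ i : ℕ, x + i • (q : ZMod d) ∈ S := by
      intro i
      induction i with
      | zero => simpa using hx
      | succ i ih => rw [succ_nsmul, ← add_assoc]; exact hS _ ih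
    have h4 : y = x + i • (q : ZMod d) := by
      change i • (q : ZMod d) = -x + y at hi
      rw [hi]; abel
    rw [h4]
    exact h3 i
  have := Fintype.ofFinite (ZMod d ⧸ H)
  let T : Finset (ZMod d) → Finset (ZMod d ⧸ H) := fun S => S.image (QuotientAddGroup.mk (s := H))
  have hmem : ∀ S : Finset (ZMod d), (∀ x ∈ S, x + q ∈ S) → ∀ x : ZMod d,
      (x : ZMod d ⧸ H) ∈ T S ↔ x ∈ S := by
    intro S hS x
    constructor
    · intro h
      obtain ⟨y, hy, hyx⟩ := Finset.mem_image.1 h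
      exact hpre S hS y x hyx hy
    · exact fun h => Finset.mem_image_of_mem _ h
  have hcard : ∀ S : Finset (ZMod d), (∀ x ∈ S, x + q ∈ S) → S.card = e * (T S).card := by
    intro S hS
    have h1 := Nat.card_congr
      (QuotientAddGroup.preimageMkEquivAddSubgroupProdSet H (T S : Set (ZMod d ⧸ H)))
    have h2 : (QuotientAddGroup.mk ⁻¹' (T S : Set (ZMod d ⧸ H)) : Set (ZMod d)) = S := by
      ext x
      exact hmem S hS x
    rw [h2, Nat.card_prod, hHcard] at h1
    simpa using h1
  -- an invariant set that contains `0` is a set of `j / e` cosets that contains the coset of `0`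
  split_ifs with hdvd
  · have h1 : cycCount d q j ≤ (d.gcd q - 1).choose (j / e - 1) := by
      rw [cycCount, Nat.card_eq_fintype_card, Fintype.card_subtype]
      have hcc : ((Finset.univ.erase (0 : ZMod d ⧸ H)).powersetCard (j / e - 1)).card =
          (d.gcd q - 1).choose (j / e - 1) := by
        rw [Finset.card_powersetCard, Finset.card_erase_of_mem (Finset.mem_univ _),
          Finset.card_univ, ← Nat.card_eq_fintype_card, hQcard]
      rw [← hcc]
      refine Finset.card_le_card_of_injOn (fun S => (T S).erase 0) ?_ ?_
      · intro S hS
        simp only [Finset.coe_filter, Finset.mem_univ, true_and, Set.mem_ofPred_eq] at hS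
        have h0 : (0 : ZMod d ⧸ H) ∈ T S := (hmem S hS.2.2 0).2 hS.1
        rw [Finset.mem_coe, Finset.mem_powersetCard]
        refine ⟨Finset.erase_subset_erase _ (Finset.subset_univ _), ?_⟩
        rw [Finset.card_erase_of_mem h0, ← hS.2.1, hcard S hS.2.2, Nat.mul_div_cancel_left _ hepos]
      · intro S hS S' hS' h
        simp only [Finset.coe_filter, Finset.mem_univ, true_and, Set.mem_ofPred_eq] at hS hS'
        have h0 : (0 : ZMod d ⧸ H) ∈ T S := (hmem S hS.2.2 0).2 hS.1
        have h0' : (0 : ZMod d ⧸ H) ∈ T S' := (hmem S' hS'.2.2 0).2 hS'.1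
        have hT : T S = T S' := by
          rw [← Finset.insert_erase h0, ← Finset.insert_erase h0']
          exact congrArg _ h
        ext x
        rw [← hmem S hS.2.2, ← hmem S' hS'.2.2, hT]
    calc (cycCount d q j : ℝ) ≤ ((d.gcd q - 1).choose (j / e - 1) : ℕ) := Nat.cast_le.2 h1
      _ ≤ ((d.gcd q - 1 : ℕ) : ℝ) ^ (j / e - 1) / (j / e - 1).factorial :=
        Nat.choose_le_pow_div _ _
      _ ≤ _ := by
        gcongr
        exact Nat.sub_le _ _
  · have : IsEmpty {S : Finset (ZMod d) // 0 ∈ S ∧ S.card = j ∧ ∀ x ∈ S, x + q ∈ S} :=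
      ⟨fun S => hdvd ⟨_, S.2.2.1.symm.trans (hcard S.1 S.2.2.2)⟩⟩
    rw [cycCount, Nat.card_of_isEmpty, Nat.cast_zero]

/-- An upper bound for the weighted number of cycles that contribute `j` points to an invariant
set: `∑_{i ∣ j} σ_{i-1}(q) / (i-1)!`. -/
noncomputable def cycBound (q j : ℕ) : ℝ :=
  ∑ i ∈ j.divisors, ∑ g ∈ q.divisors, (g : ℝ) ^ (i - 1) / (i - 1).factorial

/-- The pairs `(j / (d / gcd(d, q)), gcd(d, q))` are distinct for distinct `d`, and consist of a
divisor of `j` and a divisor of `q`. -/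
theorem sum_cycCount_le {q j : ℕ} (hq : q ≠ 0) (hj : j ≠ 0) (n : ℕ) :
    ∑ d ∈ Finset.Icc 1 n, (cycCount d q j : ℝ) ≤ cycBound q j := by
  have h1 : ∀ d ∈ Finset.Icc 1 n, (cycCount d q j : ℝ) ≤ if d / d.gcd q ∣ j then
      (d.gcd q : ℝ) ^ (j / (d / d.gcd q) - 1) / (j / (d / d.gcd q) - 1).factorial else 0 :=
    fun d hd => cycCount_le (by have := (Finset.mem_Icc.1 hd).1; omega)
  refine (Finset.sum_le_sum h1).trans ?_
  rw [← Finset.sum_filter, cycBound, ← Finset.sum_product']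
  have hinj : Set.InjOn (fun d : ℕ => (j / (d / d.gcd q), d.gcd q))
      (Finset.filter (fun d => d / d.gcd q ∣ j) (Finset.Icc 1 n) : Set ℕ) := by
    have h2 : ∀ d : ℕ, d / d.gcd q ∣ j → d = j / (j / (d / d.gcd q)) * d.gcd q := by
      intro d hd
      rw [Nat.div_div_self hd hj, Nat.div_mul_cancel (Nat.gcd_dvd_left d q)]
    intro d hd d' hd' h
    simp only [Finset.coe_filter, Set.mem_ofPred_eq] at hd hd'
    obtain ⟨h3, h4⟩ := Prod.ext_iff.1 h
    simp only at h3 h4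
    rw [h2 d hd.2, h2 d' hd'.2, h3, h4]
  rw [← Finset.sum_image (f := fun p : ℕ × ℕ => (p.2 : ℝ) ^ (p.1 - 1) / (p.1 - 1).factorial) hinj]
  refine Finset.sum_le_sum_of_subset_of_nonneg ?_ fun _ _ _ => by positivity
  intro p hp
  obtain ⟨d, hd, rfl⟩ := Finset.mem_image.1 hp
  simp only [Finset.mem_filter] at hd
  simp only [Finset.mem_product, Nat.mem_divisors]
  exact ⟨⟨Nat.div_dvd_of_dvd hd.2, hj⟩, Nat.gcd_dvd_right d q, hq⟩

/-- The coefficients of `exp (∑_j (cycBound q j / j) t^j)`: upper bounds for the mean number of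
`k`-element sets that are invariant under `σ ^ q`. -/
noncomputable def invBound (q : ℕ) : ℕ → ℝ
  | 0 => 1
  | k + 1 => (∑ i : Fin (k + 1), cycBound q (k + 1 - i) * invBound q i) / (k + 1)

theorem invBound_succ (q k : ℕ) : ((k + 1 : ℕ) : ℝ) * invBound q (k + 1) =
    ∑ j ∈ Finset.Icc 1 (k + 1), cycBound q j * invBound q (k + 1 - j) := by
  rw [invBound, Nat.cast_succ, mul_div_cancel₀ _ (by positivity),
    Fin.sum_univ_eq_sum_range (fun i => cycBound q (k + 1 - i) * invBound q i)]
  refine Finset.sum_bij' (fun i _ => k + 1 - i) (fun j _ => k + 1 - j) ?_ ?_ ?_ ?_ ?_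
  · intro i hi; simp only [Finset.mem_range, Finset.mem_Icc] at *; omega
  · intro i hi; simp only [Finset.mem_range, Finset.mem_Icc] at *; omega
  · intro i hi; simp only [Finset.mem_range] at *; omega
  · intro i hi; simp only [Finset.mem_Icc] at *; omega
  · intro i hi
    simp only [Finset.mem_range] at hi
    rw [show k + 1 - (k + 1 - i) = i by omega]

theorem cycBound_nonneg (q j : ℕ) : 0 ≤ cycBound q j :=
  Finset.sum_nonneg fun _ _ => Finset.sum_nonneg fun _ _ => by positivity

theorem invBound_nonneg (q k : ℕ) : 0 ≤ invBound q k := by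
  induction k using Nat.strong_induction_on with
  | _ k ih =>
    cases k with
    | zero => simp [invBound]
    | succ k =>
      rw [invBound]
      exact div_nonneg (Finset.sum_nonneg fun i _ =>
        mul_nonneg (cycBound_nonneg _ _) (ih i i.2)) (by positivity)

/-- Upper bound for the mean number of sets that are invariant under a `q`-th power. -/
theorem sum_invCount_le {q : ℕ} (hq : q ≠ 0) (k : ℕ) : ∀ n : ℕ,
    ∑ s : Perm (Fin n), (invCount (s ^ q) k : ℝ) ≤ n.factorial * invBound q k := by
  induction k using Nat.strong_induction_on with
  | _ k ih =>
    intro n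
    cases k with
    | zero =>
      have h : ∀ s : Perm (Fin n), invCount s 0 = 1 := by
        intro s
        rw [invCount, Nat.card_eq_one_iff_unique]
        exact ⟨⟨fun A B => Subtype.ext ((Finset.card_eq_zero.1 A.2.1).trans
          (Finset.card_eq_zero.1 B.2.1).symm)⟩, ⟨⟨∅, by simp⟩⟩⟩
      simp [h, invBound, Fintype.card_perm]
    | succ k =>
      have h1 := mul_sum_invCount_le (α := Fin n) (q := q) (k := k + 1)
        (p := invBound q) fun m k' hk' => ih k' hk' m
      rw [Fintype.card_fin] at h1
      refine le_of_mul_le_mul_left ?_ (show (0 : ℝ) < ((k + 1 : ℕ) : ℝ) by positivity)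
      refine h1.trans ?_
      rw [mul_left_comm, invBound_succ]
      refine mul_le_mul_of_nonneg_left (Finset.sum_le_sum fun j hj => ?_) (Nat.cast_nonneg _)
      have := (Finset.mem_Icc.1 hj).1
      exact mul_le_mul_of_nonneg_right (sum_cycCount_le hq (by omega) n) (invBound_nonneg _ _)

/-- Lower bound for the mean number of embeddings of a `k`-element set into the fixed points of a
`q`-th power, by those with image in a single cycle: its length is a divisor `d` of `q`. -/
theorem le_sum_embCount_one {q n k : ℕ} (hq : q ≠ 0) (hn : q ≤ n) :
    n.factorial * ∑ d ∈ q.divisors, (d - 1).descFactorial k ≤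
      ∑ s : Perm (Fin n), embCount (1 : Perm (Fin (k + 1))) (s ^ q) := by
  classical
  have h1 : ∀ s : Perm (Fin n), ∑ d ∈ q.divisors, ∑ a,
      (if Function.minimalPeriod s a = d then (d - 1).descFactorial k else 0) ≤
      embCount (1 : Perm (Fin (k + 1))) (s ^ q) := by
    intro s
    rw [embCount_one, Fintype.card_fin, Finset.sum_comm]
    -- the first point `a` of the image lies on a cycle of a length `d` that divides `q`
    set f := Fintype.card {x // (s ^ q) x = x} with hf
    have hiter : ∀ x, (s ^ q) x = (s^[q]) x := fun x => by
      rw [← Equiv.Perm.iterate_eq_pow]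
    have h2 : ∀ a, (∑ d ∈ q.divisors,
        if Function.minimalPeriod s a = d then (d - 1).descFactorial k else 0) ≤
        if (s ^ q) a = a then (f - 1).descFactorial k else 0 := by
      intro a
      rw [Finset.sum_ite_eq]
      have hiff : Function.minimalPeriod s a ∈ q.divisors ↔ (s ^ q) a = a := by
        rw [Nat.mem_divisors, ← Function.isPeriodicPt_iff_minimalPeriod_dvd,
          Function.IsPeriodicPt, Function.IsFixedPt, hiter]
        simp [hq]
      by_cases ha : (s ^ q) a = a
      · rw [if_pos (hiff.2 ha), if_pos ha]
        refine Nat.descFactorial_le _ (Nat.sub_le_sub_right ?_ 1)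
        have hcard : Fintype.card (Fin (Function.minimalPeriod s a)) ≤ f := by
          refine Fintype.card_le_of_injective
            (fun i => (⟨(s^[i]) a, ?_⟩ : {x // (s ^ q) x = x})) ?_
          · rw [hiter, ← Function.iterate_add_apply, add_comm, Function.iterate_add_apply,
              ← hiter a, ha]
          · intro i j hij
            exact Fin.ext ((Function.iterate_eq_iterate_iff_of_lt_minimalPeriod i.2 j.2).1
              (congrArg Subtype.val hij))
        rwa [Fintype.card_fin] at hcard
      · rw [if_neg (mt hiff.1 ha), if_neg ha]
    refine (Finset.sum_le_sum fun a _ => h2 a).trans ?_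
    rw [← Finset.sum_filter, Finset.sum_const, ← Fintype.card_subtype, ← hf, smul_eq_mul]
    cases f with
    | zero => simp
    | succ f => rw [Nat.succ_descFactorial_succ, Nat.add_sub_cancel]
  refine le_trans (le_of_eq ?_) (Finset.sum_le_sum fun s _ => h1 s)
  rw [Finset.sum_comm, Finset.mul_sum]
  refine Finset.sum_congr rfl fun d hd => ?_
  have hdq := Nat.divisor_le hd
  have hd0 : d ≠ 0 := (Nat.pos_of_mem_divisors hd).ne'
  have h3 := sum_card_minimalPeriod (α := Fin n) hd0 (by rw [Fintype.card_fin]; omega)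
  rw [Fintype.card_fin] at h3
  rw [← h3, Finset.sum_mul]
  refine Finset.sum_congr rfl fun s _ => ?_
  rw [Finset.sum_mul]
  exact Finset.sum_congr rfl fun a _ => by split_ifs <;> simp

end CycleRemoval
end RootNumber

/-! ### Divisor sums -/

namespace RootNumber
open ArithmeticFunction

section DivisorSums

/-- The number of divisors is smaller than any power: `σ_0(q) ^ k = O_k(q)`. -/
theorem exists_sigma_zero_pow_le (k : ℕ) :
    ∃ C : ℝ, 0 < C ∧ ∀ q : ℕ, q ≠ 0 → (sigma 0 q : ℝ) ^ k ≤ C * q := by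
  set K : ℕ := k.factorial * 2 ^ k with hK
  have hK1 : 1 ≤ K := Nat.succ_le_of_lt (by positivity)
  refine ⟨((K ^ (2 ^ k) : ℕ) : ℝ), by positivity, fun q hq => ?_⟩
  -- the local bound needs a constant only at the finitely many primes below `2 ^ k`
  have hloc : ∀ p ∈ q.primeFactors, (q.factorization p + 1) ^ k ≤
      (if p < 2 ^ k then K else 1) * p ^ q.factorization p := by
    intro p hp
    have hp2 := (Nat.prime_of_mem_primeFactors hp).two_le
    set a := q.factorization p
    split_ifs with h
    · calc (a + 1) ^ k ≤ (a + 1).ascFactorial k := Nat.pow_succ_le_ascFactorial (a + 1) k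
        _ = k.factorial * (a + k).choose k := Nat.ascFactorial_eq_factorial_mul_choose a k
        _ ≤ k.factorial * 2 ^ (a + k) := by gcongr; exact Nat.choose_le_two_pow _ _
        _ = K * 2 ^ a := by rw [hK, pow_add]; ring
        _ ≤ K * p ^ a := by gcongr
    · rw [one_mul]
      calc (a + 1) ^ k ≤ (2 ^ a) ^ k := by gcongr; exact Nat.lt_two_pow_self
        _ = (2 ^ k) ^ a := by rw [← pow_mul, ← pow_mul, mul_comm]
        _ ≤ p ^ a := by gcongr; omega
  have hnat : sigma 0 q ^ k ≤ K ^ (2 ^ k) * q := by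
    rw [sigma_zero_apply, Nat.card_divisors hq, ← Finset.prod_pow]
    refine (Finset.prod_le_prod' hloc).trans ?_
    rw [Finset.prod_mul_distrib]
    have h2 : ∏ p ∈ q.primeFactors, p ^ q.factorization p = q := by
      conv_rhs => rw [← Nat.prod_factorization_pow_eq_self hq]
      rfl
    rw [h2]
    refine Nat.mul_le_mul_right q ?_
    rw [← Finset.prod_filter, Finset.prod_const]
    refine Nat.pow_le_pow_right hK1 ?_
    refine (Finset.card_le_card (t := Finset.range (2 ^ k)) fun p hp => ?_).trans_eq
      (Finset.card_range _)
    exact Finset.mem_range.2 (Finset.mem_filter.1 hp).2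
  exact_mod_cast hnat

theorem one_le_sigma_zero {q : ℕ} (hq : q ≠ 0) : (1 : ℝ) ≤ sigma 0 q := by
  rw [sigma_zero_apply]
  exact_mod_cast Finset.card_pos.2 ⟨q, Nat.mem_divisors_self q hq⟩

theorem sigma_eq_sum (k q : ℕ) : (sigma k q : ℝ) = ∑ d ∈ q.divisors, (d : ℝ) ^ k := by
  rw [sigma_apply]; push_cast; rfl

theorem sigma_le (k q : ℕ) : (sigma k q : ℝ) ≤ sigma 0 q * (q : ℝ) ^ k := by
  rw [sigma_eq_sum, sigma_zero_apply, ← nsmul_eq_mul]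
  refine Finset.sum_le_card_nsmul _ _ _ fun d hd => ?_
  have := Nat.divisor_le hd
  gcongr

theorem le_sigma_one {q : ℕ} (hq : q ≠ 0) : (q : ℝ) ≤ sigma 1 q := by
  rw [sigma_eq_sum]
  have := Finset.single_le_sum (f := fun d : ℕ => (d : ℝ) ^ 1) (fun _ _ => by positivity)
    (Nat.mem_divisors_self q hq)
  simpa using this

/-- `σ_k(q) / q ^ k` is the sum of the inverse `k`-th powers of the divisors. -/
theorem sigma_div_pow {q : ℕ} (hq : q ≠ 0) (k : ℕ) :
    (sigma k q : ℝ) / (q : ℝ) ^ k = ∑ d ∈ q.divisors, ((d : ℝ) ^ k)⁻¹ := by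
  rw [sigma_eq_sum, ← Nat.sum_div_divisors, Finset.sum_div]
  refine Finset.sum_congr rfl fun d hd => ?_
  have hd0 : (d : ℝ) ≠ 0 := Nat.cast_ne_zero.2 (Nat.pos_of_mem_divisors hd).ne'
  have hq0 : (q : ℝ) ≠ 0 := Nat.cast_ne_zero.2 hq
  rw [Nat.cast_div (Nat.dvd_of_mem_divisors hd) hd0, div_pow]
  field_simp

theorem sigma_div_pow_le_two {q k : ℕ} (hq : q ≠ 0) (hk : 2 ≤ k) :
    (sigma k q : ℝ) / (q : ℝ) ^ k ≤ 2 := by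
  rw [sigma_div_pow hq]
  calc ∑ d ∈ q.divisors, ((d : ℝ) ^ k)⁻¹ ≤ ∑ d ∈ q.divisors, ((d : ℝ) ^ 2)⁻¹ := by
        refine Finset.sum_le_sum fun d hd => ?_
        have hd0 : 0 < d := Nat.pos_of_mem_divisors hd
        have : (1 : ℝ) ≤ d := by exact_mod_cast hd0
        gcongr
    _ ≤ ∑ d ∈ Finset.Ioo 0 (q + 1), ((d : ℝ) ^ 2)⁻¹ := by
        refine Finset.sum_le_sum_of_subset_of_nonneg (fun d hd => ?_) fun _ _ _ => by positivity
        have h1 := Nat.divisor_le hd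
        have h2 := Nat.pos_of_mem_divisors hd
        rw [Finset.mem_Ioo]; omega
    _ ≤ 2 / ((0 : ℕ) + 1) := sum_Ioo_inv_sq_le 0 (q + 1)
    _ = 2 := by norm_num

theorem sq_sigma_one_div_le {q : ℕ} (hq : q ≠ 0) :
    ((sigma 1 q : ℝ) / (q : ℝ) ^ 1) ^ 2 ≤ 2 * sigma 0 q := by
  have h2 := sigma_div_pow_le_two hq le_rfl
  rw [sigma_div_pow hq] at *
  have h1 := sq_sum_le_card_mul_sum_sq (s := q.divisors) (f := fun d : ℕ => ((d : ℝ) ^ 1)⁻¹)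
  simp only [inv_pow, ← pow_mul, one_mul] at h1
  rw [← sigma_zero_apply] at h1
  refine h1.trans ?_
  rw [mul_comm]
  exact mul_le_mul_of_nonneg_right h2 (Nat.cast_nonneg _)

theorem sigma_div_pow_le {q : ℕ} (hq : q ≠ 0) (k : ℕ) :
    (sigma k q : ℝ) / (q : ℝ) ^ k ≤ sigma 0 q := by
  rw [div_le_iff₀ (by positivity)]
  exact sigma_le k q

/-- A lower bound for the descending factorial. It is trivial for `d ≤ m`, where `d ≤ m ^ 2`. -/
theorem pow_succ_le_descFactorial_add (d m : ℕ) :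
    (d : ℝ) ^ (m + 1) ≤ d * (d - 1).descFactorial m + m ^ 2 * d ^ m := by
  induction m with
  | zero => simp
  | succ m ih =>
    have hd : (0 : ℝ) ≤ d := Nat.cast_nonneg d
    by_cases h : d ≤ m + 1
    · have h1 : (d : ℝ) ≤ (m + 1) ^ 2 := by
        have : (d : ℝ) ≤ m + 1 := by exact_mod_cast h
        nlinarith
      have h2 : (d : ℝ) ^ (m + 1 + 1) ≤ ((m + 1 : ℕ) : ℝ) ^ 2 * d ^ (m + 1) := by
        rw [pow_succ', Nat.cast_succ]
        gcongr
      have h3 : (0 : ℝ) ≤ d * ((d - 1).descFactorial (m + 1) : ℕ) := by positivity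
      linarith
    · push Not at h
      rw [Nat.descFactorial_succ, Nat.cast_mul, Nat.sub_sub, Nat.cast_sub (by omega)]
      push_cast
      have h1 : (0 : ℝ) ≤ d - (1 + m) := by
        have : ((m + 1 : ℕ) : ℝ) ≤ d := by exact_mod_cast h.le
        push_cast at this
        linarith
      have h2 := mul_le_mul_of_nonneg_left ih h1
      have h3 : (0 : ℝ) ≤ m * d ^ (m + 1) := by positivity
      have h4 : (0 : ℝ) ≤ m ^ 2 * d ^ m * (1 + m) := by positivity
      rw [pow_succ' (d : ℝ) (m + 1)]
      rw [pow_succ' (d : ℝ) m] at *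
      nlinarith

theorem sigma_sub_sum_descFactorial_le (q m : ℕ) :
    (sigma (m + 1) q : ℝ) - ((∑ d ∈ q.divisors, (d - 1).descFactorial (m + 1) : ℕ) : ℝ) ≤
      (m + 1) ^ 2 * sigma m q := by
  rw [sigma_eq_sum, sigma_eq_sum, Finset.mul_sum, Nat.cast_sum, ← Finset.sum_sub_distrib]
  refine Finset.sum_le_sum fun d hd => ?_
  have hd0 : (0 : ℝ) < d := Nat.cast_pos.2 (Nat.pos_of_mem_divisors hd)
  have h := pow_succ_le_descFactorial_add d (m + 1)
  rw [pow_succ', pow_succ' (d : ℝ) m] at h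
  refine le_of_mul_le_mul_left ?_ hd0
  push_cast at h ⊢
  rw [pow_succ' (d : ℝ) m]
  linarith

end DivisorSums

/-! ### A convolution recursion -/

section Recursion
variable {b p : ℕ → ℝ} {q M : ℝ} {N : ℕ}

theorem sum_choose_le (m : ℕ) : ∑ i ∈ Finset.range m, (m.choose i : ℝ) ≤ 2 ^ m := by
  have h := Nat.sum_range_choose m
  rw [Finset.sum_range_succ] at h
  have h' : ∑ i ∈ Finset.range m, m.choose i ≤ 2 ^ m := by omega
  exact_mod_cast h'

theorem sum_choose_mul_two_pow_le (m : ℕ) :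
    ∑ i ∈ Finset.range m, (m.choose i : ℝ) * 2 ^ (m - i) ≤ 3 ^ m := by
  have h := add_pow (1 : ℝ) 2 m
  rw [Finset.sum_range_succ] at h
  norm_num at h
  rw [h]
  have : ∑ i ∈ Finset.range m, (m.choose i : ℝ) * 2 ^ (m - i) =
      ∑ i ∈ Finset.range m, (2 : ℝ) ^ (m - i) * m.choose i :=
    Finset.sum_congr rfl fun _ _ => mul_comm _ _
  linarith

/-- First estimate for a solution of the convolution recursion: the solution is close to the
coefficients `b`. -/
theorem recursion_le (hq : 0 < q) (hM : 1 ≤ M)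
    (hb0 : ∀ j, 0 ≤ b j) (hbM : ∀ j, 1 ≤ j → j ≤ N → b j ≤ M)
    (hgrow : ∀ m < N, M ^ 3 * 3 ^ m ≤ 2 ^ m * q)
    (hp : ∀ m < N, p (m + 1) = b (m + 1) +
      (∑ i ∈ Finset.range m, (m.choose i : ℝ) * (b (i + 1) * p (m - i))) / q) :
    ∀ k, 1 ≤ k → k ≤ N → p k ≤ b k + M ^ 2 * 2 ^ k / q := by
  intro k
  induction k using Nat.strong_induction_on with
  | _ k ih =>
    intro hk hkN
    obtain ⟨m, rfl⟩ : ∃ m, k = m + 1 := ⟨k - 1, by omega⟩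
    rw [hp m (by omega)]
    gcongr
    have hM0 : 0 ≤ M := by linarith
    calc ∑ i ∈ Finset.range m, (m.choose i : ℝ) * (b (i + 1) * p (m - i)) ≤
        ∑ i ∈ Finset.range m, (m.choose i : ℝ) * (M * (M + M ^ 2 * 2 ^ (m - i) / q)) := by
          refine Finset.sum_le_sum fun i hi => ?_
          rw [Finset.mem_range] at hi
          refine mul_le_mul_of_nonneg_left ?_ (Nat.cast_nonneg _)
          have h1 := ih (m - i) (by omega) (by omega) (by omega)
          have h2 := hbM (m - i) (by omega) (by omega)
          have h3 := hbM (i + 1) (by omega) (by omega)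
          calc b (i + 1) * p (m - i) ≤ b (i + 1) * (M + M ^ 2 * 2 ^ (m - i) / q) :=
                mul_le_mul_of_nonneg_left (by linarith) (hb0 _)
            _ ≤ _ := mul_le_mul_of_nonneg_right h3 (by positivity)
      _ = M ^ 2 * ∑ i ∈ Finset.range m, (m.choose i : ℝ) +
          M ^ 3 / q * ∑ i ∈ Finset.range m, (m.choose i : ℝ) * 2 ^ (m - i) := by
          rw [Finset.mul_sum, Finset.mul_sum, ← Finset.sum_add_distrib]
          refine Finset.sum_congr rfl fun i _ => ?_
          ring
      _ ≤ M ^ 2 * 2 ^ m + M ^ 3 / q * 3 ^ m := by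
          gcongr
          · exact sum_choose_le m
          · exact sum_choose_mul_two_pow_le m
      _ ≤ M ^ 2 * 2 ^ m + M ^ 2 * 2 ^ m := by
          refine add_le_add le_rfl ?_
          rw [div_mul_eq_mul_div, div_le_iff₀ hq]
          have h5 := hgrow m (by omega)
          have h6 : (1 : ℝ) ≤ M ^ 2 := one_le_pow₀ hM
          have h7 : 0 ≤ 2 ^ m * q := by positivity
          nlinarith
      _ = M ^ 2 * 2 ^ (m + 1) := by ring

theorem cube_le_two_pow (m : ℕ) : m ^ 3 ≤ 8 * 2 ^ m := by
  by_cases h : m < 4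
  · interval_cases m <;> norm_num
  · push Not at h
    induction m, h using Nat.le_induction with
    | base => norm_num
    | succ m hm ih =>
      rw [pow_succ 2 m]
      nlinarith [mul_le_mul hm hm (by norm_num) (by omega)]

theorem sq_le_two_pow (m : ℕ) : m ^ 2 ≤ 2 * 2 ^ m := by
  by_cases h : m < 3
  · interval_cases m <;> norm_num
  · push Not at h
    induction m, h using Nat.le_induction with
    | base => norm_num
    | succ m hm ih =>
      rw [pow_succ 2 m]
      nlinarith

/-- The convolution of `b` with itself, when only `b 1` and `b 2` may be large. -/
theorem sum_choose_mul_mul_le {m : ℕ} (hm : 3 ≤ m) {t w : ℝ} (ht : 1 ≤ t) (hw0 : 0 ≤ w)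
    (hwt : w ≤ t) (hw : w ^ 2 ≤ 2 * t)
    (hb0 : ∀ j, 0 ≤ b j) (hb1 : b 1 ≤ t) (hb2 : b 2 ≤ w + 1)
    (hb3 : ∀ j, 3 ≤ j → j ≤ m → b j ≤ 3) :
    ∑ i ∈ Finset.range m, (m.choose i : ℝ) * (b (i + 1) * b (m - i)) ≤
      30 * (m * t) + 21 * 2 ^ m := by
  have hm1 : (3 : ℝ) ≤ m := by exact_mod_cast hm
  have hpt : ∀ i ∈ Finset.range m, (m.choose i : ℝ) * (b (i + 1) * b (m - i)) ≤
      9 * (m.choose i : ℝ) + (if i = 0 then 9 * t else 0) + (if i = m - 1 then 9 * t * m else 0) +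
        (if i = 1 then 9 * t * m else 0) + (if i = m - 2 then 3 * w * m ^ 2 else 0) := by
    intro i hi
    rw [Finset.mem_range] at hi
    have hch : (0 : ℝ) ≤ m.choose i := Nat.cast_nonneg _
    have e1 : 0 ≤ (if i = 0 then 9 * t else 0) := by split_ifs <;> positivity
    have e2 : 0 ≤ (if i = m - 1 then 9 * t * m else 0) := by split_ifs <;> positivity
    have e3 : 0 ≤ (if i = 1 then 9 * t * m else 0) := by split_ifs <;> positivity
    have e4 : 0 ≤ (if i = m - 2 then 3 * w * (m : ℝ) ^ 2 else 0) := by split_ifs <;> positivity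
    by_cases h0 : i = 0
    · subst h0
      have h3 : b m ≤ 3 := hb3 m hm le_rfl
      have : b (0 + 1) * b (m - 0) ≤ t * 3 := mul_le_mul hb1 h3 (hb0 _) (by linarith)
      rw [Nat.choose_zero_right, Nat.cast_one, one_mul] at *
      rw [if_pos rfl] at *
      linarith
    by_cases h1 : i = m - 1
    · subst h1
      have h3 : b (m - 1 + 1) ≤ 3 := hb3 _ (by omega) (by omega)
      have h4 : m - (m - 1) = 1 := by omega
      have h5 : m.choose (m - 1) = m := by
        rw [Nat.choose_symm_of_eq_add (b := 1) (by omega), Nat.choose_one_right]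
      rw [h4, h5] at *
      rw [if_pos rfl] at *
      have h6 : b (m - 1 + 1) * b 1 ≤ 3 * t := mul_le_mul h3 hb1 (hb0 _) (by norm_num)
      have h7 : (m : ℝ) * (b (m - 1 + 1) * b 1) ≤ m * (3 * t) :=
        mul_le_mul_of_nonneg_left h6 (by linarith)
      nlinarith
    by_cases h2 : i = 1
    · subst h2
      rw [Nat.choose_one_right] at *
      rw [if_pos (rfl : (1 : ℕ) = 1)] at *
      have h6 : b (1 + 1) * b (m - 1) ≤ 9 * t := by
        by_cases h7 : m = 3
        · subst h7
          have : b 2 * b 2 ≤ (w + 1) * (w + 1) := mul_le_mul hb2 hb2 (hb0 _) (by linarith)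
          norm_num
          nlinarith
        · have h8 : b (m - 1) ≤ 3 := hb3 _ (by omega) (by omega)
          have : b 2 * b (m - 1) ≤ (w + 1) * 3 := mul_le_mul hb2 h8 (hb0 _) (by linarith)
          norm_num
          nlinarith
      have h7 : (m : ℝ) * (b (1 + 1) * b (m - 1)) ≤ m * (9 * t) :=
        mul_le_mul_of_nonneg_left h6 (by linarith)
      nlinarith
    by_cases h3 : i = m - 2
    · have h4 : m - i = 2 := by omega
      have h5 : b (i + 1) ≤ 3 := hb3 _ (by omega) (by omega)
      have h6 : b (i + 1) * b (m - i) ≤ 3 * (w + 1) := by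
        rw [h4]
        exact mul_le_mul h5 hb2 (hb0 _) (by norm_num)
      have h7 : (m.choose i : ℝ) ≤ m ^ 2 := by
        rw [Nat.choose_symm_of_eq_add (b := 2) (by omega)]
        exact_mod_cast Nat.choose_le_pow m 2
      rw [if_pos h3] at *
      have h8 := mul_le_mul_of_nonneg_left h6 hch
      have h9 := mul_le_mul_of_nonneg_right h7 hw0
      nlinarith
    · have h5 : b (i + 1) ≤ 3 := hb3 _ (by omega) (by omega)
      have h6 : b (m - i) ≤ 3 := hb3 _ (by omega) (by omega)
      have h7 : b (i + 1) * b (m - i) ≤ 3 * 3 := mul_le_mul h5 h6 (hb0 _) (by norm_num)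
      have h8 := mul_le_mul_of_nonneg_left h7 hch
      linarith
  refine (Finset.sum_le_sum hpt).trans ?_
  simp only [Finset.sum_add_distrib, Finset.sum_ite_eq', Finset.mem_range, ← Finset.mul_sum]
  rw [if_pos (by omega), if_pos (by omega), if_pos (by omega), if_pos (by omega)]
  have h1 := sum_choose_le m
  have h2 : (m : ℝ) ^ 3 ≤ 8 * 2 ^ m := by exact_mod_cast cube_le_two_pow m
  have h3 : 2 * (w * (m : ℝ) ^ 2) ≤ m * w ^ 2 + m ^ 3 := by
    nlinarith [mul_nonneg (show (0 : ℝ) ≤ m by positivity) (sq_nonneg (w - m))]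
  have h4 : (m : ℝ) * w ^ 2 ≤ m * (2 * t) := mul_le_mul_of_nonneg_left hw (by positivity)
  have h5 : t * 3 ≤ t * m := mul_le_mul_of_nonneg_left hm1 (by linarith)
  nlinarith

/-- Second estimate for a solution of the convolution recursion: one substitution of the first
estimate into the recursion. -/
theorem recursion_le_refined {m : ℕ} (hm : 3 ≤ m) {t w : ℝ} (ht : 1 ≤ t) (hw0 : 0 ≤ w)
    (hwt : w ≤ t) (hw : w ^ 2 ≤ 2 * t) (hq : 0 < q)
    (hb0 : ∀ j, 0 ≤ b j) (hb1 : b 1 ≤ t) (hb2 : b 2 ≤ w + 1)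
    (hb3 : ∀ j, 3 ≤ j → j ≤ m + 1 → b j ≤ 3)
    (hgrow : ∀ i < m + 1, (3 * t) ^ 3 * 3 ^ i ≤ 2 ^ i * q)
    (hp : ∀ k < m + 1, p (k + 1) = b (k + 1) +
      (∑ i ∈ Finset.range k, (k.choose i : ℝ) * (b (i + 1) * p (k - i))) / q) :
    p (m + 1) ≤ b (m + 1) + (30 * (m * t) + 22 * 2 ^ m) / q := by
  have hbM : ∀ j, 1 ≤ j → j ≤ m + 1 → b j ≤ 3 * t := by
    intro j h1 h2
    by_cases h3 : 3 ≤ j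
    · linarith [hb3 j h3 h2]
    · interval_cases j <;> linarith
  have hcrude := recursion_le hq (by linarith) hb0 hbM hgrow hp
  rw [hp m (by omega)]
  gcongr
  have hconv := sum_choose_mul_mul_le (b := b) hm ht hw0 hwt hw hb0 hb1 hb2
    fun j h1 h2 => hb3 j h1 (by omega)
  have ht0 : 0 ≤ t := by linarith
  calc ∑ i ∈ Finset.range m, (m.choose i : ℝ) * (b (i + 1) * p (m - i)) ≤
      ∑ i ∈ Finset.range m, ((m.choose i : ℝ) * (b (i + 1) * b (m - i)) +
        (3 * t) ^ 3 / q * ((m.choose i : ℝ) * 2 ^ (m - i))) := by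
        refine Finset.sum_le_sum fun i hi => ?_
        rw [Finset.mem_range] at hi
        have h1 := hcrude (m - i) (by omega) (by omega)
        have h2 := hbM (i + 1) (by omega) (by omega)
        have h3 : b (i + 1) * p (m - i) ≤
            b (i + 1) * b (m - i) + 3 * t * ((3 * t) ^ 2 * 2 ^ (m - i) / q) := by
          calc _ ≤ b (i + 1) * (b (m - i) + (3 * t) ^ 2 * 2 ^ (m - i) / q) :=
                mul_le_mul_of_nonneg_left h1 (hb0 _)
            _ = b (i + 1) * b (m - i) + b (i + 1) * ((3 * t) ^ 2 * 2 ^ (m - i) / q) :=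
                mul_add _ _ _
            _ ≤ _ := by gcongr
        refine (mul_le_mul_of_nonneg_left h3 (Nat.cast_nonneg _)).trans_eq ?_
        ring
    _ ≤ (30 * (m * t) + 21 * 2 ^ m) + (3 * t) ^ 3 / q * 3 ^ m := by
        rw [Finset.sum_add_distrib, ← Finset.mul_sum]
        gcongr
        exact sum_choose_mul_two_pow_le m
    _ ≤ _ := by
        have h5 : (3 * t) ^ 3 / q * 3 ^ m ≤ 2 ^ m := by
          rw [div_mul_eq_mul_div, div_le_iff₀ hq]
          exact hgrow m (by omega)
        linarith

end Recursion
end RootNumber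

/-! ### Normalized coefficients -/

namespace RootNumber
open ArithmeticFunction

section Asymptotics
variable {q : ℕ}

theorem cycBound_eq (q j : ℕ) :
    cycBound q j = ∑ i ∈ j.divisors, (sigma (i - 1) q : ℝ) / (i - 1).factorial := by
  rw [cycBound]
  refine Finset.sum_congr rfl fun i _ => ?_
  rw [sigma_eq_sum, Finset.sum_div]

theorem sum_half_pow_le (m : ℕ) : ∑ i ∈ Finset.range m, (1 / 2 : ℝ) ^ (m - 1 - i) ≤ 2 := by
  rw [Finset.sum_range_reflect (fun i => (1 / 2 : ℝ) ^ i)]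
  exact sum_geometric_two_le m

theorem factorial_le_mul_pow {i j : ℕ} (h : i ≤ j) :
    j.factorial ≤ i.factorial * j ^ (j - i) := by
  have h1 := Nat.factorial_mul_descFactorial (n := j) (k := j - i) (Nat.sub_le _ _)
  rw [Nat.sub_sub_self h] at h1
  rw [← h1]
  exact Nat.mul_le_mul_left _ (Nat.descFactorial_le_pow _ _)

/-- A ratio of at most one half makes powers decay geometrically. -/
theorem pow_div_pow_le {x y : ℝ} (hx : 0 ≤ x) (hy : 0 < y) (hxy : 2 * x ≤ y) (k : ℕ) :
    (x / y) ^ (k + 1) ≤ x / y * (1 / 2) ^ k := by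
  rw [pow_succ']
  have : x / y ≤ 1 / 2 := by rw [div_le_iff₀ hy]; linarith
  gcongr

/-- The normalized coefficient `(j-1)! q ^ (1-j) cycBound q j` is essentially the contribution
`∑_{d ∣ q} d ^ (1-j)` of the divisor `j` of `j`. -/
theorem normalized_cycBound_le (hq : q ≠ 0) {m : ℕ} (hm : 2 * (m + 1) ≤ q) :
    (m.factorial : ℝ) * cycBound q (m + 1) / (q : ℝ) ^ m ≤
      (sigma m q : ℝ) / (q : ℝ) ^ m + 2 * sigma 0 q * ((m + 1 : ℕ) : ℝ) / q := by
  have hq0 : (0 : ℝ) < q := Nat.cast_pos.2 (Nat.pos_of_ne_zero hq)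
  have hm0 : (m.factorial : ℝ) ≠ 0 := Nat.cast_ne_zero.2 (Nat.factorial_ne_zero _)
  have hm' : 2 * ((m + 1 : ℕ) : ℝ) ≤ q := by exact_mod_cast hm
  rw [cycBound_eq, ← Nat.cons_self_properDivisors (show m + 1 ≠ 0 by omega), Finset.sum_cons,
    Nat.add_sub_cancel, mul_add, mul_div_cancel₀ _ hm0, add_div]
  refine add_le_add le_rfl ?_
  rw [Finset.mul_sum, Finset.sum_div]
  have h1 : ∀ i ∈ (m + 1).properDivisors, (m.factorial : ℝ) * ((sigma (i - 1) q : ℝ) /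
      (i - 1).factorial) / (q : ℝ) ^ m ≤
      sigma 0 q * (((m + 1 : ℕ) : ℝ) / q) * (1 / 2) ^ (m - i) := by
    intro i hi
    have hi1 : 1 ≤ i := Nat.pos_of_mem_properDivisors hi
    have hi2 : i < m + 1 := (Nat.mem_properDivisors.1 hi).2
    obtain ⟨i, rfl⟩ : ∃ k, i = k + 1 := ⟨i - 1, by omega⟩
    obtain ⟨r, rfl⟩ : ∃ r, m = i + 1 + r := ⟨m - (i + 1), by omega⟩
    rw [Nat.add_sub_cancel, Nat.add_sub_cancel_left]
    have h2 : (((i + 1 + r).factorial : ℕ) : ℝ) ≤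
        i.factorial * ((i + 1 + r + 1 : ℕ) : ℝ) ^ (r + 1) := by
      have h3 := factorial_le_mul_pow (show i ≤ i + 1 + r by omega)
      rw [show i + 1 + r - i = r + 1 by omega] at h3
      have h4 : (i + 1 + r) ^ (r + 1) ≤ (i + 1 + r + 1) ^ (r + 1) :=
        Nat.pow_le_pow_left (by omega) _
      exact_mod_cast h3.trans (Nat.mul_le_mul_left _ h4)
    have hi0 : (i.factorial : ℝ) ≠ 0 := Nat.cast_ne_zero.2 (Nat.factorial_ne_zero _)
    calc _ ≤ (i.factorial * ((i + 1 + r + 1 : ℕ) : ℝ) ^ (r + 1)) *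
        ((sigma 0 q * (q : ℝ) ^ i) / i.factorial) / (q : ℝ) ^ (i + 1 + r) := by
          gcongr
          exact sigma_le i q
      _ = sigma 0 q * (((i + 1 + r + 1 : ℕ) : ℝ) / q) ^ (r + 1) := by
          rw [div_pow, show i + 1 + r = i + (r + 1) by omega, pow_add (q : ℝ)]
          field_simp
      _ ≤ sigma 0 q * ((((i + 1 + r + 1 : ℕ) : ℝ) / q) * (1 / 2) ^ r) := by
          gcongr
          exact pow_div_pow_le (Nat.cast_nonneg _) hq0 hm' r
      _ = _ := by ring
  refine (Finset.sum_le_sum h1).trans ?_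
  rw [← Finset.mul_sum]
  have h2 : ∑ i ∈ (m + 1).properDivisors, (1 / 2 : ℝ) ^ (m - i) ≤ 2 := by
    refine le_trans ?_ (sum_half_pow_le (m + 1))
    refine Finset.sum_le_sum_of_subset_of_nonneg (fun i hi => ?_) fun _ _ _ => by positivity
    exact Finset.mem_range.2 (Nat.mem_properDivisors.1 hi).2
  calc _ ≤ sigma 0 q * (((m + 1 : ℕ) : ℝ) / q) * 2 := by gcongr
    _ = _ := by ring

theorem invBound_zero (q : ℕ) : invBound q 0 = 1 := by rw [invBound]

/-- The recursion of `invBound` in normalized form. -/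
theorem normalized_invBound_succ (hq : q ≠ 0) (m : ℕ) :
    ((m + 1).factorial : ℝ) * invBound q (m + 1) / (q : ℝ) ^ m =
      (m.factorial : ℝ) * cycBound q (m + 1) / (q : ℝ) ^ m +
      (∑ i ∈ Finset.range m, (m.choose i : ℝ) *
        (((i.factorial : ℝ) * cycBound q (i + 1) / (q : ℝ) ^ i) *
          (((m - i).factorial : ℝ) * invBound q (m - i) / (q : ℝ) ^ (m - i - 1)))) / q := by
  have hq0 : (q : ℝ) ≠ 0 := Nat.cast_ne_zero.2 hq
  have h1 := invBound_succ q m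
  have h2 : ∑ j ∈ Finset.Icc 1 (m + 1), cycBound q j * invBound q (m + 1 - j) =
      ∑ i ∈ Finset.range (m + 1), cycBound q (i + 1) * invBound q (m - i) := by
    have h3 := Finset.sum_Ico_add' (fun j => cycBound q j * invBound q (m + 1 - j)) 0 (m + 1) 1
    simp only [Nat.add_sub_add_right] at h3
    rw [Finset.range_eq_Ico, h3]
    rfl
  rw [h2, Finset.sum_range_succ, Nat.sub_self, invBound_zero, mul_one] at h1
  rw [Nat.factorial_succ, Nat.cast_mul, mul_comm ((m + 1 : ℕ) : ℝ), mul_assoc, h1, mul_add, add_div,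
    add_comm, Finset.mul_sum, Finset.sum_div, Finset.sum_div]
  congr 1
  refine Finset.sum_congr rfl fun i hi => ?_
  rw [Finset.mem_range] at hi
  rw [← Nat.choose_mul_factorial_mul_factorial hi.le]
  obtain ⟨r, rfl⟩ : ∃ r, m = i + 1 + r := ⟨m - (i + 1), by omega⟩
  rw [show i + 1 + r - i = r + 1 by omega, Nat.add_sub_cancel]
  push_cast
  field_simp
  ring

/-- `q` is large compared with the number of its divisors and with `N`. The eighth power is enough
for `(3 σ_0(q)) ^ 3 (3/2) ^ N ≤ q`, since `(3/2) ^ 5 ≤ 2 ^ 3` and so `(3/2) ^ N ≤ q ^ (3/5)`. -/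
structure IsLarge (q N : ℕ) : Prop where
  ne_zero : q ≠ 0
  sigma_pow_le : (3 * (sigma 0 q : ℝ)) ^ 8 ≤ q
  two_pow_le : 2 ^ N ≤ q

namespace IsLarge
variable {N : ℕ}

theorem mul_le (h : IsLarge q N) : (9 * (sigma 0 q : ℝ) ^ 2) * N ≤ q := by
  have ht := one_le_sigma_zero h.ne_zero
  set t : ℝ := ((sigma 0 q : ℕ) : ℝ)
  have hN : (N : ℝ) ^ 2 ≤ 2 * q := by
    have := (sq_le_two_pow N).trans (Nat.mul_le_mul_left 2 h.two_pow_le)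
    exact_mod_cast this
  have h1 := h.sigma_pow_le
  have hq : (0 : ℝ) ≤ q := Nat.cast_nonneg q
  refine le_of_pow_le_pow_left₀ (n := 2) (by norm_num) hq ?_
  have h4 : (1 : ℝ) ≤ t ^ 4 := one_le_pow₀ ht
  have h5 : 162 * t ^ 4 ≤ (3 * t) ^ 8 := by nlinarith [sq_nonneg (t ^ 4)]
  calc ((9 * t ^ 2) * N) ^ 2 = 81 * t ^ 4 * N ^ 2 := by ring
    _ ≤ 81 * t ^ 4 * (2 * q) := by gcongr
    _ = 162 * t ^ 4 * q := by ring
    _ ≤ q * q := by gcongr; exact h5.trans h1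
    _ = (q : ℝ) ^ 2 := by ring

theorem pow_growth (h : IsLarge q N) {m : ℕ} (hm : m ≤ N) :
    (3 * (sigma 0 q : ℝ)) ^ 3 * 3 ^ m ≤ 2 ^ m * q := by
  have ht := one_le_sigma_zero h.ne_zero
  set t : ℝ := ((sigma 0 q : ℕ) : ℝ)
  have h1 := h.sigma_pow_le
  have hq : (0 : ℝ) ≤ q := Nat.cast_nonneg q
  have hq2 : (2 : ℝ) ^ m ≤ q := by
    have := (Nat.pow_le_pow_right (show 0 < 2 by norm_num) hm).trans h.two_pow_le
    exact_mod_cast this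
  refine le_of_pow_le_pow_left₀ (n := 5) (by norm_num) (by positivity) ?_
  have h3 : (1 : ℝ) ≤ 3 * t := by linarith
  calc ((3 * t) ^ 3 * 3 ^ m) ^ 5 = (3 * t) ^ 15 * 243 ^ m := by
        rw [mul_pow, ← pow_mul, ← pow_mul, mul_comm m 5, pow_mul 3 5 m]; norm_num
    _ ≤ (3 * t) ^ 16 * 256 ^ m := by
        gcongr
        · norm_num
        · norm_num
    _ = ((3 * t) ^ 8) ^ 2 * ((2 ^ m) ^ 5 * (2 ^ m) ^ 3) := by
        rw [← pow_mul, ← pow_add, ← pow_mul, mul_comm m (5 + 3), pow_mul 2 (5 + 3) m]; norm_num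
    _ ≤ (q : ℝ) ^ 2 * ((2 ^ m) ^ 5 * (q : ℝ) ^ 3) := by gcongr
    _ = (2 ^ m * q) ^ 5 := by ring

end IsLarge
end Asymptotics
end RootNumber

/-! ### Bounds for the mean numbers of invariant sets -/

namespace RootNumber
open ArithmeticFunction

section Bounds
variable {q : ℕ}

theorem cycBound_one (q : ℕ) : cycBound q 1 = sigma 0 q := by
  rw [cycBound_eq, Nat.divisors_one]
  simp

theorem cycBound_two (q : ℕ) : cycBound q 2 = sigma 0 q + sigma 1 q := by
  rw [cycBound_eq, show Nat.divisors 2 = {1, 2} from rfl, Finset.sum_pair (by norm_num)]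
  simp

theorem cycBound_three (q : ℕ) : cycBound q 3 = sigma 0 q + sigma 2 q / 2 := by
  rw [cycBound_eq, show Nat.divisors 3 = {1, 3} from rfl, Finset.sum_pair (by norm_num)]
  simp

theorem invBound_one (q : ℕ) : invBound q 1 = sigma 0 q := by
  have h := invBound_succ q 0
  simp [invBound_zero, cycBound_one] at h
  exact h

theorem invBound_two (q : ℕ) :
    invBound q 2 = ((sigma 0 q : ℝ) ^ 2 + sigma 0 q + sigma 1 q) / 2 := by
  have h := invBound_succ q 1
  rw [Finset.sum_Icc_succ_top (by norm_num)] at h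
  simp [invBound_zero, cycBound_one, cycBound_two, invBound_one] at h
  linarith

theorem invBound_three (q : ℕ) :
    invBound q 3 = ((sigma 0 q : ℝ) * (((sigma 0 q : ℝ) ^ 2 + sigma 0 q + sigma 1 q) / 2) +
      (sigma 0 q + sigma 1 q) * sigma 0 q + sigma 0 q + sigma 2 q / 2) / 3 := by
  have h := invBound_succ q 2
  rw [Finset.sum_Icc_succ_top (by norm_num), Finset.sum_Icc_succ_top (by norm_num)] at h
  simp [invBound_zero, cycBound_one, cycBound_two, cycBound_three, invBound_one,
    invBound_two] at h
  linarith

namespace IsLarge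
variable {N m : ℕ}

theorem two_mul_mul_le (h : IsLarge q N) {k : ℕ} (hk : k ≤ N) :
    2 * (sigma 0 q : ℝ) * k ≤ q := by
  have ht := one_le_sigma_zero h.ne_zero
  refine le_trans ?_ h.mul_le
  have hk' : (k : ℝ) ≤ N := by exact_mod_cast hk
  exact mul_le_mul (by nlinarith) hk' (Nat.cast_nonneg k) (by positivity)

theorem two_mul_le (h : IsLarge q N) {k : ℕ} (hk : k ≤ N) : 2 * k ≤ q := by
  have ht := one_le_sigma_zero h.ne_zero
  have h1 := h.two_mul_mul_le hk
  have h2 : (2 : ℝ) * k ≤ q := by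
    refine le_trans ?_ h1
    have : (0 : ℝ) ≤ k := Nat.cast_nonneg k
    nlinarith
  exact_mod_cast h2

theorem normalized_cycBound_le (h : IsLarge q N) {j : ℕ} (hj : j + 1 ≤ N) :
    (j.factorial : ℝ) * cycBound q (j + 1) / (q : ℝ) ^ j ≤
      (sigma j q : ℝ) / (q : ℝ) ^ j + 1 := by
  have hq0 : (0 : ℝ) < q := Nat.cast_pos.2 (Nat.pos_of_ne_zero h.ne_zero)
  refine (RootNumber.normalized_cycBound_le h.ne_zero (h.two_mul_le hj)).trans ?_
  gcongr
  rw [div_le_one₀ hq0]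
  exact h.two_mul_mul_le hj

theorem cycBound_le_three (h : IsLarge q N) {j : ℕ} (hj : 3 ≤ j) (hjN : j ≤ N) :
    ((j - 1).factorial : ℝ) * cycBound q j / (q : ℝ) ^ (j - 1) ≤ 3 := by
  obtain ⟨i, rfl⟩ : ∃ i, j = i + 1 := ⟨j - 1, by omega⟩
  rw [Nat.add_sub_cancel]
  have h1 := h.normalized_cycBound_le hjN
  have h2 := sigma_div_pow_le_two h.ne_zero (show 2 ≤ i by omega)
  linarith

/-- The invariant sets of size `m + 1`. The main term `σ_m(q)` stems from the sets that lie in a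
single cycle of a length that divides `q`. -/
theorem factorial_mul_invBound_le (h : IsLarge q (m + 1)) (hm : 3 ≤ m) :
    ((m + 1).factorial : ℝ) * invBound q (m + 1) ≤ sigma m q +
      (q : ℝ) ^ (m - 1) * (32 * ((m + 1 : ℕ) * sigma 0 q) + 22 * 2 ^ m) := by
  have hq := h.ne_zero
  have hq0 : (0 : ℝ) < q := Nat.cast_pos.2 (Nat.pos_of_ne_zero hq)
  have ht := one_le_sigma_zero hq
  have h1 := recursion_le_refined (q := (q : ℝ))
    (b := fun j => ((j - 1).factorial : ℝ) * cycBound q j / (q : ℝ) ^ (j - 1))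
    (p := fun j => (j.factorial : ℝ) * invBound q j / (q : ℝ) ^ (j - 1)) hm ht
    (w := (sigma 1 q : ℝ) / (q : ℝ) ^ 1) (by positivity) (sigma_div_pow_le hq 1)
    (sq_sigma_one_div_le hq) hq0
    (fun j => div_nonneg (mul_nonneg (Nat.cast_nonneg _) (cycBound_nonneg _ _)) (by positivity))
    (by simp [cycBound_one]) (h.normalized_cycBound_le (j := 1) (by omega))
    (fun j hj hj' => h.cycBound_le_three hj hj')
    (fun i hi => h.pow_growth hi.le) (fun k _ => normalized_invBound_succ hq k)
  simp only [Nat.add_sub_cancel] at h1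
  have h2 := RootNumber.normalized_cycBound_le hq (h.two_mul_le (k := m + 1) le_rfl)
  have h3 : ((m + 1).factorial : ℝ) * invBound q (m + 1) / (q : ℝ) ^ m ≤
      (sigma m q : ℝ) / (q : ℝ) ^ m + (32 * ((m + 1 : ℕ) * sigma 0 q) + 22 * 2 ^ m) / q := by
    refine h1.trans ((add_le_add h2 le_rfl).trans ?_)
    rw [add_assoc, ← add_div]
    refine add_le_add le_rfl (div_le_div_of_nonneg_right ?_ hq0.le)
    push_cast
    nlinarith
  rw [div_le_iff₀ (by positivity)] at h3
  refine h3.trans_eq ?_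
  obtain ⟨k, rfl⟩ : ∃ k, m = k + 1 := ⟨m - 1, by omega⟩
  rw [Nat.add_sub_cancel, pow_succ (q : ℝ) k]
  field_simp

/-- The contributions of the smaller invariant sets are absorbed by the error term. -/
theorem factorial_mul_sum_invBound_le (h : IsLarge q (m + 1)) (hm : 3 ≤ m) :
    ((m + 1).factorial : ℝ) * ∑ k ∈ Finset.range (m + 1), invBound q k ≤
      (q : ℝ) ^ (m - 1) * (6 * ((m + 1 : ℕ) * sigma 0 q) + 6 * 2 ^ m) := by
  have hq := h.ne_zero
  have hq0 : (0 : ℝ) < q := Nat.cast_pos.2 (Nat.pos_of_ne_zero hq)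
  have ht := one_le_sigma_zero hq
  set t : ℝ := ((sigma 0 q : ℕ) : ℝ) with ht_def
  have hbM : ∀ j, 1 ≤ j → j ≤ m + 1 →
      ((j - 1).factorial : ℝ) * cycBound q j / (q : ℝ) ^ (j - 1) ≤ 3 * t := by
    intro j hj hjm
    obtain ⟨i, rfl⟩ : ∃ i, j = i + 1 := ⟨j - 1, by omega⟩
    rw [Nat.add_sub_cancel]
    have h1 := h.normalized_cycBound_le hjm
    have h2 := sigma_div_pow_le hq i
    linarith
  have hcrude := recursion_le (q := (q : ℝ)) (N := m + 1) (M := 3 * t)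
    (b := fun j => ((j - 1).factorial : ℝ) * cycBound q j / (q : ℝ) ^ (j - 1))
    (p := fun j => (j.factorial : ℝ) * invBound q j / (q : ℝ) ^ (j - 1)) hq0 (by linarith)
    (fun j => div_nonneg (mul_nonneg (Nat.cast_nonneg _) (cycBound_nonneg _ _)) (by positivity))
    hbM (fun i hi => h.pow_growth hi.le) (fun k _ => normalized_invBound_succ hq k)
  set P : ℝ := 3 * t + (3 * t) ^ 2 * 2 ^ (m + 1) / q with hP
  have hP0 : 0 ≤ P := by positivity
  have hterm : ∀ i ∈ Finset.range m, ((m + 1).factorial : ℝ) * invBound q (i + 1) ≤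
      (q : ℝ) ^ (m - 1) * ((m + 1 : ℕ) * P) * (1 / 2) ^ (m - 1 - i) := by
    intro i hi
    rw [Finset.mem_range] at hi
    obtain ⟨r, rfl⟩ : ∃ r, m = i + 1 + r := ⟨m - (i + 1), by omega⟩
    have h1 := hcrude (i + 1) (by omega) (by omega)
    simp only [Nat.add_sub_cancel] at h1
    have h2 := hbM (i + 1) (by omega) (by omega)
    rw [Nat.add_sub_cancel] at h2
    have h3 : ((i + 1).factorial : ℝ) * invBound q (i + 1) / (q : ℝ) ^ i ≤ P := by
      refine h1.trans (add_le_add h2 ?_)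
      gcongr
      norm_num
    rw [div_le_iff₀ (by positivity)] at h3
    have h4 := factorial_le_mul_pow (show i + 1 ≤ i + 1 + r + 1 by omega)
    rw [show i + 1 + r + 1 - (i + 1) = r + 1 by omega] at h4
    have h4' : (((i + 1 + r + 1).factorial : ℕ) : ℝ) ≤
        (i + 1).factorial * ((i + 1 + r + 1 : ℕ) : ℝ) ^ (r + 1) := by exact_mod_cast h4
    have h5 := pow_div_pow_le (x := ((i + 1 + r + 1 : ℕ) : ℝ)) (y := (q : ℝ)) (Nat.cast_nonneg _)
      hq0 (by exact_mod_cast h.two_mul_le (k := i + 1 + r + 1) le_rfl) r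
    rw [show i + 1 + r - 1 = i + r by omega, Nat.add_sub_cancel_left]
    set D : ℝ := ((i + 1 + r + 1 : ℕ) : ℝ)
    have hD : 0 ≤ D := Nat.cast_nonneg _
    calc _ ≤ ((i + 1).factorial * D ^ (r + 1)) * invBound q (i + 1) :=
          mul_le_mul_of_nonneg_right h4' (invBound_nonneg _ _)
      _ = D ^ (r + 1) * ((i + 1).factorial * invBound q (i + 1)) := by ring
      _ ≤ D ^ (r + 1) * (P * (q : ℝ) ^ i) := mul_le_mul_of_nonneg_left h3 (by positivity)
      _ = (D / q) ^ (r + 1) * (P * (q : ℝ) ^ (i + r + 1)) := by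
          rw [div_pow, add_assoc, pow_add (q : ℝ) i]
          field_simp
      _ ≤ (D / q * (1 / 2) ^ r) * (P * (q : ℝ) ^ (i + r + 1)) :=
          mul_le_mul_of_nonneg_right h5 (by positivity)
      _ = _ := by
          rw [pow_succ (q : ℝ)]
          field_simp
  have hfac : ((m + 1).factorial : ℝ) ≤ (q : ℝ) ^ (m - 1) * 2 := by
    have h4 := factorial_le_mul_pow (show 2 ≤ m + 1 by omega)
    rw [show m + 1 - 2 = m - 1 by omega, Nat.factorial_two] at h4
    have h5 : (m + 1) ^ (m - 1) ≤ q ^ (m - 1) := by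
      have := h.two_mul_le (k := m + 1) le_rfl
      exact Nat.pow_le_pow_left (by omega) _
    have h6 : (m + 1).factorial ≤ q ^ (m - 1) * 2 := by
      rw [mul_comm]
      exact h4.trans (Nat.mul_le_mul_left _ h5)
    exact_mod_cast h6
  have hDP : ((m + 1 : ℕ) : ℝ) * P ≤ 3 * ((m + 1 : ℕ) * t) + 2 * 2 ^ m := by
    have h1 := h.mul_le
    have h2 : ((m + 1 : ℕ) : ℝ) * ((3 * t) ^ 2 * 2 ^ (m + 1) / q) ≤ 2 * 2 ^ m := by
      rw [mul_div_assoc', div_le_iff₀ hq0]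
      calc ((m + 1 : ℕ) : ℝ) * ((3 * t) ^ 2 * 2 ^ (m + 1)) =
          (9 * t ^ 2 * (m + 1 : ℕ)) * 2 ^ (m + 1) := by ring
        _ ≤ (q : ℝ) * 2 ^ (m + 1) := by gcongr
        _ = 2 * 2 ^ m * (q : ℝ) := by ring
    rw [hP, mul_add]
    linarith
  rw [Finset.sum_range_succ', mul_add, invBound_zero, mul_one, Finset.mul_sum]
  have hone : (1 : ℝ) ≤ 2 ^ m := one_le_pow₀ (by norm_num)
  calc _ ≤ (q : ℝ) ^ (m - 1) * ((m + 1 : ℕ) * P) * 2 + (q : ℝ) ^ (m - 1) * 2 := by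
        refine add_le_add ((Finset.sum_le_sum hterm).trans ?_) hfac
        rw [← Finset.mul_sum]
        gcongr
        exact sum_half_pow_le m
    _ = (q : ℝ) ^ (m - 1) * (2 * ((m + 1 : ℕ) * P) + 2) := by ring
    _ ≤ _ := by
        refine mul_le_mul_of_nonneg_left ?_ (by positivity)
        linarith

theorem sum_invBound_range_le (h : IsLarge q (m + 1)) (hm : 3 ≤ m) :
    ∑ k ∈ Finset.range (m + 2), invBound q k ≤ (sigma m q : ℝ) / (m + 1).factorial +
      38 * ((q : ℝ) ^ (m - 1) * ((m + 1 : ℕ) * sigma 0 q + 2 ^ (m + 1)) / (m + 1).factorial) := by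
  rw [mul_div_assoc', ← add_div, le_div_iff₀ (by positivity), mul_comm, Finset.sum_range_succ,
    mul_add]
  have h1 := h.factorial_mul_invBound_le hm
  have h2 := h.factorial_mul_sum_invBound_le hm
  have h3 : (0 : ℝ) ≤ (q : ℝ) ^ (m - 1) * 2 ^ m := by positivity
  rw [pow_succ (2 : ℝ) m]
  nlinarith

theorem sigma_sub_le (h : IsLarge q (m + 1)) (hm : 3 ≤ m) :
    (sigma m q : ℝ) / (m + 1).factorial -
      4 * ((q : ℝ) ^ (m - 1) * ((m + 1 : ℕ) * sigma 0 q + 2 ^ (m + 1)) / (m + 1).factorial) ≤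
      ((∑ d ∈ q.divisors, (d - 1).descFactorial m : ℕ) : ℝ) / (m + 1).factorial := by
  have hq := h.ne_zero
  have hq0 : (0 : ℝ) < q := Nat.cast_pos.2 (Nat.pos_of_ne_zero hq)
  rw [mul_div_assoc', ← sub_div]
  gcongr
  obtain ⟨k, rfl⟩ : ∃ k, m = k + 1 := ⟨m - 1, by omega⟩
  rw [Nat.add_sub_cancel]
  have h1 := sigma_sub_sum_descFactorial_le q k
  have h2 := sigma_div_pow_le_two hq (show 2 ≤ k by omega)
  rw [div_le_iff₀ (by positivity)] at h2
  have h3 : ((k : ℝ) + 1) ^ 2 ≤ 2 * 2 ^ (k + 1) := by exact_mod_cast sq_le_two_pow (k + 1)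
  have h4 : ((k : ℝ) + 1) ^ 2 * sigma k q ≤ 2 * 2 ^ (k + 1) * (2 * (q : ℝ) ^ k) := by gcongr
  have h5 : (0 : ℝ) ≤ (q : ℝ) ^ k * ((k + 1 + 1 : ℕ) * sigma 0 q) := by positivity
  have h6 : (0 : ℝ) ≤ (q : ℝ) ^ k * 2 ^ (k + 1) := by positivity
  rw [pow_succ (2 : ℝ) (k + 1)]
  nlinarith

theorem sq_le_sigma_one (h : IsLarge q N) : (sigma 0 q : ℝ) ^ 2 ≤ sigma 1 q := by
  have ht := one_le_sigma_zero h.ne_zero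
  refine le_trans ?_ (h.sigma_pow_le.trans (le_sigma_one h.ne_zero))
  calc (sigma 0 q : ℝ) ^ 2 ≤ (3 * (sigma 0 q : ℝ)) ^ 2 := by gcongr; linarith
    _ ≤ (3 * (sigma 0 q : ℝ)) ^ 8 := pow_le_pow_right₀ (by linarith) (by norm_num)

end IsLarge

theorem sum_invBound_range_two (q : ℕ) : ∑ k ∈ Finset.range 2, invBound q k = sigma 0 q + 1 := by
  rw [Finset.sum_range_succ, Finset.sum_range_one, invBound_zero, invBound_one, add_comm]

theorem sum_invBound_range_three_le (hq : q ≠ 0) : ∑ k ∈ Finset.range 3, invBound q k ≤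
    (sigma 1 q : ℝ) / 2 + 3 * (sigma 0 q : ℝ) ^ 2 := by
  have ht := one_le_sigma_zero hq
  rw [Finset.sum_range_succ, sum_invBound_range_two, invBound_two]
  nlinarith

theorem sigma_one_sub_le (hq : q ≠ 0) : (sigma 1 q : ℝ) / 2 - (sigma 0 q : ℝ) ^ 2 ≤
    ((∑ d ∈ q.divisors, (d - 1).descFactorial 1 : ℕ) : ℝ) / 2 := by
  have ht := one_le_sigma_zero hq
  have h1 := sigma_sub_sum_descFactorial_le q 0
  norm_num at h1 ⊢
  nlinarith

theorem sum_invBound_range_four_le {N : ℕ} (h : IsLarge q N) : ∑ k ∈ Finset.range 4, invBound q k ≤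
    (sigma 2 q : ℝ) / 6 + 5 * ((sigma 0 q : ℝ) * sigma 1 q) := by
  have ht := one_le_sigma_zero h.ne_zero
  have h1 := h.sq_le_sigma_one
  rw [Finset.sum_range_succ, Finset.sum_range_succ, sum_invBound_range_two, invBound_two,
    invBound_three]
  set t : ℝ := ((sigma 0 q : ℕ) : ℝ)
  set s : ℝ := ((sigma 1 q : ℕ) : ℝ)
  have h2 : t ^ 2 * t ≤ s * t := mul_le_mul_of_nonneg_right h1 (by linarith)
  have h3 : 1 * s ≤ t * s := mul_le_mul_of_nonneg_right ht (by nlinarith)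
  have h4 : t * 1 ≤ t * s := mul_le_mul_of_nonneg_left (by nlinarith) (by linarith)
  nlinarith

theorem sigma_two_sub_le (hq : q ≠ 0) : (sigma 2 q : ℝ) / 6 - (sigma 0 q : ℝ) * sigma 1 q ≤
    ((∑ d ∈ q.divisors, (d - 1).descFactorial 2 : ℕ) : ℝ) / 6 := by
  have ht := one_le_sigma_zero hq
  have h1 := sigma_sub_sum_descFactorial_le q 1
  have h2 : (0 : ℝ) ≤ sigma 1 q := Nat.cast_nonneg _
  norm_num at h1 ⊢
  nlinarith

theorem exists_isLarge : ∃ q₀ : ℕ, ∀ q, q₀ ≤ q → ∀ Δ : ℕ,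
    (Δ : ℝ) ≤ Real.log q / Real.log 2 → IsLarge q Δ := by
  -- twice the exponent that is needed, so that the constant is absorbed for large `q`
  obtain ⟨C, hC, h⟩ := exists_sigma_zero_pow_le 16
  refine ⟨⌈3 ^ 16 * C⌉₊ + 1, fun q hq Δ hΔ => ?_⟩
  have hq0 : q ≠ 0 := by omega
  have hqpos : (0 : ℝ) < q := Nat.cast_pos.2 (Nat.pos_of_ne_zero hq0)
  refine ⟨hq0, ?_, ?_⟩
  · refine le_of_pow_le_pow_left₀ (n := 2) (by norm_num) hqpos.le ?_
    have h1 : 3 ^ 16 * C ≤ q :=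
      (Nat.le_ceil _).trans (by exact_mod_cast (show ⌈3 ^ 16 * C⌉₊ ≤ q by omega))
    calc ((3 * (sigma 0 q : ℝ)) ^ 8) ^ 2 = 3 ^ 16 * (sigma 0 q : ℝ) ^ 16 := by
          rw [← pow_mul, mul_pow]
      _ ≤ 3 ^ 16 * (C * q) := by gcongr; exact h q hq0
      _ = (3 ^ 16 * C) * q := by ring
      _ ≤ q * q := by gcongr
      _ = (q : ℝ) ^ 2 := by ring
  · rw [le_div_iff₀ (Real.log_pos (by norm_num)), ← Real.log_pow] at hΔ
    have h2 := (Real.log_le_log_iff (by positivity) hqpos).1 hΔ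
    exact_mod_cast h2

end Bounds
end RootNumber

/-! ### The multiplicity -/

namespace RootNumber
open ArithmeticFunction

section Multiplicity

/-- The multiplicity is the mean value of `χ_λ (σ ^ q)`. -/
theorem multiplicity_eq (q : ℕ) {n : ℕ} (lam : n.Partition) :
    multiplicity q lam =
      (n.factorial : ℂ)⁻¹ * ∑ s : Equiv.Perm (Fin n), chi lam (s ^ q) := by
  classical
  rw [multiplicity, innerProd, Fintype.card_perm, Fintype.card_fin]
  congr 1
  have h1 : ∀ p : Equiv.Perm (Fin n), (rootNumber n q p : ℂ) * (starRingEnd ℂ) (chi lam p) =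
      ∑ s : Equiv.Perm (Fin n), if s ^ q = p then chi lam p else 0 := by
    intro p
    rw [rootNumber, Nat.card_eq_fintype_card, Fintype.card_subtype, conj_chi,
      ← Finset.sum_filter, Finset.sum_const, nsmul_eq_mul]
  simp only [h1]
  rw [Finset.sum_comm]
  simp

theorem rows_eq_cons {n Δ : ℕ} {lam : n.Partition} {mu : Δ.Partition}
    (hn : n ≠ 0) (h : (rows lam).tail = rows mu) : ∃ m, n = m + Δ ∧ rows lam = m :: rows mu := by
  cases hl : rows lam with
  | nil =>
    have := rows_sum lam
    rw [hl] at this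
    exact absurd this.symm hn
  | cons m l =>
    rw [hl, List.tail_cons] at h
    have h1 := rows_sum lam
    rw [hl, h, List.sum_cons, rows_sum mu] at h1
    exact ⟨m, h1.symm, by rw [h]⟩

/-- The multiplicity is close to `χ_μ(1) Q`, where `Q` is the mean value of
`(fixed points of σ ^ q choose k + 1)`, and `Q` lies between the two bounds of the hypotheses. The
difference is bounded by the mean number of invariant sets other than sets of fixed points. -/
theorem norm_multiplicity_sub_le {q k n : ℕ} (hq : 2 ≤ q) (hn : (k + 1) * q ≤ n)
    {lam : n.Partition} {mu : (k + 1).Partition} (h : (rows lam).tail = rows mu)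
    {A E : ℝ} (hE : 0 ≤ E)
    (hU : ∑ i ∈ Finset.range (k + 2), invBound q i ≤ A + E)
    (hL : A - E ≤ ((∑ d ∈ q.divisors, (d - 1).descFactorial k : ℕ) : ℝ) / (k + 1).factorial) :
    ‖multiplicity q lam - chi mu 1 * A‖ ≤ ‖chi mu 1‖ * (4 * E) := by
  have hkq : k + 1 + (k + 1) ≤ n := by nlinarith
  have hchi : ∀ s, chi lam s = charPoly (chi mu) s := by
    obtain ⟨m, rfl, hrows⟩ := rows_eq_cons (by omega) h
    exact chi_eq_charPoly hrows (by omega)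
  have hfac : (0 : ℝ) < n.factorial := Nat.cast_pos.2 (Nat.factorial_pos _)
  have hfac' : (n.factorial : ℂ) ≠ 0 := Nat.cast_ne_zero.2 (Nat.factorial_ne_zero _)
  set e : Equiv.Perm (Fin n) → ℝ := fun s =>
    ((k + 1).factorial : ℝ)⁻¹ * embCount (1 : Equiv.Perm (Fin (k + 1))) (s ^ q) with he
  set Q : ℝ := (n.factorial : ℝ)⁻¹ * ∑ s, e s with hQ
  have hQle : (n.factorial : ℝ) * Q = ∑ s, e s := by
    rw [hQ, mul_inv_cancel_left₀ hfac.ne']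
  have hlow : ((∑ d ∈ q.divisors, (d - 1).descFactorial k : ℕ) : ℝ) / (k + 1).factorial ≤ Q := by
    have h1 := le_sum_embCount_one (q := q) (n := n) (k := k) (by omega) (by nlinarith)
    have h2 : (n.factorial : ℝ) * ((∑ d ∈ q.divisors, (d - 1).descFactorial k : ℕ) : ℝ) ≤
        ∑ s : Equiv.Perm (Fin n), (embCount (1 : Equiv.Perm (Fin (k + 1))) (s ^ q) : ℝ) := by
      exact_mod_cast h1
    refine le_of_mul_le_mul_left ?_ hfac
    rw [hQle, he, ← Finset.mul_sum, mul_div_assoc', div_eq_inv_mul]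
    exact mul_le_mul_of_nonneg_left h2 (by positivity)
  have hpt : ∀ s : Equiv.Perm (Fin n), ‖chi lam (s ^ q) - chi mu 1 * (e s : ℂ)‖ ≤
      ‖chi mu 1‖ * (∑ i ∈ Finset.range (k + 2), (invCount (s ^ q) i : ℝ) - e s) := by
    intro s
    have h1 := norm_charPoly_sub_le (norm_chi_le mu) (s ^ q)
    rw [Fintype.card_fin, ← hchi] at h1
    have h2 : (e s : ℂ) =
        ((k + 1).factorial : ℂ)⁻¹ * embCount (1 : Equiv.Perm (Fin (k + 1))) (s ^ q) := by
      rw [he, Complex.ofReal_mul, Complex.ofReal_inv, Complex.ofReal_natCast,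
        Complex.ofReal_natCast]
    have h3 : e s =
        ((k + 1).factorial : ℝ)⁻¹ * embCount (1 : Equiv.Perm (Fin (k + 1))) (s ^ q) := rfl
    rw [h2, h3]
    exact h1
  have hmain : ‖multiplicity q lam - chi mu 1 * Q‖ ≤
      ‖chi mu 1‖ * (∑ i ∈ Finset.range (k + 2), invBound q i - Q) := by
    have h1 : multiplicity q lam - chi mu 1 * Q =
        (n.factorial : ℂ)⁻¹ * ∑ s, (chi lam (s ^ q) - chi mu 1 * (e s : ℂ)) := by
      rw [multiplicity_eq, hQ, Finset.sum_sub_distrib, Complex.ofReal_mul, Complex.ofReal_sum,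
        Complex.ofReal_inv, Complex.ofReal_natCast, ← Finset.mul_sum, mul_sub, mul_left_comm]
    rw [h1, norm_mul, norm_inv, Complex.norm_natCast, inv_mul_le_iff₀ hfac]
    refine (norm_sum_le _ _).trans ((Finset.sum_le_sum fun s _ => hpt s).trans ?_)
    rw [← Finset.mul_sum, mul_left_comm]
    refine mul_le_mul_of_nonneg_left ?_ (norm_nonneg _)
    rw [Finset.sum_sub_distrib, mul_sub, hQle, Finset.sum_comm, Finset.mul_sum]
    refine sub_le_sub_right (Finset.sum_le_sum fun i _ => ?_) _
    exact sum_invCount_le (by omega) i n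
  have hf := norm_nonneg (chi mu 1)
  have hQU : 0 ≤ ‖chi mu 1‖ * (∑ i ∈ Finset.range (k + 2), invBound q i - Q) :=
    (norm_nonneg _).trans hmain
  have hdiff : ‖chi mu 1 * Q - chi mu 1 * A‖ = ‖chi mu 1‖ * |Q - A| := by
    rw [← mul_sub, norm_mul, ← Complex.ofReal_sub, Complex.norm_real, Real.norm_eq_abs]
  have htri := norm_sub_le_norm_sub_add_norm_sub (multiplicity q lam) (chi mu 1 * Q) (chi mu 1 * A)
  rw [hdiff] at htri
  refine htri.trans ((add_le_add_left hmain _).trans ?_)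
  rw [← mul_add]
  -- if `χ_μ(1) = 0`, there is no upper bound for `Q`, but nothing to show either
  by_cases hf0 : ‖chi mu 1‖ = 0
  · rw [hf0, zero_mul, zero_mul]
  have hfpos : 0 < ‖chi mu 1‖ := lt_of_le_of_ne hf (Ne.symm hf0)
  have hQU' := nonneg_of_mul_nonneg_right hQU hfpos
  refine mul_le_mul_of_nonneg_left ?_ hf
  have habs : |Q - A| ≤ E := abs_le.2 ⟨by linarith, by linarith⟩
  linarith

theorem finrank_specht_sq_le {n : ℕ} (mu : n.Partition) :
    Module.finrank ℂ (Specht mu) ^ 2 ≤ n.factorial := by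
  have h := sum_chi_mul_chi mu
  have h1 : ∀ g, chi mu g * chi mu g = ((‖chi mu g‖ ^ 2 : ℝ) : ℂ) := by
    intro g
    rw [← Complex.normSq_eq_norm_sq, ← Complex.mul_conj, conj_chi]
  simp only [h1] at h
  rw [← Complex.ofReal_sum] at h
  have h2 : ∑ g, ‖chi mu g‖ ^ 2 = (n.factorial : ℝ) := by exact_mod_cast h
  have h3 := Finset.single_le_sum (f := fun g => ‖chi mu g‖ ^ 2) (fun _ _ => by positivity)
    (Finset.mem_univ 1)
  rw [h2] at h3
  simp only [chi_one, Complex.norm_natCast] at h3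
  exact_mod_cast h3

/-- A vanishing degree would make the whole character vanish. -/
theorem finrank_specht_pos {n : ℕ} (mu : n.Partition) : 0 < Module.finrank ℂ (Specht mu) := by
  rw [Nat.pos_iff_ne_zero]
  intro h0
  have h := sum_chi_mul_chi mu
  have h1 : ∀ g, chi mu g = 0 := by
    intro g
    have := norm_chi_le mu g
    rw [chi_one, h0, Nat.cast_zero, norm_zero] at this
    exact norm_le_zero_iff.1 this
  simp only [h1, mul_zero, Finset.sum_const_zero] at h
  exact Nat.factorial_ne_zero n (by exact_mod_cast h.symm)

theorem chi_one_eq_one {n : ℕ} (mu : n.Partition) (hn : n ≤ 2) : chi mu 1 = 1 := by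
  have h1 := finrank_specht_sq_le mu
  have h2 := finrank_specht_pos mu
  have h3 : n.factorial ≤ 2 := (Nat.factorial_le hn).trans_eq rfl
  rw [chi_one]
  have : Module.finrank ℂ (Specht mu) = 1 := by nlinarith
  rw [this, Nat.cast_one]

theorem norm_chi_one_le_two (mu : Nat.Partition 3) : ‖chi mu 1‖ ≤ 2 := by
  have h1 := finrank_specht_sq_le mu
  rw [chi_one, Complex.norm_natCast]
  have h3 : Nat.factorial 3 = 6 := rfl
  have : Module.finrank ℂ (Specht mu) ≤ 2 := by nlinarith
  exact_mod_cast this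

end Multiplicity
end RootNumber

theorem theorem1 :
    ∃ (C : ℝ) (q₀ : ℕ), ∀ q : ℕ, q₀ ≤ q →
      ∀ Δ : ℕ, (Δ : ℝ) ≤ Real.log q / Real.log 2 →
      ∀ n : ℕ, Δ * q ≤ n →
      ∀ (lam : n.Partition) (mu : Δ.Partition),
        (RootNumber.rows lam).tail = RootNumber.rows mu →
        (Δ = 1 →
          ‖RootNumber.multiplicity q lam - (ArithmeticFunction.sigma 0 q : ℂ)‖ ≤ C) ∧
        (Δ = 2 →
          ‖RootNumber.multiplicity q lam - 1 / 2 * (ArithmeticFunction.sigma 1 q : ℂ)‖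
            ≤ C * (ArithmeticFunction.sigma 0 q : ℝ) ^ 2) ∧
        (Δ = 3 →
          ‖RootNumber.multiplicity q lam
              - RootNumber.chi mu 1 / 6 * (ArithmeticFunction.sigma 2 q : ℂ)‖
            ≤ C * ((ArithmeticFunction.sigma 0 q : ℝ) * (ArithmeticFunction.sigma 1 q : ℝ))) ∧
        (4 ≤ Δ →
          ‖RootNumber.multiplicity q lam
              - RootNumber.chi mu 1 / (Nat.factorial Δ : ℂ)
                * (ArithmeticFunction.sigma (Δ - 1) q : ℂ)‖
            ≤ C * (‖RootNumber.chi mu 1‖ / (Nat.factorial Δ : ℝ) * (q : ℝ) ^ (Δ - 2)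
                * ((Δ : ℝ) * (ArithmeticFunction.sigma 0 q : ℝ) + 2 ^ Δ))) := by
  obtain ⟨q₀, hq₀⟩ := RootNumber.exists_isLarge
  -- `152 = 4 * 38`, with the constant of `sum_invBound_range_le`; the other cases need less
  refine ⟨152, q₀, fun q hq Δ hΔ n hn lam mu hrows => ?_⟩
  have hlarge := hq₀ q hq Δ hΔ
  have hq2 : 1 ≤ Δ → 2 ≤ q := fun h =>
    (Nat.pow_le_pow_right (show 0 < 2 by norm_num) h).trans hlarge.two_pow_le
  have ht : (1 : ℝ) ≤ (ArithmeticFunction.sigma 0 q : ℝ) :=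
    RootNumber.one_le_sigma_zero hlarge.ne_zero
  refine ⟨?_, ?_, ?_, ?_⟩
  · rintro rfl
    have h := RootNumber.norm_multiplicity_sub_le (k := 0) (E := 1) (hq2 le_rfl) hn hrows
      zero_le_one (RootNumber.sum_invBound_range_two q).le
      (by simp [ArithmeticFunction.sigma_zero_apply])
    rw [RootNumber.chi_one_eq_one mu (by norm_num), one_mul, norm_one] at h
    rw [Complex.ofReal_natCast] at h
    linarith
  · rintro rfl
    have h := RootNumber.norm_multiplicity_sub_le (k := 1)
      (A := (ArithmeticFunction.sigma 1 q : ℝ) / 2)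
      (E := 3 * (ArithmeticFunction.sigma 0 q : ℝ) ^ 2) (hq2 one_le_two) hn hrows (by positivity)
      (RootNumber.sum_invBound_range_three_le hlarge.ne_zero) (by
        refine le_trans ?_ (RootNumber.sigma_one_sub_le hlarge.ne_zero)
        nlinarith)
    rw [RootNumber.chi_one_eq_one mu le_rfl, one_mul, norm_one] at h
    rw [one_div_mul_eq_div]
    push_cast at h
    refine h.trans ?_
    nlinarith
  · rintro rfl
    have h := RootNumber.norm_multiplicity_sub_le (k := 2)
      (A := (ArithmeticFunction.sigma 2 q : ℝ) / 6)
      (E := 5 * ((ArithmeticFunction.sigma 0 q : ℝ) * ArithmeticFunction.sigma 1 q))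
      (hq2 (by norm_num)) hn hrows (by positivity)
      (RootNumber.sum_invBound_range_four_le hlarge) (by
        refine le_trans ?_ (RootNumber.sigma_two_sub_le hlarge.ne_zero)
        have : (0 : ℝ) ≤ (ArithmeticFunction.sigma 0 q : ℝ) * ArithmeticFunction.sigma 1 q := by
          positivity
        linarith)
    have hf := RootNumber.norm_chi_one_le_two mu
    rw [div_mul_eq_mul_div, mul_div_assoc]
    push_cast at h
    refine h.trans ?_
    have h0 : (0 : ℝ) ≤ (ArithmeticFunction.sigma 0 q : ℝ) * ArithmeticFunction.sigma 1 q := by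
      positivity
    nlinarith
  · intro hΔ4
    obtain ⟨m, rfl⟩ : ∃ m, Δ = m + 1 := ⟨Δ - 1, by omega⟩
    have hm : 3 ≤ m := by omega
    set B : ℝ := (q : ℝ) ^ (m - 1) * ((m + 1 : ℕ) * ArithmeticFunction.sigma 0 q + 2 ^ (m + 1)) /
      (m + 1).factorial with hB
    have hB0 : 0 ≤ B := by positivity
    have h := RootNumber.norm_multiplicity_sub_le (k := m)
      (A := (ArithmeticFunction.sigma m q : ℝ) / (m + 1).factorial) (E := 38 * B)
      (hq2 (by omega)) hn hrows (by positivity) (hlarge.sum_invBound_range_le hm)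
      (le_trans (by linarith) (hlarge.sigma_sub_le hm))
    rw [Nat.add_sub_cancel, show m + 1 - 2 = m - 1 by omega, div_mul_eq_mul_div, mul_div_assoc]
    push_cast at h ⊢
    refine h.trans_eq ?_
    rw [hB]
    push_cast
    ring
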